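/- \textbf{Theorem (Local supercritical bifurcation modulo translations).} Let $\nu>0$ and let $K\in C^\infty(\mathbb T^d)$, $\mathbb T^d=(\mathbb R/\mathbb Z)^d$, be real, even and of zero mean, with Fourier coefficients $\widehat K(\xi)=\int_{\mathbb T^d} K(x)e^{-2\pi i\xi\cdot x}\,dx$. For $\gamma\in\mathbb R$ consider classical ($C^2$) solutions $(\phi,m,\lambda)$ of the stationary mean-field game system $$-\nu\Delta\phi+\tfrac12|\nabla\phi|^2=\gamma K*m-\lambda,\qquad -\nu\Delta m-\operatorname{div}(m\nabla\phi)=0,\qquad \int_{\mathbb T^d} m=1,\quad \int_{\mathbb T^d}\phi=0, \tag{SMFG}$$ which has the trivial solution $(0,1,0)$. Put $$\gamma_c=\inf_{\xi\in\mathbb Z^d\setminus\{0\},\ \widehat K(\xi)<0}\frac{\nu^2(2\pi|\xi|)^2}{|\widehat K(\xi)|}$$ ($+\infty$ if there is no such $\xi$), and assume: (a) (Simple critical pair) $\gamma_c<\infty$, and the frequencies attaining this infimum are exactly $\pm\xi_0$ for some $\xi_0\neq0$. (b) (Nondegenerate cubic reduced equation) Write $\Phi_\gamma(\mu,w,\lambda)=\bigl(-\nu\Delta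 w+\tfrac12|\nabla w|^2-\gamma K*\mu+\lambda,\ -\nu\Delta\mu-\operatorname{div}((1+\mu)\nabla w)\bigr)$, $c(x)=\cos(2\pi\xi_0\cdot x)$, and $\ell(f,g)=\tfrac{2}{1+\nu^2}\int_{\mathbb T^d}(f-\nu g)\,c\,dx$, so that $\ell(c,-\nu c)=1$. A triple $(\mu,w,\lambda)$ of two $C^2$ functions of zero mean and a real number, with $\int\mu\sin(2\pi\xi_0\cdot x)\,dx=0$, solves the complement equation at $(A,\gamma)$ if $\ell(\mu,w)=A$ and $\Phi_\gamma(\mu,w,\lambda)=r\,(c,-\nu c)$ with $r=\ell(\Phi_\gamma(\mu,w,\lambda))$. There are $\alpha,\beta>0$ and $C$ such that, for all $(A,\gamma)$ near $(0,\gamma_c)$ and all solutions $(\mu,w,\lambda)$ of the complement equation at $(A,\gamma)$ that are small in $C^2\times C^2\times\mathbb R$, $$\bigl|r-\alpha(\gamma-\gamma_c)A+\beta A^3\bigr|\le C\bigl(|\gamma-\gamma_c|^2|A|+|\gamma-\gamma_c||A|^3+|A|^5\bigr).$$ Then there are $\delta>0$, a neighbourhood $\mathcal U=\{\phi,\ m-1,\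 \lambda \text{ smaller than } \varepsilon \text{ in } C^2\times C^2\times\mathbb R\}$ of $(0,1,0)$, and a family $(\phi_\gamma,m_\gamma,\lambda_\gamma)\in\mathcal U$, $\gamma\in(\gamma_c,\gamma_c+\delta)$, of solutions of (SMFG) with $m_\gamma\not\equiv1$, such that: 1. (Branch) $\phi_\gamma(x)$ and $m_\gamma(x)$ are $C^\infty$ in $(\gamma,x)$, $\lambda_\gamma$ is $C^\infty$ in $\gamma$, the phase conditions $\int (m_\gamma-1)\sin(2\pi\xi_0\cdot x)\,dx=0$ and $\int (m_\gamma-1)\cos(2\pi\xi_0\cdot x)\,dx\ge0$ hold, and $(\phi_\gamma,m_\gamma,\lambda_\gamma)\to(0,1,0)$ in $H^s\times H^s\times\mathbb R$ for every $s\ge0$ as $\gamma\downarrow\gamma_c$. 2. (Expansion) With $A(\gamma)=\ell(m_\gamma-1,\phi_\gamma)>0$, which is $C^\infty$ on $(\gamma_c,\gamma_c+\delta)$, $$m_\gamma(x)=1+A(\gamma)\cos(2\pi\xi_0\cdot x)+R_\gamma(x),\qquad A(\gamma)=\sqrt{\tfrac{\alpha}{\beta}}\sqrt{\gamma-\gamma_c}+O(\gamma-\gamma_c),\qquad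 \|R_\gamma\|_{H^s}=O(\gamma-\gamma_c)$$ as $\gamma\downarrow\gamma_c$, for every $s\ge0$. 3. (Local uniqueness) For $\gamma\in(\gamma_c,\gamma_c+\delta)$, $(\phi_\gamma,m_\gamma,\lambda_\gamma)$ is the only solution of (SMFG) in $\mathcal U$ with $m\not\equiv1$ that satisfies both phase conditions. 4. (Translations) For $\gamma\in(\gamma_c,\gamma_c+\delta)$ and $\tau\in\mathbb T^d$, $(\phi_\gamma(\cdot+\tau),m_\gamma(\cdot+\tau),\lambda_\gamma)$ solves (SMFG) and $m_\gamma(x+\tau)>0$ for all $x$; every solution of (SMFG) in $\mathcal U$ with $m\not\equiv1$ is of this form. 5. (Pitchfork) If $\xi_0\cdot\tau\in\tfrac12+\mathbb Z$, then the translate of $(\phi_\gamma,m_\gamma,\lambda_\gamma)$ by $\tau$ satisfies the sine condition and has amplitude $\ell=-A(\gamma)$; the branch and this translate are the only solutions in $\mathcal U$ with $m\not\equiv1$ that satisfy the sine condition. Moreover, for some $\eta>0$ and all $|A|<\eta$, $|\gamma-\gamma_c|<\delta$, the complement equation at $(A,\gamma)$ has a solution with $(w,1+\mu,\lambda)\in\mathcal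 U$, and $r=\Psi(A,\gamma)$ is the same for all of them; $\Psi(\cdot,\gamma)$ is odd; for $\gamma\le\gamma_c$ its only zero in $(-\eta,\eta)$ is $0$; and for $\gamma>\gamma_c$ one has $A(\gamma)<\eta$ and its zeros in $(-\eta,\eta)$ are exactly $0$, $A(\gamma)$ and $-A(\gamma)$. -/

import Mathlib

open MeasureTheory Filter Topology Set
open scoped ContDiff ENNReal

noncomputable section

namespace MFGTorus

variable {d : ℕ}

/-- Functions on the flat torus `(ℝ/ℤ)^d` are `ℤ^d`-periodic functions on this space. -/
abbrev Space (d : ℕ) : Type := EuclideanSpace ℝ (Fin d)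

/-- An integer frequency as a vector of `ℝ^d`. -/
def latt (ξ : Fin d → ℤ) : Space d := WithLp.toLp 2 (fun i => (ξ i : ℝ))

/-- `ℤ^d`-periodicity. -/
def IsPeriodic (f : Space d → ℝ) : Prop :=
  ∀ (n : Fin d → ℤ) (x : Space d), f (x + latt n) = f x

/-- The fundamental cell `[0,1)^d`. -/
def cell (d : ℕ) : Set (Space d) := {x | ∀ i, x i ∈ Ico (0 : ℝ) 1}

/-- Integral over the torus. -/
def torusIntegral (f : Space d → ℝ) : ℝ := ∫ x in cell d, f x

/-- The phase `2π ξ·x`. -/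
def phase (ξ : Fin d → ℤ) (x : Space d) : ℝ := 2 * Real.pi * inner ℝ (latt ξ) x

/-- `cos (2π ξ·x)`. -/
def cosMode (ξ : Fin d → ℤ) (x : Space d) : ℝ := Real.cos (phase ξ x)

/-- `sin (2π ξ·x)`. -/
def sinMode (ξ : Fin d → ℤ) (x : Space d) : ℝ := Real.sin (phase ξ x)

/-- The Fourier coefficient `∫ f(x) exp(-2πi ξ·x) dx`. -/
def fourierCoef (f : Space d → ℝ) (ξ : Fin d → ℤ) : ℂ :=
  ∫ x in cell d, (f x : ℂ) * Complex.exp (-(phase ξ x : ℂ) * Complex.I)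

/-- The `H^s` norm of a function on the torus, with value `∞` when it is not finite. -/
def sobolevNorm (s : ℝ) (f : Space d → ℝ) : ℝ≥0∞ :=
  (∑' ξ : Fin d → ℤ,
    ENNReal.ofReal ((1 + (2 * Real.pi * ‖latt ξ‖) ^ 2) ^ s * ‖fourierCoef f ξ‖ ^ 2)) ^ (1 / 2 : ℝ)

/-- Convolution on the torus. -/
def conv (K f : Space d → ℝ) (x : Space d) : ℝ := torusIntegral (fun y => K (x - y) * f y)

/-- Divergence of a vector field. -/
def divergence (F : Space d → Space d) (x : Space d) : ℝ :=
  ∑ i, (fderiv ℝ F x (EuclideanSpace.single i 1)) i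

/-- Smooth, periodic, even kernels with zero mean. -/
structure IsKernel (K : Space d → ℝ) : Prop where
  smooth : ContDiff ℝ ∞ K
  periodic : IsPeriodic K
  even : ∀ x, K (-x) = K x
  mean_zero : torusIntegral K = 0

/-- The Fourier coefficient of an even real kernel, which is a real number. -/
def kernelCoef (K : Space d → ℝ) (ξ : Fin d → ℤ) : ℝ := (fourierCoef K ξ).re

/-- The coupling `ν² (2π|ξ|)² / |K̂(ξ)|` at which the mode `ξ` becomes neutral. -/
def modeThreshold (ν : ℝ) (K : Space d → ℝ) (ξ : Fin d → ℤ) : ℝ :=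
  ν ^ 2 * (2 * Real.pi * ‖latt ξ‖) ^ 2 / |kernelCoef K ξ|

/-- The critical coupling, equal to `+∞` when no nonzero mode has `K̂(ξ) < 0`. -/
def criticalCoupling (ν : ℝ) (K : Space d → ℝ) : EReal :=
  ⨅ (ξ : Fin d → ℤ) (_ : ξ ≠ 0 ∧ kernelCoef K ξ < 0), (modeThreshold ν K ξ : EReal)

/-- The set of critical modes. -/
def criticalSet (ν : ℝ) (K : Space d → ℝ) : Set (Fin d → ℤ) :=
  {ξ | ξ ≠ 0 ∧ kernelCoef K ξ < 0 ∧ (modeThreshold ν K ξ : EReal) = criticalCoupling ν K}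

/-- Critical-mode hypothesis: `γc < ∞` is the critical coupling and `±ξ₀` are the only
critical modes. -/
structure SimpleCriticalPair (ν : ℝ) (K : Space d → ℝ) (γc : ℝ) (ξ₀ : Fin d → ℤ) : Prop where
  coupling : criticalCoupling ν K = (γc : EReal)
  ne_zero : ξ₀ ≠ 0
  modes : criticalSet ν K = {ξ₀, -ξ₀}

/-- First component (Hamilton-Jacobi-Bellman) of the stationary operator at `(μ, w, l)`,
where `m = 1 + μ`. -/
def hjbOp (ν : ℝ) (K : Space d → ℝ) (γ : ℝ) (μ w : Space d → ℝ) (l : ℝ) (x : Space d) : ℝ :=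
  -ν * Laplacian.laplacian w x + (1 / 2) * ‖gradient w x‖ ^ 2 - γ * conv K μ x + l

/-- Second component (Fokker-Planck) of the stationary operator. -/
def fpOp (ν : ℝ) (μ w : Space d → ℝ) (x : Space d) : ℝ :=
  -ν * Laplacian.laplacian μ x - divergence (fun y => (1 + μ y) • gradient w y) x

/-- Classical solutions `(φ, m, l)` of the stationary mean-field game system. -/
structure IsStationary (ν : ℝ) (K : Space d → ℝ) (γ : ℝ) (φ m : Space d → ℝ) (l : ℝ) : Prop where
  contDiff_phi : ContDiff ℝ 2 φ
  contDiff_m : ContDiff ℝ 2 m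
  periodic_phi : IsPeriodic φ
  periodic_m : IsPeriodic m
  hjb : ∀ x, -ν * Laplacian.laplacian φ x + (1 / 2) * ‖gradient φ x‖ ^ 2 = γ * conv K m x - l
  fp : ∀ x, -ν * Laplacian.laplacian m x - divergence (fun y => m y • gradient φ y) x = 0
  mass : torusIntegral m = 1
  mean_phi : torusIntegral φ = 0

/-- `‖f‖_{C²} < ε`, in the sense that `f` and its derivatives of order at most two are
everywhere smaller than `ε`. -/
def C2Small (ε : ℝ) (f : Space d → ℝ) : Prop :=
  ∀ k : ℕ, k ≤ 2 → ∀ x, ‖iteratedFDeriv ℝ k f x‖ < ε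

/-- The triple `(φ, m, l)` is `ε`-close to the uniform equilibrium `(0, 1, 0)`. -/
def NearUniform (ε : ℝ) (φ m : Space d → ℝ) (l : ℝ) : Prop :=
  C2Small ε φ ∧ C2Small ε (fun x => m x - 1) ∧ |l| < ε

/-- Phase condition: `∫ μ sin(2π ξ₀·x) dx = 0`. -/
def PhaseFixed (ξ₀ : Fin d → ℤ) (μ : Space d → ℝ) : Prop :=
  torusIntegral (fun x => μ x * sinMode ξ₀ x) = 0

/-- Sign convention: `∫ μ cos(2π ξ₀·x) dx ≥ 0`. -/
def SignFixed (ξ₀ : Fin d → ℤ) (μ : Space d → ℝ) : Prop :=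
  0 ≤ torusIntegral (fun x => μ x * cosMode ξ₀ x)

/-- The `L²` pairing of a pair `(f, g)` with the critical vector `(cos, -ν cos)`, which spans both
the kernel and the cokernel of the phase-fixed linearized operator at criticality; it is normalized
so that the pairing of `(cos, -ν cos)` with itself is `1`. -/
def critPairing (ν : ℝ) (ξ₀ : Fin d → ℤ) (f g : Space d → ℝ) : ℝ :=
  2 / (1 + ν ^ 2) *
    (torusIntegral (fun x => f x * cosMode ξ₀ x) - ν * torusIntegral (fun x => g x * cosMode ξ₀ x))

/-- The critical component of the stationary operator at `(μ, w, l)`. -/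
def reducedValue (ν : ℝ) (K : Space d → ℝ) (ξ₀ : Fin d → ℤ) (γ : ℝ)
    (μ w : Space d → ℝ) (l : ℝ) : ℝ :=
  critPairing ν ξ₀ (hjbOp ν K γ μ w l) (fpOp ν μ w)

/-- `(μ, w, l)` is a phase-fixed solution, with critical amplitude `A`, of the complement equation
of the Lyapunov-Schmidt reduction: the stationary operator at `(μ, w, l)` equals its critical
component. -/
structure SolvesComplement (ν : ℝ) (K : Space d → ℝ) (ξ₀ : Fin d → ℤ) (γ A : ℝ)
    (μ w : Space d → ℝ) (l : ℝ) : Prop where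
  contDiff_mu : ContDiff ℝ 2 μ
  contDiff_w : ContDiff ℝ 2 w
  periodic_mu : IsPeriodic μ
  periodic_w : IsPeriodic w
  mean_mu : torusIntegral μ = 0
  mean_w : torusIntegral w = 0
  phaseFixed : PhaseFixed ξ₀ μ
  amplitude : critPairing ν ξ₀ μ w = A
  complement_hjb : ∀ x, hjbOp ν K γ μ w l x = reducedValue ν K ξ₀ γ μ w l * cosMode ξ₀ x
  complement_fp : ∀ x, fpOp ν μ w x = reducedValue ν K ξ₀ γ μ w l * (-ν * cosMode ξ₀ x)

/-- Nondegenerate cubic reduced equation: near `(A, γ) = (0, γc)` and near the uniform equilibrium,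
the critical component of the stationary operator along solutions of the complement equation is
`α (γ - γc) A - β A³ + R` with `α, β > 0` and
`|R| ≤ C (|γ - γc|² |A| + |γ - γc| |A|³ + |A|⁵)`. -/
def CubicReducedEquation (ν : ℝ) (K : Space d → ℝ) (ξ₀ : Fin d → ℤ) (γc α β : ℝ) : Prop :=
  0 < α ∧ 0 < β ∧ ∃ C : ℝ, ∃ ε > 0, ∃ η > 0, ∀ (A γ : ℝ) (μ w : Space d → ℝ) (l : ℝ),
    |A| < η → |γ - γc| < η → SolvesComplement ν K ξ₀ γ A μ w l →
    NearUniform ε w (fun x => 1 + μ x) l →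
    |reducedValue ν K ξ₀ γ μ w l - (α * (γ - γc) * A - β * A ^ 3)| ≤
      C * (|γ - γc| ^ 2 * |A| + |γ - γc| * |A| ^ 3 + |A| ^ 5)

/-- `Ψ` is the reduced bifurcation function for `|A| < η`, `|γ - γc| < δ`: the complement equation
has a solution of amplitude `A` that is `ε`-close to the uniform equilibrium, and at every such
solution the critical component of the stationary operator is `Ψ A γ`. -/
def IsReducedFunction (ν : ℝ) (K : Space d → ℝ) (ξ₀ : Fin d → ℤ) (γc ε η δ : ℝ)
    (Ψ : ℝ → ℝ → ℝ) : Prop :=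
  ∀ A γ : ℝ, |A| < η → |γ - γc| < δ →
    (∃ (μ w : Space d → ℝ) (l : ℝ), SolvesComplement ν K ξ₀ γ A μ w l ∧
      NearUniform ε w (fun x => 1 + μ x) l) ∧
    ∀ (μ w : Space d → ℝ) (l : ℝ), SolvesComplement ν K ξ₀ γ A μ w l →
      NearUniform ε w (fun x => 1 + μ x) l → reducedValue ν K ξ₀ γ μ w l = Ψ A γ

/-- Translation of a function. -/
def translate (τ : Space d) (f : Space d → ℝ) (x : Space d) : ℝ := f (x + τ)

end MFGTorus

end

/-!
The argument is a Lyapunov–Schmidt reduction at the trivial solution, carried out in two different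
function spaces: existence in weighted sequence spaces, uniqueness in `L²`.

*Existence.* Write `m = 1 + μ`, `γ = γc + t`. On the Fourier side the linearization at the uniform
equilibrium is a family of `2 × 2` matrices; by simplicity of the critical pair it is invertible
except at `0` and `±ξ₀`, and at `±ξ₀` it has rank one with kernel spanned by `(1, -ν)`. After the
substitution `(μ, w) = A (P, W)` the complement equation, divided by `A`, becomes an equation for
the cosine coefficients of `(P, W)` of the form `(P, W) = (c, -νc) + L(A, t; P, W)`, where `c` is
the critical cosine and `L` vanishes at `(A, t) = 0`. Since the inverse symbol gains two derivatives
and the nonlinearity loses at most one of them, the right-hand side is analytic and gains one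
derivative in the scale of weighted `ℓ¹` spaces. The implicit function theorem therefore gives
profiles `(P, W)` which depend smoothly on `(A, t)` near `0` with values in all these spaces
(`SimpleCriticalPair.exists_isProfile`), and they solve the complement equation
(`IsProfile.solvesComplement`). The residual left at `±ξ₀` is `A g(A, t)`, with `g` the
`reducedQuotient`. Because the profiles are parametrized up to `A = 0`, smoothness and the estimates
of the branch in all Sobolev norms follow from those of `A`.

*Uniqueness.* The linearization is coercive from `H²` to `L²`, modulo the critical mode
(`SimpleCriticalPair.exists_coercive`). The difference of two `C²`-small solutions of the complement
equation at the same `(A, t)` solves the linearized equation with a right-hand side that is a small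
multiple of its own `H²` norm, so it vanishes
(`SimpleCriticalPair.exists_solvesComplement_unique`). Hence the profiles give all small solutions,
and `A g(A, t)` is the reduced function.

*The scalar equation.* A shift by half a period of the critical mode maps solutions at `A` to
solutions at `-A`; with uniqueness this makes `g` even in `A` (`IsProfile.eventually_even`). The
cubic hypothesis says that `g = αt - βA²` up to terms of order `t² + |t|A² + A⁴`. So `∂g/∂A`
vanishes at `A = 0` and `∂²g/∂A²` does not vanish near the origin, and by Rolle's theorem
`g(·, t)` has no degenerate positive zero and at most one positive zero. The signs of `g` at `0` and
at the end of the interval give a zero for `t > 0`, and `g` is negative for `t ≤ 0` and `A ≠ 0`. The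
zero is smooth in `t` by the implicit function theorem and equals `√(αt/β) + O(t)`
(`exists_pitchfork`).

*Translations.* Every function has a translate satisfying the phase and sign conditions
(`exists_translate_phaseFixed`), so a solution without phase condition is a translate of the branch.
Fixing the radii of the neighbourhoods in a consistent order is the content of `exists_localModel`.
-/

noncomputable section

namespace MFGTorus

variable {d : ℕ}

/-! ### Integration over the torus -/

section Torus

attribute [local instance] instMeasureSpaceUnitAddCircle

local instance : Measure.IsAddHaarMeasure (volume : Measure UnitAddCircle) :=
  inferInstanceAs (Measure.IsAddHaarMeasure AddCircle.haarAddCircle)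

local instance : IsProbabilityMeasure (volume : Measure UnitAddCircle) :=
  inferInstanceAs (IsProbabilityMeasure AddCircle.haarAddCircle)

/-- The covering map `ℝ^d → (ℝ/ℤ)^d`. -/
def toTorus (x : Space d) : UnitAddTorus (Fin d) := fun i => (x i : UnitAddCircle)

/-- The function on `(ℝ/ℤ)^d` induced by a function `F` on `ℝ^d`, through the representatives in
`(0,1]^d`. -/
def descend {E : Type*} (F : Space d → E) (y : UnitAddTorus (Fin d)) : E :=
  F (WithLp.toLp 2 (fun i => (AddCircle.equivIoc 1 0 (y i)).1))

theorem descend_toTorus {E : Type*} {F : Space d → E} (hF : ∀ n x, F (x + latt n) = F x)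
    (x : Space d) : descend F (toTorus x) = F x := by
  have h : ∀ i, ∃ n : ℤ, (AddCircle.equivIoc 1 0 (x i : UnitAddCircle)).1 + n = x i := by
    intro i
    have h1 : ((AddCircle.equivIoc (1 : ℝ) 0 (x i : UnitAddCircle)).1 : UnitAddCircle) =
        (x i : UnitAddCircle) := (AddCircle.equivIoc (1 : ℝ) 0).symm_apply_apply _
    obtain ⟨n, hn⟩ := (QuotientAddGroup.eq_iff_sub_mem.1 h1)
    refine ⟨-n, ?_⟩
    simp at hn
    push_cast
    linarith
  choose n hn using h
  rw [descend, ← hF n]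
  congr 1
  ext i
  simpa [latt, toTorus] using hn i

theorem continuous_descend {E : Type*} [TopologicalSpace E] {F : Space d → E}
    (hF : ∀ n x, F (x + latt n) = F x) (hc : Continuous F) : Continuous (descend F) := by
  have hq : IsOpenQuotientMap (Pi.map (fun (_ : Fin d) (t : ℝ) => (t : UnitAddCircle))) :=
    IsOpenQuotientMap.piMap fun _ => QuotientAddGroup.isOpenQuotientMap_mk
  rw [hq.isQuotientMap.continuous_iff]
  have : descend F ∘ (Pi.map (fun (_ : Fin d) (t : ℝ) => (t : UnitAddCircle))) =
      F ∘ (WithLp.toLp 2) := by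
    ext y
    exact descend_toTorus hF (WithLp.toLp 2 y)
  rw [this]
  exact hc.comp (PiLp.continuous_toLp 2 _)

/-- Integrals over the unit cell are integrals over the compact group `(ℝ/ℤ)^d`. Translation
invariance and Parseval's identity are taken from there. -/
theorem setIntegral_cell_eq {E : Type*} [NormedAddCommGroup E] [NormedSpace ℝ E]
    {F : Space d → E} (hF : ∀ n x, F (x + latt n) = F x) :
    ∫ x in cell d, F x = ∫ y : UnitAddTorus (Fin d), descend F y := by
  rw [UnitAddTorus.integral_preimage _ (fun _ => 0)]
  have h1 := (EuclideanSpace.volume_preserving_symm_measurableEquiv_toLp (Fin d)).symm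
  have h2 := h1.setIntegral_preimage_emb (MeasurableEquiv.measurableEmbedding _) F (cell d)
  rw [← h2]
  -- the two fundamental domains `[0,1)^d` and `(0,1]^d` differ by a null set
  have h3 : (Set.pi univ fun _ : Fin d => Ico (0 : ℝ) 1) =ᵐ[volume]
      (Set.pi univ fun _ : Fin d => Ioc (0 : ℝ) 1) := by
    have a1 := Measure.univ_pi_Ico_ae_eq_Icc (μ := fun _ : Fin d => (volume : Measure ℝ))
      (f := fun _ => 0) (g := fun _ => 1)
    have a2 := Measure.univ_pi_Ioc_ae_eq_Icc (μ := fun _ : Fin d => (volume : Measure ℝ))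
      (f := fun _ => 0) (g := fun _ => 1)
    exact a1.trans a2.symm
  have e1 : (⇑(MeasurableEquiv.toLp 2 (Fin d → ℝ)).symm.symm ⁻¹' cell d) =
      (Set.pi univ fun _ : Fin d => Ico (0 : ℝ) 1) := by
    ext y; simp [cell, Set.mem_pi]
  have e2 : {x : Fin d → ℝ | ∀ i, x i ∈ Ioc (0 : ℝ) (0 + 1)} =
      (Set.pi univ fun _ : Fin d => Ioc (0 : ℝ) 1) := by
    ext y; simp [Set.mem_pi]
  rw [e1, e2, setIntegral_congr_set h3]
  refine integral_congr_ae (Eventually.of_forall fun y => ?_)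
  exact (descend_toTorus hF (WithLp.toLp 2 y)).symm

theorem toTorus_surjective (y : UnitAddTorus (Fin d)) : ∃ x : Space d, toTorus x = y :=
  ⟨WithLp.toLp 2 (fun i => (AddCircle.equivIoc 1 0 (y i)).1), by
    ext i; exact (AddCircle.equivIoc (1 : ℝ) 0).symm_apply_apply (y i)⟩

theorem toTorus_add (x y : Space d) : toTorus (x + y) = toTorus x + toTorus y := by
  ext i; simp [toTorus]

theorem toTorus_neg (x : Space d) : toTorus (-x) = -toTorus x := by
  ext i; simp [toTorus]

theorem latt_neg (n : Fin d → ℤ) : latt (-n) = -latt n := by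
  ext i; simp [latt]

theorem latt_add (m n : Fin d → ℤ) : latt (m + n) = latt m + latt n := by
  ext i; simp [latt]

theorem latt_sub (m n : Fin d → ℤ) : latt (m - n) = latt m - latt n := by
  ext i; simp [latt]

theorem IsPeriodic.translate {f : Space d → ℝ} (hf : IsPeriodic f) (τ : Space d) :
    IsPeriodic (MFGTorus.translate τ f) := by
  intro n x
  have : x + latt n + τ = (x + τ) + latt n := by abel
  simp only [MFGTorus.translate, this, hf n]

theorem IsPeriodic.comp_neg {f : Space d → ℝ} (hf : IsPeriodic f) :
    IsPeriodic (fun x => f (-x)) := by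
  intro n x
  have : -(x + latt n) = -x + latt (-n) := by rw [latt_neg]; abel
  simp only [this, hf (-n)]

theorem torusIntegral_translate {f : Space d → ℝ} (hf : IsPeriodic f) (τ : Space d) :
    torusIntegral (translate τ f) = torusIntegral f := by
  unfold torusIntegral
  rw [setIntegral_cell_eq hf, setIntegral_cell_eq (hf.translate τ),
    ← integral_add_right_eq_self (descend f) (toTorus τ)]
  refine integral_congr_ae (Eventually.of_forall fun y => ?_)
  obtain ⟨x, rfl⟩ := toTorus_surjective y
  simp only [descend_toTorus (hf.translate τ), ← toTorus_add, descend_toTorus hf, translate]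

theorem torusIntegral_comp_neg {f : Space d → ℝ} (hf : IsPeriodic f) :
    torusIntegral (fun x => f (-x)) = torusIntegral f := by
  have : (volume : Measure (UnitAddTorus (Fin d))).IsNegInvariant := Measure.pi.isNegInvariant _
  unfold torusIntegral
  rw [setIntegral_cell_eq hf, setIntegral_cell_eq (F := fun x => f (-x)) hf.comp_neg,
    ← integral_neg_eq_self (descend f)]
  refine integral_congr_ae (Eventually.of_forall fun y => ?_)
  obtain ⟨x, rfl⟩ := toTorus_surjective y
  simp only [descend_toTorus (F := fun x => f (-x)) hf.comp_neg, ← toTorus_neg, descend_toTorus hf]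

theorem torusIntegral_const (c : ℝ) : torusIntegral (fun _ : Space d => c) = c := by
  unfold torusIntegral
  rw [setIntegral_cell_eq (fun _ _ => rfl)]
  simp [descend]

theorem IsPeriodic.exists_bound {f : Space d → ℝ} (hf : IsPeriodic f) (hc : Continuous f) :
    ∃ C, ∀ x, |f x| ≤ C := by
  obtain ⟨C, hC⟩ := isCompact_univ.exists_bound_of_continuousOn
    (continuous_descend hf hc).continuousOn
  exact ⟨C, fun x => by simpa [descend_toTorus hf] using hC (toTorus x) (mem_univ _)⟩

theorem phase_apply (ξ : Fin d → ℤ) (x : Space d) :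
    phase ξ x = 2 * Real.pi * ∑ i, ξ i * x i := by
  simp [phase, latt, PiLp.inner_apply, mul_comm]

theorem mFourier_neg_toTorus (ξ : Fin d → ℤ) (x : Space d) :
    UnitAddTorus.mFourier (-ξ) (toTorus x) = Complex.exp (-(phase ξ x : ℂ) * Complex.I) := by
  simp only [UnitAddTorus.mFourier, ContinuousMap.coe_mk, toTorus, fourier_coe_apply]
  rw [← Complex.exp_sum, phase_apply]
  congr 1
  push_cast
  rw [Finset.mul_sum, ← Finset.sum_neg_distrib, Finset.sum_mul]
  refine Finset.sum_congr rfl fun i _ => ?_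
  simp; ring

/-- Parseval's identity for continuous periodic functions. -/
theorem hasSum_sq_fourierCoef {f : Space d → ℝ} (hf : IsPeriodic f) (hc : Continuous f) :
    HasSum (fun ξ => ‖fourierCoef f ξ‖ ^ 2) (torusIntegral (fun x => f x ^ 2)) := by
  have hf' : ∀ n x, (fun x => (f x : ℂ)) (x + latt n) = (fun x => (f x : ℂ)) x := fun n x => by
    simp [hf n x]
  let g : C(UnitAddTorus (Fin d), ℂ) :=
    ⟨descend (fun x => (f x : ℂ)), continuous_descend hf' (Complex.continuous_ofReal.comp hc)⟩
  have h := UnitAddTorus.hasSum_sq_mFourierCoeff (ContinuousMap.toLp 2 volume ℂ g)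
  convert h using 1
  · ext ξ
    rw [UnitAddTorus.mFourierCoeff_toLp]
    congr 2
    have hp : ∀ n x, (fun x => (f x : ℂ) * Complex.exp (-(phase ξ x : ℂ) * Complex.I))
        (x + latt n) = (fun x => (f x : ℂ) * Complex.exp (-(phase ξ x : ℂ) * Complex.I)) x := by
      intro n x
      have e : toTorus (x + latt n) = toTorus x := by
        ext i
        simp only [toTorus, latt, PiLp.add_apply, AddCircle.coe_add]
        have : ((n i : ℝ) : UnitAddCircle) = 0 := by
          rw [AddCircle.coe_eq_zero_iff]; exact ⟨n i, by simp⟩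
        simp [this]
      simp only [hf n x, ← mFourier_neg_toTorus, e]
    unfold fourierCoef UnitAddTorus.mFourierCoeff
    rw [setIntegral_cell_eq hp]
    refine integral_congr_ae (Eventually.of_forall fun y => ?_)
    obtain ⟨x, rfl⟩ := toTorus_surjective y
    simp only [descend_toTorus
      (F := fun x => (f x : ℂ) * Complex.exp (-(phase ξ x : ℂ) * Complex.I)) hp,
      mFourier_neg_toTorus, g, ContinuousMap.coe_mk,
      descend_toTorus (F := fun x => (f x : ℂ)) hf', smul_eq_mul]
    ring
  · have hp : IsPeriodic (fun x => f x ^ 2) := fun n x => by simp [hf n x]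
    unfold torusIntegral
    rw [setIntegral_cell_eq (F := fun x => f x ^ 2) hp]
    have := ContinuousMap.coeFn_toLp (p := 2) (𝕜 := ℂ) (volume : Measure (UnitAddTorus (Fin d))) g
    refine integral_congr_ae ?_
    filter_upwards [this] with y hy
    rw [hy]
    obtain ⟨x, rfl⟩ := toTorus_surjective y
    simp [descend_toTorus (F := fun x => f x ^ 2) hp, g,
      descend_toTorus (F := fun x => (f x : ℂ)) hf']

end Torus

theorem integrableOn_cell {E : Type*} [NormedAddCommGroup E] {f : Space d → E}
    (hf : Continuous f) : IntegrableOn f (cell d) := by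
  have hb : Bornology.IsBounded (cell d) := by
    refine (Metric.isBounded_closedBall (x := (0 : Space d)) (r := √d)).subset fun x hx => ?_
    rw [mem_closedBall_zero_iff, EuclideanSpace.norm_eq]
    refine Real.sqrt_le_sqrt ?_
    calc ∑ i, ‖x i‖ ^ 2 ≤ ∑ i : Fin d, (1 : ℝ) := Finset.sum_le_sum fun i _ => by
          rw [Real.norm_eq_abs, sq_abs]
          nlinarith [(hx i).1, (hx i).2]
      _ = d := by simp
  exact (hf.locallyIntegrable.integrableOn_isCompact hb.isCompact_closure).mono_set subset_closure

theorem volume_cell_lt_top : volume (cell d) < ⊤ := by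
  have := integrableOn_cell (d := d) (f := fun _ => (1 : ℝ)) continuous_const
  simpa using (integrableOn_const_iff (C := (1 : ℝ))).1 this

instance : IsFiniteMeasure (volume.restrict (cell d)) := ⟨by simpa using volume_cell_lt_top⟩

theorem torusIntegral_add {f g : Space d → ℝ} (hf : Continuous f) (hg : Continuous g) :
    torusIntegral (fun x => f x + g x) = torusIntegral f + torusIntegral g :=
  integral_add (integrableOn_cell hf) (integrableOn_cell hg)

theorem torusIntegral_sub {f g : Space d → ℝ} (hf : Continuous f) (hg : Continuous g) :
    torusIntegral (fun x => f x - g x) = torusIntegral f - torusIntegral g :=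
  integral_sub (integrableOn_cell hf) (integrableOn_cell hg)

theorem torusIntegral_const_mul (c : ℝ) (f : Space d → ℝ) :
    torusIntegral (fun x => c * f x) = c * torusIntegral f :=
  integral_const_mul c f

theorem torusIntegral_neg (f : Space d → ℝ) :
    torusIntegral (fun x => - f x) = - torusIntegral f :=
  integral_neg f

theorem torusIntegral_finsetSum {ι : Type*} (s : Finset ι) {f : ι → Space d → ℝ}
    (hf : ∀ i ∈ s, Continuous (f i)) :
    torusIntegral (fun x => ∑ i ∈ s, f i x) = ∑ i ∈ s, torusIntegral (f i) :=
  integral_finsetSum s fun i hi => integrableOn_cell (hf i hi)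

theorem torusIntegral_mono {f g : Space d → ℝ} (hf : Continuous f) (hg : Continuous g)
    (h : ∀ x, f x ≤ g x) : torusIntegral f ≤ torusIntegral g :=
  integral_mono (integrableOn_cell hf) (integrableOn_cell hg) h

theorem abs_torusIntegral_le {f : Space d → ℝ} (hf : Continuous f) {C : ℝ}
    (h : ∀ x, |f x| ≤ C) : |torusIntegral f| ≤ C := by
  rw [abs_le]
  constructor
  · rw [← torusIntegral_const (d := d) (-C)]
    exact torusIntegral_mono continuous_const hf fun x => (abs_le.1 (h x)).1
  · rw [← torusIntegral_const (d := d) C]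
    exact torusIntegral_mono hf continuous_const fun x => (abs_le.1 (h x)).2

/-! ### Partial derivatives -/

/-- The `i`-th partial derivative. -/
def pd (i : Fin d) (f : Space d → ℝ) (x : Space d) : ℝ :=
  fderiv ℝ f x (EuclideanSpace.single i 1)

theorem IsPeriodic.pd {f : Space d → ℝ} (hf : IsPeriodic f) (i : Fin d) :
    IsPeriodic (MFGTorus.pd i f) := by
  intro n x
  have h : (fun y => f (y + latt n)) = f := funext (hf n)
  unfold MFGTorus.pd
  rw [← fderiv_comp_add_right, h]

theorem contDiff_pd {f : Space d → ℝ} {m n : ℕ∞ω} (hf : ContDiff ℝ n f) (hmn : m + 1 ≤ n)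
    (i : Fin d) : ContDiff ℝ m (pd i f) :=
  (hf.fderiv_right hmn).clm_apply contDiff_const

theorem hasDerivAt_pd {f : Space d → ℝ} (hf : Differentiable ℝ f) (i : Fin d) (x : Space d)
    (t : ℝ) : HasDerivAt (fun t : ℝ => f (x + t • EuclideanSpace.single i (1 : ℝ)))
      (pd i f (x + t • EuclideanSpace.single i (1 : ℝ))) t := by
  have h1 : HasDerivAt (fun t : ℝ => x + t • EuclideanSpace.single i (1 : ℝ))
      (EuclideanSpace.single i (1 : ℝ)) t := by
    simpa using ((hasDerivAt_id t).smul_const (EuclideanSpace.single i (1 : ℝ))).const_add x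
  exact (hf _).hasFDerivAt.comp_hasDerivAt t h1

theorem pd_mul {f g : Space d → ℝ} (hf : Differentiable ℝ f) (hg : Differentiable ℝ g)
    (i : Fin d) (x : Space d) :
    pd i (fun y => f y * g y) x = f x * pd i g x + pd i f x * g x := by
  unfold pd
  rw [fderiv_fun_mul (hf x) (hg x)]
  simp; ring

theorem pd_sub {f g : Space d → ℝ} (hf : Differentiable ℝ f) (hg : Differentiable ℝ g)
    (i : Fin d) (x : Space d) : pd i (fun y => f y - g y) x = pd i f x - pd i g x := by
  unfold pd; rw [fderiv_fun_sub (hf x) (hg x)]; rfl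

theorem pd_const_mul {f : Space d → ℝ} (hf : Differentiable ℝ f) (c : ℝ)
    (i : Fin d) (x : Space d) : pd i (fun y => c * f y) x = c * pd i f x := by
  unfold pd; rw [fderiv_const_mul (hf x)]; rfl

theorem pd_translate (f : Space d → ℝ) (τ : Space d) (i : Fin d) :
    pd i (translate τ f) = translate τ (pd i f) := by
  ext x
  unfold pd translate
  rw [fderiv_comp_add_right]

/-- The mean of a derivative vanishes: the mean of a translate does not depend on the shift. -/
theorem torusIntegral_pd {f : Space d → ℝ} (hf : ContDiff ℝ 1 f) (hp : IsPeriodic f)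
    (i : Fin d) : torusIntegral (pd i f) = 0 := by
  have hc : Continuous (pd i f) := (contDiff_pd (m := 0) hf (by norm_num) i).continuous
  obtain ⟨C, hC⟩ := (hp.pd i).exists_bound hc
  have hd : Differentiable ℝ f := hf.differentiable (by norm_num)
  have key := (hasDerivAt_integral_of_dominated_loc_of_deriv_le
    (μ := volume.restrict (cell d))
    (F := fun (t : ℝ) (x : Space d) => f (x + t • EuclideanSpace.single i (1 : ℝ)))
    (F' := fun (t : ℝ) (x : Space d) => pd i f (x + t • EuclideanSpace.single i (1 : ℝ)))
    (x₀ := (0 : ℝ)) (s := univ) (bound := fun _ => C) univ_mem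
    (Eventually.of_forall fun t => (hf.continuous.comp
      (continuous_id.add continuous_const)).aestronglyMeasurable)
    (integrableOn_cell (hf.continuous.comp (continuous_id.add continuous_const)))
    ((hc.comp (continuous_id.add continuous_const)).aestronglyMeasurable)
    (Eventually.of_forall fun x t _ => hC _)
    (integrable_const C)
    (Eventually.of_forall fun x t _ => hasDerivAt_pd hd i x t)).2
  have hconst : (fun t : ℝ => ∫ x in cell d, f (x + t • EuclideanSpace.single i (1 : ℝ))) =
      fun _ => torusIntegral f := by
    ext t
    exact torusIntegral_translate hp _
  rw [hconst] at key
  simpa [torusIntegral] using key.unique (hasDerivAt_const (0 : ℝ) (torusIntegral f))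

/-- Integration by parts on the torus. -/
theorem torusIntegral_pd_mul {f g : Space d → ℝ} (hf : ContDiff ℝ 1 f) (hg : ContDiff ℝ 1 g)
    (hfp : IsPeriodic f) (hgp : IsPeriodic g) (i : Fin d) :
    torusIntegral (fun x => pd i f x * g x) = - torusIntegral (fun x => f x * pd i g x) := by
  have h := torusIntegral_pd (f := fun x => f x * g x) (hf.mul hg)
    (fun n x => by simp only [hfp n x, hgp n x]) i
  have e : pd i (fun x => f x * g x) = fun x => f x * pd i g x + pd i f x * g x := by
    ext x
    exact pd_mul (hf.differentiable (by norm_num)) (hg.differentiable (by norm_num)) i x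
  have c1 : Continuous (pd i f) := (contDiff_pd (m := 0) hf (by norm_num) i).continuous
  have c2 : Continuous (pd i g) := (contDiff_pd (m := 0) hg (by norm_num) i).continuous
  rw [e, torusIntegral_add (f := fun x => f x * pd i g x) (g := fun x => pd i f x * g x)
    (hf.continuous.mul c2) (c1.mul hg.continuous)] at h
  linarith

/-- The Laplacian as a sum of iterated partial derivatives. -/
def lap (f : Space d → ℝ) (x : Space d) : ℝ := ∑ i, pd i (pd i f) x

theorem iteratedFDeriv_two_single {f : Space d → ℝ} (hf : ContDiff ℝ 2 f) (i : Fin d)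
    (x : Space d) : pd i (pd i f) x = iteratedFDeriv ℝ 2 f x
      ![EuclideanSpace.single i (1 : ℝ), EuclideanSpace.single i (1 : ℝ)] := by
  rw [iteratedFDeriv_two_apply]
  unfold pd
  have hd : DifferentiableAt ℝ (fderiv ℝ f) x :=
    (hf.fderiv_right (m := 1) (by norm_num)).differentiable (by norm_num) x
  rw [fderiv_clm_apply hd (differentiableAt_const _)]
  simp

theorem laplacian_eq_lap {f : Space d → ℝ} (hf : ContDiff ℝ 2 f) (x : Space d) :
    Laplacian.laplacian f x = lap f x := by
  rw [InnerProductSpace.laplacian_eq_iteratedFDeriv_orthonormalBasis f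
    (EuclideanSpace.basisFun (Fin d) ℝ)]
  simp only [lap, iteratedFDeriv_two_single hf, EuclideanSpace.basisFun_apply]

theorem gradient_apply {f : Space d → ℝ} (x : Space d) (i : Fin d) :
    gradient f x i = pd i f x := by
  have h : inner ℝ (gradient f x) (EuclideanSpace.single i (1 : ℝ)) =
      fderiv ℝ f x (EuclideanSpace.single i 1) := by
    rw [gradient, InnerProductSpace.toDual_symm_apply]
  rw [EuclideanSpace.inner_single_right] at h
  simpa [pd] using h

theorem norm_gradient_sq {f : Space d → ℝ} (x : Space d) :
    ‖gradient f x‖ ^ 2 = ∑ i, pd i f x ^ 2 := by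
  rw [EuclideanSpace.norm_sq_eq]
  simp [gradient_apply]

theorem contDiff_gradient {f : Space d → ℝ} (hf : ContDiff ℝ 2 f) :
    ContDiff ℝ 1 (gradient f) := by
  unfold gradient
  exact (InnerProductSpace.toDual ℝ (Space d)).symm.toContinuousLinearEquiv.contDiff.comp
    (hf.fderiv_right (by norm_num))

theorem divergence_smul_gradient {m f : Space d → ℝ} (hm : ContDiff ℝ 1 m)
    (hf : ContDiff ℝ 2 f) (x : Space d) :
    divergence (fun y => m y • gradient f y) x = ∑ i, pd i m x * pd i f x + m x * lap f x := by
  have hd : Differentiable ℝ (fun y => m y • gradient f y) :=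
    (hm.smul (contDiff_gradient hf)).differentiable (by norm_num)
  unfold divergence lap
  rw [Finset.mul_sum, ← Finset.sum_add_distrib]
  refine Finset.sum_congr rfl fun i _ => ?_
  have h1 : (fderiv ℝ (fun y => m y • gradient f y) x (EuclideanSpace.single i 1)) i =
      pd i (fun y => m y * pd i f y) x := by
    have e : (fun y => m y * pd i f y) =
        fun y => (EuclideanSpace.proj i : Space d →L[ℝ] ℝ) (m y • gradient f y) := by
      ext y; simp [gradient_apply]
    rw [pd, e]
    have := ((EuclideanSpace.proj i : Space d →L[ℝ] ℝ).hasFDerivAt.comp x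
      (hd x).hasFDerivAt).fderiv
    simp only [Function.comp_def] at this
    rw [this]
    rfl
  rw [h1, pd_mul (hm.differentiable (by norm_num))
    ((contDiff_pd (m := 1) hf (by norm_num) i).differentiable (by norm_num))]
  ring

theorem hjbOp_eq {ν : ℝ} {K : Space d → ℝ} {γ l : ℝ} {μ w : Space d → ℝ}
    (hw : ContDiff ℝ 2 w) (x : Space d) :
    hjbOp ν K γ μ w l x =
      -ν * lap w x + (1 / 2) * ∑ i, pd i w x ^ 2 - γ * conv K μ x + l := by
  rw [hjbOp, laplacian_eq_lap hw, norm_gradient_sq]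

theorem fpOp_eq {ν : ℝ} {μ w : Space d → ℝ} (hμ : ContDiff ℝ 2 μ) (hw : ContDiff ℝ 2 w)
    (x : Space d) :
    fpOp ν μ w x = -ν * lap μ x - (∑ i, pd i μ x * pd i w x + (1 + μ x) * lap w x) := by
  have h1 : ContDiff ℝ 1 (fun x => 1 + μ x) :=
    contDiff_const.add (hμ.of_le (by norm_num))
  rw [fpOp, laplacian_eq_lap hμ, divergence_smul_gradient h1 hw]
  have : ∀ i, pd i (fun x => 1 + μ x) x = pd i μ x := fun i => by
    unfold pd; rw [fderiv_const_add]
  simp only [this]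

/-! ### Trigonometric modes -/

/-- The eigenvalue `(2π|ξ|)²` of `-Δ` on the frequency `ξ`. -/
def freqSq (ξ : Fin d → ℤ) : ℝ := (2 * Real.pi * ‖latt ξ‖) ^ 2

/-- The real Fourier modes: `cos (2π ξ·x)` for `true` and `sin (2π ξ·x)` for `false`. -/
def trigMode : Bool → (Fin d → ℤ) → Space d → ℝ
  | true => cosMode
  | false => sinMode

/-- The real Fourier coefficients `∫ f cos (2π ξ·x)` and `∫ f sin (2π ξ·x)`. -/
def trigCoef (b : Bool) (f : Space d → ℝ) (ξ : Fin d → ℤ) : ℝ :=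
  torusIntegral (fun x => f x * trigMode b ξ x)

theorem freqSq_nonneg (ξ : Fin d → ℤ) : 0 ≤ freqSq ξ := sq_nonneg _

theorem freqSq_eq_sum (ξ : Fin d → ℤ) : freqSq ξ = ∑ i, (2 * Real.pi * ξ i) ^ 2 := by
  rw [freqSq, mul_pow, EuclideanSpace.norm_sq_eq, Finset.mul_sum]
  simp [latt, mul_pow]

theorem norm_latt_sq (ξ : Fin d → ℤ) : ‖latt ξ‖ ^ 2 = ∑ i, (ξ i : ℝ) ^ 2 := by
  rw [EuclideanSpace.norm_sq_eq]; simp [latt]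

theorem one_le_norm_latt {ξ : Fin d → ℤ} (h : ξ ≠ 0) : 1 ≤ ‖latt ξ‖ := by
  obtain ⟨i, hi⟩ := Function.ne_iff.1 h
  have h1 : (1 : ℝ) ≤ (ξ i : ℝ) ^ 2 := by
    have : 1 ≤ (ξ i) ^ 2 := by
      have : 0 < (ξ i) ^ 2 := sq_pos_of_ne_zero hi
      omega
    exact_mod_cast this
  have h2 : (ξ i : ℝ) ^ 2 ≤ ‖latt ξ‖ ^ 2 := by
    rw [norm_latt_sq]
    exact Finset.single_le_sum (f := fun i => (ξ i : ℝ) ^ 2) (fun _ _ => sq_nonneg _)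
      (Finset.mem_univ i)
  nlinarith [norm_nonneg (latt ξ)]

theorem one_le_freqSq {ξ : Fin d → ℤ} (h : ξ ≠ 0) : 1 ≤ freqSq ξ := by
  have h1 := one_le_norm_latt h
  have h2 := Real.pi_gt_three
  have : 1 ≤ 2 * Real.pi * ‖latt ξ‖ := by nlinarith
  exact one_le_pow₀ this

theorem freqSq_neg (ξ : Fin d → ℤ) : freqSq (-ξ) = freqSq ξ := by
  simp [freqSq, latt_neg]

theorem phase_zero (x : Space d) : phase 0 x = 0 := by simp [phase_apply]

theorem phase_neg (ξ : Fin d → ℤ) (x : Space d) : phase (-ξ) x = -phase ξ x := by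
  simp [phase, latt_neg]

theorem phase_neg_right (ξ : Fin d → ℤ) (x : Space d) : phase ξ (-x) = -phase ξ x := by
  simp [phase]

theorem phase_add (ξ η : Fin d → ℤ) (x : Space d) : phase (ξ + η) x = phase ξ x + phase η x := by
  simp [phase, latt_add, inner_add_left, mul_add]

theorem phase_sub (ξ η : Fin d → ℤ) (x : Space d) : phase (ξ - η) x = phase ξ x - phase η x := by
  simp [phase, latt_sub, inner_sub_left, mul_sub]

theorem phase_add_right (ξ : Fin d → ℤ) (x y : Space d) :
    phase ξ (x + y) = phase ξ x + phase ξ y := by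
  simp [phase, inner_add_right, mul_add]

theorem phase_sub_right (ξ : Fin d → ℤ) (x y : Space d) :
    phase ξ (x - y) = phase ξ x - phase ξ y := by
  simp [phase, inner_sub_right, mul_sub]

theorem phase_latt (ξ n : Fin d → ℤ) : ∃ k : ℤ, phase ξ (latt n) = k * (2 * Real.pi) := by
  refine ⟨∑ i, ξ i * n i, ?_⟩
  rw [phase_apply]; push_cast; simp [latt, mul_comm]

/-- The phase as a linear form. -/
def phaseCLM (ξ : Fin d → ℤ) : Space d →L[ℝ] ℝ := (2 * Real.pi) • innerSL ℝ (latt ξ)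

theorem phaseCLM_apply (ξ : Fin d → ℤ) (x : Space d) : phaseCLM ξ x = phase ξ x := by
  simp [phaseCLM, phase]

theorem norm_phaseCLM (ξ : Fin d → ℤ) : ‖phaseCLM ξ‖ = 2 * Real.pi * ‖latt ξ‖ := by
  rw [phaseCLM, norm_smul, innerSL_apply_norm, Real.norm_of_nonneg Real.two_pi_pos.le]

theorem phaseCLM_single (ξ : Fin d → ℤ) (i : Fin d) :
    phaseCLM ξ (EuclideanSpace.single i 1) = 2 * Real.pi * ξ i := by
  rw [phaseCLM_apply, phase, EuclideanSpace.inner_single_right]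
  simp [latt]

theorem hasFDerivAt_phase (ξ : Fin d → ℤ) (x : Space d) :
    HasFDerivAt (phase ξ) (phaseCLM ξ) x := by
  have : phase ξ = phaseCLM ξ := funext fun x => (phaseCLM_apply ξ x).symm
  rw [this]; exact (phaseCLM ξ).hasFDerivAt

theorem contDiff_trigMode {n : ℕ∞ω} (b : Bool) (ξ : Fin d → ℤ) :
    ContDiff ℝ n (trigMode b ξ) := by
  have : phase ξ = phaseCLM ξ := funext fun x => (phaseCLM_apply ξ x).symm
  cases b
  · change ContDiff ℝ n (fun x => Real.sin (phase ξ x))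
    rw [this]; exact Real.contDiff_sin.comp (phaseCLM ξ).contDiff
  · change ContDiff ℝ n (fun x => Real.cos (phase ξ x))
    rw [this]; exact Real.contDiff_cos.comp (phaseCLM ξ).contDiff

theorem continuous_trigMode (b : Bool) (ξ : Fin d → ℤ) : Continuous (trigMode b ξ) :=
  (contDiff_trigMode (n := 0) b ξ).continuous

theorem periodic_trigMode (b : Bool) (ξ : Fin d → ℤ) : IsPeriodic (trigMode b ξ) := by
  intro n x
  obtain ⟨k, hk⟩ := phase_latt ξ n
  cases b
  · simp only [trigMode, sinMode, phase_add_right, hk, Real.sin_add_int_mul_two_pi]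
  · simp only [trigMode, cosMode, phase_add_right, hk, Real.cos_add_int_mul_two_pi]

theorem abs_trigMode_le (b : Bool) (ξ : Fin d → ℤ) (x : Space d) : |trigMode b ξ x| ≤ 1 := by
  cases b
  · exact Real.abs_sin_le_one _
  · exact Real.abs_cos_le_one _

theorem pd_cosMode (i : Fin d) (ξ : Fin d → ℤ) :
    pd i (cosMode ξ) = fun x => -(2 * Real.pi * ξ i) * sinMode ξ x := by
  ext x
  have : HasFDerivAt (cosMode ξ) (-Real.sin (phase ξ x) • phaseCLM ξ) x :=
    (hasFDerivAt_phase ξ x).cos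
  rw [pd, this.fderiv]
  simp only [FunLike.coe_smul, Pi.smul_apply, phaseCLM_single, smul_eq_mul, sinMode]
  ring

theorem pd_sinMode (i : Fin d) (ξ : Fin d → ℤ) :
    pd i (sinMode ξ) = fun x => (2 * Real.pi * ξ i) * cosMode ξ x := by
  ext x
  have : HasFDerivAt (sinMode ξ) (Real.cos (phase ξ x) • phaseCLM ξ) x :=
    (hasFDerivAt_phase ξ x).sin
  rw [pd, this.fderiv]
  simp only [FunLike.coe_smul, Pi.smul_apply, phaseCLM_single, smul_eq_mul, cosMode]
  ring

theorem lap_trigMode (b : Bool) (ξ : Fin d → ℤ) (x : Space d) :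
    lap (trigMode b ξ) x = -freqSq ξ * trigMode b ξ x := by
  have dc : Differentiable ℝ (cosMode ξ) :=
    (contDiff_trigMode (n := 1) true ξ).differentiable (by norm_num)
  have ds : Differentiable ℝ (sinMode ξ) :=
    (contDiff_trigMode (n := 1) false ξ).differentiable (by norm_num)
  rw [freqSq_eq_sum, lap, ← Finset.sum_neg_distrib, Finset.sum_mul]
  refine Finset.sum_congr rfl fun i _ => ?_
  cases b
  · simp only [trigMode, pd_sinMode, pd_const_mul dc, pd_cosMode]; ring
  · simp only [trigMode, pd_cosMode, pd_const_mul ds, pd_sinMode]; ring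

theorem continuous_lap {f : Space d → ℝ} (hf : ContDiff ℝ 2 f) : Continuous (lap f) :=
  continuous_finsetSum _ fun i _ => (contDiff_pd (m := 0)
    (contDiff_pd (m := 1) hf (by norm_num) i) (by norm_num) i).continuous

theorem IsPeriodic.lap {f : Space d → ℝ} (hf : IsPeriodic f) : IsPeriodic (MFGTorus.lap f) :=
  fun n x => Finset.sum_congr rfl fun i _ => (hf.pd i).pd i n x

/-- Green's identity on the torus. -/
theorem torusIntegral_lap_mul {f g : Space d → ℝ} (hf : ContDiff ℝ 2 f) (hg : ContDiff ℝ 2 g)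
    (hfp : IsPeriodic f) (hgp : IsPeriodic g) :
    torusIntegral (fun x => lap f x * g x) =
      -∑ i, torusIntegral (fun x => pd i f x * pd i g x) := by
  have h1 : ∀ i, ContDiff ℝ 1 (pd i f) := fun i => contDiff_pd hf (by norm_num) i
  have h2 : ∀ i, ContDiff ℝ 1 (pd i g) := fun i => contDiff_pd hg (by norm_num) i
  have g1 : ContDiff ℝ 1 g := hg.of_le (by norm_num)
  simp only [lap, Finset.sum_mul]
  rw [torusIntegral_finsetSum _ fun i _ => ((contDiff_pd (m := 0) (h1 i)
    (by norm_num) i).continuous.fun_mul hg.continuous), ← Finset.sum_neg_distrib]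
  exact Finset.sum_congr rfl fun i _ => torusIntegral_pd_mul (h1 i) g1 (hfp.pd i) hgp i

theorem trigCoef_lap {f : Space d → ℝ} (hf : ContDiff ℝ 2 f) (hp : IsPeriodic f) (b : Bool)
    (ξ : Fin d → ℤ) : trigCoef b (lap f) ξ = -freqSq ξ * trigCoef b f ξ := by
  have ht := contDiff_trigMode (n := 2) b ξ
  have h1 := torusIntegral_lap_mul hf ht hp (periodic_trigMode b ξ)
  have h2 := torusIntegral_lap_mul ht hf (periodic_trigMode b ξ) hp
  have h3 : ∑ i, torusIntegral (fun x => pd i f x * pd i (trigMode b ξ) x) =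
      ∑ i, torusIntegral (fun x => pd i (trigMode b ξ) x * pd i f x) := by
    simp only [mul_comm]
  rw [trigCoef, h1, h3, ← h2, trigCoef, ← torusIntegral_const_mul]
  congr 1; ext x
  rw [lap_trigMode]; ring

theorem fourierCoef_eq {f : Space d → ℝ} (hf : Continuous f) (ξ : Fin d → ℤ) :
    fourierCoef f ξ = (trigCoef true f ξ : ℂ) - trigCoef false f ξ * Complex.I := by
  have c1 : Continuous fun x => f x * cosMode ξ x := hf.mul (continuous_trigMode true ξ)
  have c2 : Continuous fun x => f x * sinMode ξ x := hf.mul (continuous_trigMode false ξ)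
  have e : ∀ x, (f x : ℂ) * Complex.exp (-(phase ξ x : ℂ) * Complex.I) =
      ((f x * cosMode ξ x : ℝ) : ℂ) - ((f x * sinMode ξ x : ℝ) : ℂ) * Complex.I := by
    intro x
    rw [← Complex.ofReal_neg, Complex.exp_mul_I]
    simp [cosMode, sinMode]
    ring
  simp only [fourierCoef, e]
  rw [integral_sub, integral_mul_const]
  · exact congrArg₂ (fun a b : ℂ => a - b * Complex.I) integral_ofReal integral_ofReal
  · exact integrableOn_cell (Complex.continuous_ofReal.comp c1)
  · exact integrableOn_cell ((Complex.continuous_ofReal.comp c2).mul continuous_const)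

theorem norm_fourierCoef_sq {f : Space d → ℝ} (hf : Continuous f) (ξ : Fin d → ℤ) :
    ‖fourierCoef f ξ‖ ^ 2 = trigCoef true f ξ ^ 2 + trigCoef false f ξ ^ 2 := by
  rw [fourierCoef_eq hf, ← Complex.normSq_eq_norm_sq, Complex.normSq_apply]
  simp; ring

theorem hasSum_sq_trigCoef {f : Space d → ℝ} (hf : IsPeriodic f) (hc : Continuous f) :
    HasSum (fun ξ => trigCoef true f ξ ^ 2 + trigCoef false f ξ ^ 2)
      (torusIntegral (fun x => f x ^ 2)) := by
  simpa only [norm_fourierCoef_sq hc] using hasSum_sq_fourierCoef hf hc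

theorem torusIntegral_cosMode {ξ : Fin d → ℤ} (h : ξ ≠ 0) : torusIntegral (cosMode ξ) = 0 := by
  obtain ⟨i, hi⟩ := Function.ne_iff.1 h
  have h1 := torusIntegral_pd (contDiff_trigMode (n := 1) false ξ) (periodic_trigMode false ξ) i
  simp only [trigMode, pd_sinMode, torusIntegral_const_mul] at h1
  have hi' : (ξ i : ℝ) ≠ 0 := by exact_mod_cast hi
  simpa [Real.pi_ne_zero, hi'] using h1

theorem torusIntegral_odd {f : Space d → ℝ} (hp : IsPeriodic f) (h : ∀ x, f (-x) = -f x) :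
    torusIntegral f = 0 := by
  have h1 := torusIntegral_comp_neg hp
  simp only [h, torusIntegral_neg] at h1
  linarith

theorem cosMode_neg (ξ : Fin d → ℤ) (x : Space d) : cosMode ξ (-x) = cosMode ξ x := by
  simp [cosMode, phase_neg_right]

theorem sinMode_neg (ξ : Fin d → ℤ) (x : Space d) : sinMode ξ (-x) = -sinMode ξ x := by
  simp [sinMode, phase_neg_right]

theorem trigCoef_false_even {f : Space d → ℝ} (hp : IsPeriodic f) (h : ∀ x, f (-x) = f x)
    (ξ : Fin d → ℤ) : trigCoef false f ξ = 0 := by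
  refine torusIntegral_odd (fun n x => ?_) fun x => ?_
  · simp only [hp n x, periodic_trigMode false ξ n x]
  · simp only [h x, trigMode, sinMode_neg]; ring

theorem torusIntegral_cosMode_eq (ξ : Fin d → ℤ) :
    torusIntegral (cosMode ξ) = if ξ = 0 then 1 else 0 := by
  split_ifs with h
  · have : cosMode (0 : Fin d → ℤ) = fun _ => 1 := by ext x; simp [cosMode, phase_zero]
    rw [h, this, torusIntegral_const]
  · exact torusIntegral_cosMode h

theorem trigCoef_true_cosMode (ξ η : Fin d → ℤ) :
    trigCoef true (cosMode ξ) η =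
      ((if ξ = η then 1 else 0) + (if ξ = -η then 1 else 0)) / 2 := by
  have e : (fun x => cosMode ξ x * trigMode true η x) =
      fun x => (1 / 2) * (cosMode (ξ - η) x + cosMode (ξ + η) x) := by
    ext x
    simp only [trigMode, cosMode, phase_sub, phase_add, Real.cos_add, Real.cos_sub]; ring
  rw [trigCoef, e, torusIntegral_const_mul, torusIntegral_add
    (f := cosMode (ξ - η)) (g := cosMode (ξ + η))
    (continuous_trigMode true _) (continuous_trigMode true _), torusIntegral_cosMode_eq,
    torusIntegral_cosMode_eq]
  simp only [sub_eq_zero, add_eq_zero_iff_eq_neg]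
  ring

theorem trigCoef_false_cosMode (ξ η : Fin d → ℤ) : trigCoef false (cosMode ξ) η = 0 :=
  trigCoef_false_even (periodic_trigMode true ξ) (cosMode_neg ξ) η

theorem trigCoef_add {f g : Space d → ℝ} (hf : Continuous f) (hg : Continuous g) (b : Bool)
    (ξ : Fin d → ℤ) :
    trigCoef b (fun x => f x + g x) ξ = trigCoef b f ξ + trigCoef b g ξ := by
  have ht := continuous_trigMode b ξ
  rw [trigCoef, trigCoef, trigCoef, ← torusIntegral_add (hf.fun_mul ht) (hg.fun_mul ht)]
  simp only [add_mul]

theorem trigCoef_const_mul (c : ℝ) (f : Space d → ℝ) (b : Bool) (ξ : Fin d → ℤ) :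
    trigCoef b (fun x => c * f x) ξ = c * trigCoef b f ξ := by
  rw [trigCoef, trigCoef, ← torusIntegral_const_mul]
  simp only [mul_assoc]

theorem trigCoef_sub {f g : Space d → ℝ} (hf : Continuous f) (hg : Continuous g) (b : Bool)
    (ξ : Fin d → ℤ) :
    trigCoef b (fun x => f x - g x) ξ = trigCoef b f ξ - trigCoef b g ξ := by
  have ht := continuous_trigMode b ξ
  rw [trigCoef, trigCoef, trigCoef, ← torusIntegral_sub (hf.fun_mul ht) (hg.fun_mul ht)]
  simp only [sub_mul]

theorem trigCoef_const {ξ : Fin d → ℤ} (h : ξ ≠ 0) (c : ℝ) (b : Bool) :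
    trigCoef b (fun _ => c) ξ = 0 := by
  rw [trigCoef, torusIntegral_const_mul]
  cases b
  · rw [torusIntegral_odd (periodic_trigMode false ξ) (sinMode_neg ξ), mul_zero]
  · simp only [trigMode, torusIntegral_cosMode h, mul_zero]

theorem trigCoef_zero_of_mean_zero {f : Space d → ℝ} (hf : torusIntegral f = 0) (b : Bool) :
    trigCoef b f 0 = 0 := by
  cases b
  · simp [trigCoef, trigMode, sinMode, phase_zero, torusIntegral]
  · simpa [trigCoef, trigMode, cosMode, phase_zero] using hf

/-! ### Convolution with the kernel -/

theorem torusIntegral_sub_left {f : Space d → ℝ} (hf : IsPeriodic f) (x : Space d) :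
    torusIntegral (fun y => f (x - y)) = torusIntegral f := by
  have h1 := torusIntegral_comp_neg (hf.translate x)
  rw [torusIntegral_translate hf] at h1
  rw [← h1]
  congr 1; ext y
  rw [translate, neg_add_eq_sub]

theorem kernelCoef_eq {K : Space d → ℝ} (hK : Continuous K) (ξ : Fin d → ℤ) :
    kernelCoef K ξ = trigCoef true K ξ := by
  rw [kernelCoef, fourierCoef_eq hK]; simp

theorem kernelCoef_neg {K : Space d → ℝ} (hK : Continuous K) (ξ : Fin d → ℤ) :
    kernelCoef K (-ξ) = kernelCoef K ξ := by
  rw [kernelCoef_eq hK, kernelCoef_eq hK, trigCoef, trigCoef]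
  simp [trigMode, cosMode, phase_neg]

theorem exists_abs_kernelCoef_le {K : Space d → ℝ} (hK : IsKernel K) :
    ∃ B, 0 ≤ B ∧ ∀ ξ, |kernelCoef K ξ| ≤ B := by
  obtain ⟨C, hC⟩ := IsPeriodic.exists_bound hK.periodic hK.smooth.continuous
  refine ⟨C, (abs_nonneg _).trans (hC 0), fun ξ => ?_⟩
  rw [kernelCoef_eq hK.smooth.continuous]
  refine abs_torusIntegral_le (hK.smooth.continuous.mul (continuous_trigMode true ξ)) fun x => ?_
  rw [Pi.mul_apply, abs_mul]
  exact (mul_le_of_le_one_right (abs_nonneg _) (abs_trigMode_le _ _ _)).trans (hC x)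

theorem conv_trigMode {K : Space d → ℝ} (hK : IsKernel K) (b : Bool) (ξ : Fin d → ℤ)
    (x : Space d) : conv K (trigMode b ξ) x = kernelCoef K ξ * trigMode b ξ x := by
  have hc := hK.smooth.continuous
  have hs : trigCoef false K ξ = 0 := trigCoef_false_even hK.periodic hK.even ξ
  have c1 : Continuous fun y => K y * trigMode true ξ y := hc.mul (continuous_trigMode true ξ)
  have c2 : Continuous fun y => K y * trigMode false ξ y := hc.mul (continuous_trigMode false ξ)
  have hp : IsPeriodic fun y => K (x - y) * trigMode b ξ y := fun n y => by
    have : x - (y + latt n) = (x - y) + latt (-n) := by rw [latt_neg]; abel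
    simp only [this, hK.periodic _ _, periodic_trigMode b ξ n y]
  rw [conv, ← torusIntegral_sub_left hp x, kernelCoef_eq hc]
  cases b
  · have e : (fun y => K (x - (x - y)) * trigMode false ξ (x - y)) = fun y =>
        sinMode ξ x * (K y * trigMode true ξ y) - cosMode ξ x * (K y * trigMode false ξ y) := by
      ext y
      simp only [sub_sub_cancel, trigMode, sinMode, cosMode, phase_sub_right, Real.sin_sub]; ring
    rw [e, torusIntegral_sub (continuous_const.fun_mul c1) (continuous_const.fun_mul c2),
      torusIntegral_const_mul, torusIntegral_const_mul]
    change sinMode ξ x * trigCoef true K ξ - cosMode ξ x * trigCoef false K ξ = _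
    rw [hs, trigMode]; ring
  · have e : (fun y => K (x - (x - y)) * trigMode true ξ (x - y)) = fun y =>
        cosMode ξ x * (K y * trigMode true ξ y) + sinMode ξ x * (K y * trigMode false ξ y) := by
      ext y
      simp only [sub_sub_cancel, trigMode, sinMode, cosMode, phase_sub_right, Real.cos_sub]; ring
    rw [e, torusIntegral_add (continuous_const.fun_mul c1) (continuous_const.fun_mul c2),
      torusIntegral_const_mul, torusIntegral_const_mul]
    change cosMode ξ x * trigCoef true K ξ + sinMode ξ x * trigCoef false K ξ = _
    rw [hs, trigMode]; ring

theorem continuous_conv {K f : Space d → ℝ} (hK : IsKernel K) (hf : Continuous f)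
    (hp : IsPeriodic f) : Continuous (conv K f) := by
  obtain ⟨C, hC⟩ := IsPeriodic.exists_bound hK.periodic hK.smooth.continuous
  obtain ⟨C', hC'⟩ := hp.exists_bound hf
  have hc := hK.smooth.continuous
  refine continuous_of_dominated (bound := fun _ => C * C')
    (fun x => (Continuous.aestronglyMeasurable (by fun_prop)))
    (fun x => Eventually.of_forall fun y => ?_) (integrable_const _)
    (Eventually.of_forall fun y => by fun_prop)
  rw [norm_mul]
  exact mul_le_mul (hC _) (hC' _) (abs_nonneg _) ((abs_nonneg _).trans (hC 0))

theorem periodic_conv {K : Space d → ℝ} (hK : IsKernel K) (f : Space d → ℝ) :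
    IsPeriodic (conv K f) := by
  intro n x
  simp only [conv]
  congr 1; ext y
  rw [show x + latt n - y = (x - y) + latt n by abel, hK.periodic]

theorem conv_sub {K f g : Space d → ℝ} (hK : Continuous K) (hf : Continuous f)
    (hg : Continuous g) (x : Space d) :
    conv K (fun y => f y - g y) x = conv K f x - conv K g x := by
  rw [conv, conv, conv, ← torusIntegral_sub (by fun_prop) (by fun_prop)]
  simp only [mul_sub]

theorem conv_const {K : Space d → ℝ} (hK : IsKernel K) (c : ℝ) (x : Space d) :
    conv K (fun _ => c) x = 0 := by
  have : (fun y => K (x - y) * c) = fun y => c * K (x - y) := by ext y; ring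
  rw [conv, this, torusIntegral_const_mul, torusIntegral_sub_left hK.periodic, hK.mean_zero,
    mul_zero]

theorem conv_const_mul {K : Space d → ℝ} (c : ℝ) (f : Space d → ℝ) (x : Space d) :
    conv K (fun y => c * f y) x = c * conv K f x := by
  rw [conv, conv, ← torusIntegral_const_mul]
  congr 1; ext y; ring

theorem conv_translate {K f : Space d → ℝ} (hK : IsKernel K) (hp : IsPeriodic f) (τ x : Space d) :
    conv K (translate τ f) x = conv K f (x + τ) := by
  have hq : IsPeriodic fun y => K (x + τ - y) * f y := fun n y => by
    have : x + τ - (y + latt n) = (x + τ - y) + latt (-n) := by rw [latt_neg]; abel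
    simp only [this, hK.periodic _ _, hp n y]
  rw [conv, conv, ← torusIntegral_translate hq τ]
  congr 1; ext y
  simp only [translate]
  congr 2; abel

theorem trigCoef_conv {K f : Space d → ℝ} (hK : IsKernel K) (hf : Continuous f)
    (hp : IsPeriodic f) (b : Bool) (ξ : Fin d → ℤ) :
    trigCoef b (conv K f) ξ = kernelCoef K ξ * trigCoef b f ξ := by
  obtain ⟨C, hC⟩ := IsPeriodic.exists_bound hK.periodic hK.smooth.continuous
  obtain ⟨C', hC'⟩ := hp.exists_bound hf
  have hc := hK.smooth.continuous
  have ht := continuous_trigMode b ξ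
  have h1 : trigCoef b (conv K f) ξ =
      ∫ x in cell d, ∫ y in cell d, K (x - y) * f y * trigMode b ξ x := by
    refine integral_congr_ae (Eventually.of_forall fun x => ?_)
    exact (integral_mul_const (trigMode b ξ x) fun y => K (x - y) * f y).symm
  have hi : Integrable (Function.uncurry fun (x y : Space d) => K (x - y) * f y * trigMode b ξ x)
      ((volume.restrict (cell d)).prod (volume.restrict (cell d))) := by
    refine Integrable.of_bound (C := C * C') (Continuous.aestronglyMeasurable (by
      unfold Function.uncurry; fun_prop)) (Eventually.of_forall fun p => ?_)
    simp only [Function.uncurry, norm_mul]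
    refine (mul_le_of_le_one_right (by positivity) (abs_trigMode_le _ _ _)).trans ?_
    exact mul_le_mul (hC _) (hC' _) (abs_nonneg _) ((abs_nonneg _).trans (hC 0))
  rw [h1, integral_integral_swap hi, trigCoef, ← torusIntegral_const_mul]
  refine integral_congr_ae (Eventually.of_forall fun y => ?_)
  have e : (fun x => K (x - y) * f y * trigMode b ξ x) =
      fun x => f y * (K (y - x) * trigMode b ξ x) := by
    ext x
    rw [← hK.even (x - y), neg_sub]; ring
  have h2 := conv_trigMode hK b ξ y
  rw [conv] at h2
  change torusIntegral (fun x => K (x - y) * f y * trigMode b ξ x) = _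
  rw [e, torusIntegral_const_mul, h2]
  ring

theorem torusIntegral_conv_sq_le {K f : Space d → ℝ} (hK : IsKernel K) (hf : Continuous f)
    (hp : IsPeriodic f) {B : ℝ} (hB : ∀ ξ, |kernelCoef K ξ| ≤ B) :
    torusIntegral (fun x => conv K f x ^ 2) ≤ B ^ 2 * torusIntegral (fun x => f x ^ 2) := by
  refine hasSum_le (fun ξ => ?_) (hasSum_sq_trigCoef (periodic_conv hK f)
    (continuous_conv hK hf hp)) ((hasSum_sq_trigCoef hp hf).mul_left (B ^ 2))
  rw [trigCoef_conv hK hf hp, trigCoef_conv hK hf hp, mul_pow, mul_pow, ← mul_add]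
  have : kernelCoef K ξ ^ 2 ≤ B ^ 2 := sq_le_sq' (by linarith [neg_abs_le (kernelCoef K ξ), hB ξ])
    ((le_abs_self _).trans (hB ξ))
  gcongr

theorem eq_zero_of_torusIntegral_sq_le {f : Space d → ℝ} (hf : Continuous f) (hp : IsPeriodic f)
    (h : torusIntegral (fun x => f x ^ 2) ≤ 0) : f = 0 := by
  have hc : ∀ x ∈ closure (interior (cell d)), f x = 0 := by
    have h0 : ∫ x in cell d, f x ^ 2 = 0 :=
      le_antisymm h (integral_nonneg fun x => sq_nonneg _)
    have h1 := (integral_eq_zero_iff_of_nonneg (fun x => sq_nonneg (f x))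
      (integrableOn_cell (hf.pow 2))).1 h0
    have h2 : f =ᵐ[volume.restrict (interior (cell d))] 0 := by
      refine ae_restrict_of_ae_restrict_of_subset interior_subset ?_
      filter_upwards [h1] with x hx
      simpa using hx
    have h3 := Measure.eqOn_open_of_ae_eq h2 isOpen_interior hf.continuousOn continuousOn_const
    exact fun x hx => h3.closure hf continuous_const hx
  have hI : ∀ x : Space d, (∀ i, x i ∈ Icc (0 : ℝ) 1) → f x = 0 := by
    intro x hx
    apply hc
    have ho : {x : Space d | ∀ i, x i ∈ Ioo (0 : ℝ) 1} ⊆ interior (cell d) := by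
      refine interior_maximal (fun x hx i => ⟨(hx i).1.le, (hx i).2⟩) ?_
      have : {x : Space d | ∀ i, x i ∈ Ioo (0 : ℝ) 1} =
          ⋂ i, (fun x : Space d => x i) ⁻¹' Ioo (0 : ℝ) 1 := by ext x; simp
      rw [this]
      exact isOpen_iInter_of_finite fun i => isOpen_Ioo.preimage (by fun_prop)
    refine closure_mono ho ?_
    -- the segment from an interior point to `x` stays in the open cell
    have hl : Tendsto (fun t : ℝ => x + t • (WithLp.toLp 2 (fun _ => (1 / 2 : ℝ)) - x))
        (𝓝[>] 0) (𝓝 x) := by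
      have : Continuous fun t : ℝ => x + t • (WithLp.toLp 2 (fun _ => (1 / 2 : ℝ)) - x) := by
        fun_prop
      have h := this.tendsto 0
      simp only [zero_smul, add_zero] at h
      exact h.mono_left nhdsWithin_le_nhds
    refine mem_closure_of_tendsto hl ?_
    filter_upwards [Ioo_mem_nhdsGT (show (0 : ℝ) < 1 by norm_num)] with t ht i
    have := hx i
    simp only [PiLp.add_apply, PiLp.smul_apply, PiLp.sub_apply, smul_eq_mul]
    constructor <;> nlinarith [this.1, this.2, ht.1, ht.2]
  -- by periodicity it suffices to look at the closed cell
  ext x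
  have h1 := hp (fun i => -⌊x i⌋) x
  rw [← h1]
  refine hI _ fun i => ?_
  have a := Int.floor_le (x i)
  have b := (Int.lt_floor_add_one (x i)).le
  simp only [PiLp.add_apply, latt, mem_Icc]
  push_cast
  constructor <;> linarith

/-! ### The linearization at the critical coupling -/

/-- Minus the determinant of the symbol of the linearized operator, divided by `(2π|ξ|)²`. -/
def symbolDet (ν : ℝ) (K : Space d → ℝ) (γc : ℝ) (ξ : Fin d → ℤ) : ℝ :=
  ν ^ 2 * freqSq ξ + γc * kernelCoef K ξ

theorem SimpleCriticalPair.mem {ν : ℝ} {K : Space d → ℝ} {γc : ℝ} {ξ₀ : Fin d → ℤ}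
    (h : SimpleCriticalPair ν K γc ξ₀) : ξ₀ ∈ criticalSet ν K := by
  rw [h.modes]; simp

theorem SimpleCriticalPair.threshold {ν : ℝ} {K : Space d → ℝ} {γc : ℝ} {ξ₀ : Fin d → ℤ}
    (h : SimpleCriticalPair ν K γc ξ₀) : ν ^ 2 * freqSq ξ₀ / |kernelCoef K ξ₀| = γc := by
  have h2 := h.mem.2.2
  rw [h.coupling] at h2
  exact_mod_cast h2

theorem SimpleCriticalPair.symbolDet_eq_zero {ν : ℝ} {K : Space d → ℝ} {γc : ℝ} {ξ₀ : Fin d → ℤ}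
    (h : SimpleCriticalPair ν K γc ξ₀) : γc * kernelCoef K ξ₀ = -(ν ^ 2 * freqSq ξ₀) := by
  have h1 := h.mem.2.1
  rw [← h.threshold, abs_of_neg h1, div_neg, neg_mul, div_mul_cancel₀ _ h1.ne]

theorem SimpleCriticalPair.nonneg {ν : ℝ} {K : Space d → ℝ} {γc : ℝ} {ξ₀ : Fin d → ℤ}
    (h : SimpleCriticalPair ν K γc ξ₀) : 0 ≤ γc := by
  rw [← h.threshold]
  exact div_nonneg (mul_nonneg (sq_nonneg _) (freqSq_nonneg _)) (abs_nonneg _)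

theorem SimpleCriticalPair.symbolDet_pos {ν : ℝ} (hν : 0 < ν) {K : Space d → ℝ} {γc : ℝ}
    {ξ₀ ξ : Fin d → ℤ} (h : SimpleCriticalPair ν K γc ξ₀) (h0 : ξ ≠ 0) (h1 : ξ ≠ ξ₀)
    (h2 : ξ ≠ -ξ₀) : 0 < symbolDet ν K γc ξ := by
  have hk := one_le_freqSq h0
  have hνk : 0 < ν ^ 2 * freqSq ξ := by positivity
  rcases le_or_gt 0 (kernelCoef K ξ) with hκ | hκ
  · have := mul_nonneg h.nonneg hκ
    unfold symbolDet; linarith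
  · have hle : (γc : EReal) ≤ (modeThreshold ν K ξ : EReal) := by
      rw [← h.coupling]
      exact iInf₂_le ξ ⟨h0, hκ⟩
    have hne : (modeThreshold ν K ξ : EReal) ≠ (γc : EReal) := by
      intro he
      have : ξ ∈ criticalSet ν K := ⟨h0, hκ, by rw [h.coupling, he]⟩
      rw [h.modes] at this
      rcases this with h | h
      exacts [h1 h, h2 h]
    have hlt : γc < modeThreshold ν K ξ := by
      exact_mod_cast lt_of_le_of_ne hle hne.symm
    have : γc < ν ^ 2 * freqSq ξ / -kernelCoef K ξ := by
      rw [modeThreshold, abs_of_neg hκ] at hlt; exact hlt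
    rw [lt_div_iff₀ (by linarith)] at this
    unfold symbolDet; linarith

theorem finite_freqSq_le (R : ℝ) : {ξ : Fin d → ℤ | freqSq ξ ≤ R}.Finite := by
  obtain ⟨N, hN⟩ := exists_nat_ge R
  refine (Set.finite_Icc (fun _ : Fin d => -(N : ℤ)) (fun _ => (N : ℤ))).subset fun ξ hξ => ?_
  have h : ∀ i, |ξ i| ≤ (N : ℤ) := by
    intro i
    have h1 : (2 * Real.pi * ξ i) ^ 2 ≤ freqSq ξ := by
      rw [freqSq_eq_sum]
      exact Finset.single_le_sum (f := fun i => (2 * Real.pi * (ξ i : ℝ)) ^ 2)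
        (fun _ _ => sq_nonneg _) (Finset.mem_univ i)
    have h2 : (ξ i : ℝ) ^ 2 ≤ (2 * Real.pi * ξ i) ^ 2 := by
      rw [mul_pow]
      have : 1 ≤ (2 * Real.pi) ^ 2 := one_le_pow₀ (by linarith [Real.pi_gt_three])
      nlinarith [sq_nonneg (ξ i : ℝ)]
    have h3 : ((ξ i) ^ 2 : ℤ) ≤ N := by
      have : (ξ i : ℝ) ^ 2 ≤ N := h2.trans (h1.trans (le_trans hξ hN))
      exact_mod_cast this
    have h4 : |ξ i| ≤ (ξ i) ^ 2 := by
      rw [← sq_abs]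
      nlinarith [abs_nonneg (ξ i), Int.one_le_abs (z := ξ i), eq_or_ne (ξ i) 0,
        show |ξ i| = 0 ∨ 1 ≤ |ξ i| by have := abs_nonneg (ξ i); omega]
    exact h4.trans h3
  exact ⟨fun i => (abs_le.1 (h i)).1, fun i => (abs_le.1 (h i)).2⟩

/-- Away from the critical modes the determinant of the symbol is uniformly elliptic: it is
positive for every such mode, and comparable to `(2π|ξ|)²` for all but finitely many of them. -/
theorem SimpleCriticalPair.exists_le_symbolDet {ν : ℝ} (hν : 0 < ν) {K : Space d → ℝ}
    (hK : IsKernel K) {γc : ℝ} {ξ₀ : Fin d → ℤ} (h : SimpleCriticalPair ν K γc ξ₀) :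
    ∃ c > 0, ∀ ξ, ξ ≠ 0 → ξ ≠ ξ₀ → ξ ≠ -ξ₀ → c * freqSq ξ ≤ symbolDet ν K γc ξ := by
  obtain ⟨B, hB0, hB⟩ := exists_abs_kernelCoef_le hK
  have hγ := h.nonneg
  -- beyond this threshold the term `ν² k` of the determinant dominates `γc K̂`
  set R := 2 * (γc * B) / ν ^ 2
  have hfin := finite_freqSq_le (d := d) R
  obtain ⟨c₁, hc₁, h₁⟩ : ∃ c > 0, ∀ ξ ∈ {ξ : Fin d → ℤ | freqSq ξ ≤ R}, ξ ≠ 0 → ξ ≠ ξ₀ →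
      ξ ≠ -ξ₀ → c * freqSq ξ ≤ symbolDet ν K γc ξ := by
    generalize {ξ : Fin d → ℤ | freqSq ξ ≤ R} = S at hfin
    induction S, hfin using Set.Finite.induction_on with
    | empty => exact ⟨1, one_pos, by simp⟩
    | @insert a s _ _ ih =>
      obtain ⟨c, hc, hs⟩ := ih
      by_cases ha : a ≠ 0 ∧ a ≠ ξ₀ ∧ a ≠ -ξ₀
      · have hp := h.symbolDet_pos hν ha.1 ha.2.1 ha.2.2
        have hk := one_le_freqSq ha.1
        have hk' : 0 < freqSq a := by linarith
        refine ⟨min c (symbolDet ν K γc a / freqSq a), lt_min hc (div_pos hp hk'), ?_⟩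
        rintro ξ (rfl | hξ) e0 e1 e2
        · exact (mul_le_mul_of_nonneg_right (min_le_right _ _) hk'.le).trans
            (div_mul_cancel₀ _ hk'.ne').le
        · exact (mul_le_mul_of_nonneg_right (min_le_left _ _) (freqSq_nonneg _)).trans
            (hs ξ hξ e0 e1 e2)
      · refine ⟨c, hc, ?_⟩
        rintro ξ (rfl | hξ) e0 e1 e2
        · exact absurd ⟨e0, e1, e2⟩ ha
        · exact hs ξ hξ e0 e1 e2
  refine ⟨min c₁ (ν ^ 2 / 2), by positivity, fun ξ e0 e1 e2 => ?_⟩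
  rcases le_or_gt (freqSq ξ) R with hR | hR
  · exact (mul_le_mul_of_nonneg_right (min_le_left _ _) (freqSq_nonneg _)).trans
      (h₁ ξ hR e0 e1 e2)
  · refine (mul_le_mul_of_nonneg_right (min_le_right _ _) (freqSq_nonneg _)).trans ?_
    rw [div_lt_iff₀ (by positivity)] at hR
    have h1 : -(γc * B) ≤ γc * kernelCoef K ξ := by
      rw [← mul_neg]
      exact mul_le_mul_of_nonneg_left (by linarith [neg_abs_le (kernelCoef K ξ), hB ξ]) hγ
    unfold symbolDet
    nlinarith

/-- The symbol of the linearized operator at a noncritical mode is inverted with gain of two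
derivatives. -/
theorem noncritical_symbol_bound {ν γκ c k : ℝ} (hν : 0 < ν) (hc : 0 < c) (hk : 1 ≤ k)
    (hD : c * k ≤ ν ^ 2 * k + γκ) {u v f g : ℝ} (h1 : ν * k * v - γκ * u = f)
    (h2 : ν * k * u + k * v = g) :
    (1 + k ^ 2) * (u ^ 2 + v ^ 2) ≤
      (8 * (1 + ν ^ 2) ^ 2 / c ^ 2 + 4) * (f ^ 2 + g ^ 2) := by
  have hu : (ν ^ 2 * k + γκ) * u = ν * g - f := by rw [← h1, ← h2]; ring
  have hv : k * v = g - ν * (k * u) := by rw [← h2]; ring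
  have e1 : (c * k * u) ^ 2 ≤ (ν * g - f) ^ 2 := by
    rw [← hu, mul_pow, mul_pow (ν ^ 2 * k + γκ)]
    gcongr
  have e2 : (ν * g - f) ^ 2 ≤ (1 + ν ^ 2) * (f ^ 2 + g ^ 2) := by nlinarith [sq_nonneg (g + ν * f)]
  have e3 : (k * u) ^ 2 ≤ (1 + ν ^ 2) / c ^ 2 * (f ^ 2 + g ^ 2) := by
    rw [div_mul_eq_mul_div, le_div_iff₀ (by positivity)]
    nlinarith
  have e4 : (k * v) ^ 2 ≤ 2 * g ^ 2 + 2 * ν ^ 2 * (k * u) ^ 2 := by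
    rw [hv]; nlinarith [sq_nonneg (g + ν * (k * u))]
  have e5 : (1 + k ^ 2) * (u ^ 2 + v ^ 2) ≤ 2 * ((k * u) ^ 2 + (k * v) ^ 2) := by
    have : 1 ≤ k ^ 2 := one_le_pow₀ hk
    nlinarith [mul_nonneg (sub_nonneg.2 this) (add_nonneg (sq_nonneg u) (sq_nonneg v))]
  have e6 : (k * u) ^ 2 + (k * v) ^ 2 ≤
      2 * g ^ 2 + 2 * (1 + ν ^ 2) * ((1 + ν ^ 2) / c ^ 2 * (f ^ 2 + g ^ 2)) := by
    have : 2 * (1 + ν ^ 2) * (k * u) ^ 2 ≤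
        2 * (1 + ν ^ 2) * ((1 + ν ^ 2) / c ^ 2 * (f ^ 2 + g ^ 2)) := by gcongr
    nlinarith [sq_nonneg (k * u)]
  have e7 : 2 * (1 + ν ^ 2) * ((1 + ν ^ 2) / c ^ 2 * (f ^ 2 + g ^ 2)) * 2 =
      4 * (1 + ν ^ 2) ^ 2 / c ^ 2 * (f ^ 2 + g ^ 2) := by ring
  have e8 : 0 ≤ (1 + ν ^ 2) ^ 2 / c ^ 2 * (f ^ 2 + g ^ 2) := by positivity
  have e9 : 8 * (1 + ν ^ 2) ^ 2 / c ^ 2 * (f ^ 2 + g ^ 2) =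
      8 * ((1 + ν ^ 2) ^ 2 / c ^ 2 * (f ^ 2 + g ^ 2)) := by ring
  have e10 : 4 * (1 + ν ^ 2) ^ 2 / c ^ 2 * (f ^ 2 + g ^ 2) =
      4 * ((1 + ν ^ 2) ^ 2 / c ^ 2 * (f ^ 2 + g ^ 2)) := by ring
  rw [add_mul _ (4 : ℝ), e9]
  nlinarith [sq_nonneg f, sq_nonneg g]

/-- At a critical mode only the combination of the two equations orthogonal to the cokernel is
available; with the component along the kernel (or the first component) prescribed to be zero it
still determines the pair. -/
theorem critical_symbol_bound {ν k r : ℝ} (hν : 0 < ν) (hk : 1 ≤ k) {u v f g : ℝ}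
    (h1 : ν * k * v + ν ^ 2 * k * u = f + r) (h2 : ν * k * u + k * v = g - ν * r)
    (h : u = 0 ∨ u = ν * v) :
    (1 + k ^ 2) * (u ^ 2 + v ^ 2) ≤ 2 * (f ^ 2 + g ^ 2) := by
  have hs : k * (1 + ν ^ 2) * (ν * u + v) = ν * f + g := by linear_combination ν * h1 + h2
  have e1 : (1 + ν ^ 2) * (k ^ 2 * (u ^ 2 + v ^ 2)) ≤ (1 + ν ^ 2) * (f ^ 2 + g ^ 2) := by
    have hsq : (k * (1 + ν ^ 2) * (ν * u + v)) ^ 2 ≤ (1 + ν ^ 2) * (f ^ 2 + g ^ 2) := by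
      rw [hs]; nlinarith [sq_nonneg (f - ν * g)]
    refine le_trans ?_ hsq
    have hν1 : 1 ≤ 1 + ν ^ 2 := by nlinarith [sq_nonneg ν]
    rcases h with h | h
    · rw [h]
      have : 0 ≤ (k * v) ^ 2 * (1 + ν ^ 2) * ν ^ 2 := by positivity
      nlinarith
    · rw [h]
      have : 0 ≤ (k * v) ^ 2 * (1 + ν ^ 2) ^ 2 * ((1 + ν ^ 2) ^ 2 - 1) := by
        have : 0 ≤ (1 + ν ^ 2) ^ 2 - 1 := by nlinarith
        positivity
      nlinarith
  have e2 := le_of_mul_le_mul_left e1 (by positivity)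
  have : 1 ≤ k ^ 2 := one_le_pow₀ hk
  nlinarith [mul_nonneg (sub_nonneg.2 this) (add_nonneg (sq_nonneg u) (sq_nonneg v))]

/-- Coercivity of the linearized operator at the critical coupling on pairs that satisfy the phase
condition and have zero amplitude, modulo constants in the first equation and multiples of the
critical vector. -/
theorem SimpleCriticalPair.exists_coercive {ν : ℝ} (hν : 0 < ν) {K : Space d → ℝ}
    (hK : IsKernel K) {γc : ℝ} {ξ₀ : Fin d → ℤ} (h : SimpleCriticalPair ν K γc ξ₀) :
    ∃ C > 0, ∀ (u v F G : Space d → ℝ) (l r : ℝ), ContDiff ℝ 2 u → ContDiff ℝ 2 v →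
      IsPeriodic u → IsPeriodic v → torusIntegral u = 0 → torusIntegral v = 0 →
      PhaseFixed ξ₀ u → critPairing ν ξ₀ u v = 0 → Continuous F → Continuous G →
      IsPeriodic F → IsPeriodic G →
      (∀ x, -ν * lap v x - γc * conv K u x + l - r * cosMode ξ₀ x = F x) →
      (∀ x, -ν * lap u x - lap v x + ν * r * cosMode ξ₀ x = G x) →
      torusIntegral (fun x => u x ^ 2) + torusIntegral (fun x => lap u x ^ 2) +
        torusIntegral (fun x => v x ^ 2) + torusIntegral (fun x => lap v x ^ 2) ≤
      C * (torusIntegral (fun x => F x ^ 2) + torusIntegral (fun x => G x ^ 2)) := by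
  obtain ⟨c, hc, hD⟩ := h.exists_le_symbolDet hν hK
  refine ⟨8 * (1 + ν ^ 2) ^ 2 / c ^ 2 + 4, by positivity, ?_⟩
  intro u v F G l r hu hv pu pv mu mv hph ham cF cG pF pG hF hG
  -- by Parseval the estimate may be checked mode by mode
  have key : ∀ (b : Bool) (ξ : Fin d → ℤ),
      trigCoef b u ξ ^ 2 + trigCoef b (lap u) ξ ^ 2 + trigCoef b v ξ ^ 2 +
        trigCoef b (lap v) ξ ^ 2 ≤
      (8 * (1 + ν ^ 2) ^ 2 / c ^ 2 + 4) * (trigCoef b F ξ ^ 2 + trigCoef b G ξ ^ 2) := by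
    intro b ξ
    rw [trigCoef_lap hu pu, trigCoef_lap hv pv]
    have e : trigCoef b u ξ ^ 2 + (-freqSq ξ * trigCoef b u ξ) ^ 2 + trigCoef b v ξ ^ 2 +
        (-freqSq ξ * trigCoef b v ξ) ^ 2 =
        (1 + freqSq ξ ^ 2) * (trigCoef b u ξ ^ 2 + trigCoef b v ξ ^ 2) := by ring
    rw [e]
    by_cases h0 : ξ = 0
    · rw [h0, trigCoef_zero_of_mean_zero mu, trigCoef_zero_of_mean_zero mv]
      simp only [ne_eq, OfNat.ofNat_ne_zero, not_false_eq_true, zero_pow, add_zero, mul_zero]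
      positivity
    have hk := one_le_freqSq h0
    have cu := hu.continuous
    have cc : Continuous (cosMode ξ₀) := continuous_trigMode true ξ₀
    have cK := continuous_conv hK cu pu
    have E1 : ν * freqSq ξ * trigCoef b v ξ - γc * kernelCoef K ξ * trigCoef b u ξ =
        trigCoef b F ξ + r * trigCoef b (cosMode ξ₀) ξ := by
      have cA := continuous_lap hv
      have : F = fun x => ((-ν) * lap v x - γc * conv K u x + l) - r * cosMode ξ₀ x := by
        ext x; exact (hF x).symm
      rw [this, trigCoef_sub (by fun_prop) (by fun_prop), trigCoef_add (by fun_prop) (by fun_prop),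
        trigCoef_sub (by fun_prop) (by fun_prop), trigCoef_const_mul, trigCoef_const_mul,
        trigCoef_const_mul, trigCoef_const h0, trigCoef_lap hv pv, trigCoef_conv hK cu pu]
      ring
    have E2 : ν * freqSq ξ * trigCoef b u ξ + freqSq ξ * trigCoef b v ξ =
        trigCoef b G ξ - ν * (r * trigCoef b (cosMode ξ₀) ξ) := by
      have cA := continuous_lap hv
      have cB := continuous_lap hu
      have : G = fun x => ((-ν) * lap u x - lap v x) + (ν * r) * cosMode ξ₀ x := by
        ext x; exact (hG x).symm
      rw [this, trigCoef_add (by fun_prop) (by fun_prop), trigCoef_sub (by fun_prop) (by fun_prop),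
        trigCoef_const_mul, trigCoef_const_mul, trigCoef_lap hv pv, trigCoef_lap hu pu]
      ring
    by_cases h1 : ξ = ξ₀ ∨ ξ = -ξ₀
    · have hκ : γc * kernelCoef K ξ = -(ν ^ 2 * freqSq ξ) := by
        rcases h1 with rfl | rfl
        · exact h.symbolDet_eq_zero
        · rw [kernelCoef_neg hK.smooth.continuous, freqSq_neg]; exact h.symbolDet_eq_zero
      -- the phase condition for the sine modes, vanishing amplitude for the cosine modes
      have hz : trigCoef b u ξ = 0 ∨ trigCoef b u ξ = ν * trigCoef b v ξ := by
        cases b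
        · left
          rcases h1 with rfl | rfl
          · exact hph
          · have : trigCoef false u (-ξ₀) = -trigCoef false u ξ₀ := by
              rw [trigCoef, trigCoef, ← torusIntegral_neg]
              simp [trigMode, sinMode, phase_neg]
            rw [this, show trigCoef false u ξ₀ = 0 from hph, neg_zero]
        · right
          have h3 : trigCoef true u ξ₀ = ν * trigCoef true v ξ₀ := by
            have h4 : 2 / (1 + ν ^ 2) ≠ 0 := by positivity
            have := (mul_eq_zero.1 ham).resolve_left h4
            exact sub_eq_zero.1 this
          rcases h1 with rfl | rfl
          · exact h3
          · have : ∀ w : Space d → ℝ, trigCoef true w (-ξ₀) = trigCoef true w ξ₀ := by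
              intro w
              simp [trigCoef, trigMode, cosMode, phase_neg]
            rw [this, this, h3]
      rw [hκ] at E1
      refine (critical_symbol_bound hν hk
        (E1.symm.trans (by ring)).symm E2 hz).trans ?_
      have : 0 ≤ 8 * (1 + ν ^ 2) ^ 2 / c ^ 2 := by positivity
      gcongr
      linarith
    · push Not at h1
      have hz : trigCoef b (cosMode ξ₀) ξ = 0 := by
        cases b
        · exact trigCoef_false_cosMode ξ₀ ξ
        · rw [trigCoef_true_cosMode, if_neg (Ne.symm h1.1), if_neg]
          · simp
          · rintro rfl; exact h1.2 (neg_neg ξ).symm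
      rw [hz, mul_zero, add_zero] at E1
      rw [hz, mul_zero, mul_zero, sub_zero] at E2
      exact noncritical_symbol_bound hν hc hk (hD ξ h0 h1.1 h1.2) E1 E2
  refine hasSum_le (fun ξ => ?_)
    ((((hasSum_sq_trigCoef pu hu.continuous).add
      (hasSum_sq_trigCoef pu.lap (continuous_lap hu))).add
      (hasSum_sq_trigCoef pv hv.continuous)).add (hasSum_sq_trigCoef pv.lap (continuous_lap hv)))
    (((hasSum_sq_trigCoef pF cF).add (hasSum_sq_trigCoef pG cG)).mul_left
      (8 * (1 + ν ^ 2) ^ 2 / c ^ 2 + 4))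
  have k1 := key true ξ
  have k2 := key false ξ
  linarith

/-! ### Uniqueness for the complement equation -/

theorem C2Small.abs_lt {ε : ℝ} {f : Space d → ℝ} (h : C2Small ε f) (x : Space d) : |f x| < ε := by
  simpa using h 0 (by norm_num) x

theorem C2Small.abs_pd_lt {ε : ℝ} {f : Space d → ℝ} (h : C2Small ε f) (i : Fin d) (x : Space d) :
    |pd i f x| < ε := by
  refine lt_of_le_of_lt ?_ (h 1 (by norm_num) x)
  rw [norm_iteratedFDeriv_one]
  simpa [pd] using (fderiv ℝ f x).le_opNorm (EuclideanSpace.single i 1)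

theorem C2Small.abs_lap_le {ε : ℝ} {f : Space d → ℝ} (h : C2Small ε f) (hf : ContDiff ℝ 2 f)
    (x : Space d) : |lap f x| ≤ d * ε := by
  refine (Finset.abs_sum_le_sum_abs _ _).trans ?_
  have : ∀ i ∈ (Finset.univ : Finset (Fin d)), |pd i (pd i f) x| ≤ ε := by
    intro i _
    rw [iteratedFDeriv_two_single hf]
    refine le_trans ?_ (h 2 le_rfl x).le
    simpa using (iteratedFDeriv ℝ 2 f x).le_opNorm
      ![EuclideanSpace.single i (1 : ℝ), EuclideanSpace.single i (1 : ℝ)]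
  simpa using Finset.sum_le_sum this

theorem sq_sum_mul_le {ε : ℝ} {a b : Fin d → ℝ} (ha : ∀ i, |a i| ≤ ε) :
    (∑ i, a i * b i) ^ 2 ≤ d * ε ^ 2 * ∑ i, b i ^ 2 := by
  have h1 := sq_sum_le_card_mul_sum_sq (s := Finset.univ) (f := fun i => a i * b i)
  rw [Finset.card_univ, Fintype.card_fin] at h1
  refine h1.trans ?_
  rw [mul_assoc, Finset.mul_sum (f := fun i => b i ^ 2)]
  gcongr with i
  rw [mul_pow]
  exact mul_le_mul_of_nonneg_right (sq_le_sq.2 ((ha i).trans (le_abs_self ε))) (sq_nonneg _)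

theorem sq_add_four_le (p q s t : ℝ) :
    (p + q + s + t) ^ 2 ≤ 4 * (p ^ 2 + q ^ 2 + s ^ 2 + t ^ 2) := by
  nlinarith [sq_nonneg (p - q), sq_nonneg (p - s), sq_nonneg (p - t), sq_nonneg (q - s),
    sq_nonneg (q - t), sq_nonneg (s - t)]

/-- Interpolation of the gradient between the function and its Laplacian, by Green's identity. -/
theorem sum_torusIntegral_pd_sq_le {f : Space d → ℝ} (hf : ContDiff ℝ 2 f) (hp : IsPeriodic f) :
    torusIntegral (fun x => ∑ i, pd i f x ^ 2) ≤
      torusIntegral (fun x => f x ^ 2) + torusIntegral (fun x => lap f x ^ 2) := by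
  have cp : ∀ i, Continuous (pd i f) := fun i =>
    (contDiff_pd (m := 1) hf (by norm_num) i).continuous
  have cf := hf.continuous
  have cl := continuous_lap hf
  have h := torusIntegral_lap_mul hf hf hp hp
  rw [torusIntegral_finsetSum _ fun i _ => (cp i).fun_pow 2]
  have e : ∑ i, torusIntegral (fun x => pd i f x ^ 2) =
      torusIntegral (fun x => -(lap f x * f x)) := by
    rw [torusIntegral_neg, h, neg_neg]
    simp only [pow_two]
  have h2 : torusIntegral (fun x => -(lap f x * f x)) ≤
      torusIntegral (fun x => f x ^ 2 + lap f x ^ 2) :=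
    torusIntegral_mono (by fun_prop) (by fun_prop) fun x => by
      nlinarith [sq_nonneg (f x + lap f x), sq_nonneg (f x), sq_nonneg (lap f x)]
  rw [torusIntegral_add (by fun_prop) (by fun_prop)] at h2
  exact e.trans_le h2

theorem lap_sub {f g : Space d → ℝ} (hf : ContDiff ℝ 2 f) (hg : ContDiff ℝ 2 g) (x : Space d) :
    lap (fun y => f y - g y) x = lap f x - lap g x := by
  unfold lap
  rw [← Finset.sum_sub_distrib]
  refine Finset.sum_congr rfl fun i _ => ?_
  have e : pd i (fun y => f y - g y) = fun y => pd i f y - pd i g y :=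
    funext fun y => pd_sub (hf.differentiable (by norm_num)) (hg.differentiable (by norm_num)) i y
  rw [e, pd_sub ((contDiff_pd (m := 1) hf (by norm_num) i).differentiable (by norm_num))
    ((contDiff_pd (m := 1) hg (by norm_num) i).differentiable (by norm_num))]

set_option maxHeartbeats 1000000 in
/-- Small solutions of the complement equation with the same amplitude and the same coupling
coincide. The difference of two such solutions solves the linearized equation with a right-hand side
whose `L²` norm is a small multiple of the `H²` norm of the difference, so coercivity applies. -/
theorem SimpleCriticalPair.exists_solvesComplement_unique {ν : ℝ} (hν : 0 < ν) {K : Space d → ℝ}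
    (hK : IsKernel K) {γc : ℝ} {ξ₀ : Fin d → ℤ} (h : SimpleCriticalPair ν K γc ξ₀) :
    ∃ ε > 0, ∀ (γ A : ℝ) (μ₁ w₁ μ₂ w₂ : Space d → ℝ) (l₁ l₂ : ℝ), |γ - γc| < ε →
      SolvesComplement ν K ξ₀ γ A μ₁ w₁ l₁ → NearUniform ε w₁ (fun x => 1 + μ₁ x) l₁ →
      SolvesComplement ν K ξ₀ γ A μ₂ w₂ l₂ → NearUniform ε w₂ (fun x => 1 + μ₂ x) l₂ →
      μ₁ = μ₂ ∧ w₁ = w₂ ∧ l₁ = l₂ := by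
  obtain ⟨C, hC, hcoer⟩ := h.exists_coercive hν hK
  obtain ⟨B, hB0, hB⟩ := exists_abs_kernelCoef_le hK
  -- `M ε²` bounds the ratio of the squared norms of the right-hand side and of the difference
  set M : ℝ := 2 * B ^ 2 + 10 * d + 4 * d ^ 2 + 4 with hM
  have hMpos : 0 < M := by positivity
  set ε : ℝ := 1 / (2 * (C * M + 1)) with hε
  have hεpos : 0 < ε := by positivity
  have hε1 : ε ≤ 1 := by
    rw [hε, div_le_one (by positivity)]
    nlinarith [mul_pos hC hMpos]
  have hεCM : C * M * ε ≤ 1 / 2 := by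
    rw [hε, mul_one_div, div_le_iff₀ (by positivity)]; linarith
  refine ⟨ε, hεpos, ?_⟩
  intro γ A μ₁ w₁ μ₂ w₂ l₁ l₂ hγ s₁ n₁ s₂ n₂
  have n1w := n₁.1
  have n1μ : C2Small ε μ₁ := by simpa using n₁.2.1
  have n2w := n₂.1
  have n2μ : C2Small ε μ₂ := by simpa using n₂.2.1
  set u : Space d → ℝ := fun x => μ₁ x - μ₂ x with hu_def
  set v : Space d → ℝ := fun x => w₁ x - w₂ x with hv_def
  have cu : ContDiff ℝ 2 u := s₁.contDiff_mu.sub s₂.contDiff_mu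
  have cv : ContDiff ℝ 2 v := s₁.contDiff_w.sub s₂.contDiff_w
  have pu : IsPeriodic u := fun n x => by simp only [hu_def, s₁.periodic_mu n x, s₂.periodic_mu n x]
  have pv : IsPeriodic v := fun n x => by simp only [hv_def, s₁.periodic_w n x, s₂.periodic_w n x]
  have cμ₁ := s₁.contDiff_mu.continuous
  have cμ₂ := s₂.contDiff_mu.continuous
  have cw₁ := s₁.contDiff_w.continuous
  have cw₂ := s₂.contDiff_w.continuous
  have mu0 : torusIntegral u = 0 := by
    rw [hu_def, torusIntegral_sub cμ₁ cμ₂, s₁.mean_mu, s₂.mean_mu, sub_zero]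
  have mv0 : torusIntegral v = 0 := by
    rw [hv_def, torusIntegral_sub cw₁ cw₂, s₁.mean_w, s₂.mean_w, sub_zero]
  have hph : PhaseFixed ξ₀ u := by
    change trigCoef false u ξ₀ = 0
    rw [hu_def, trigCoef_sub cμ₁ cμ₂, show trigCoef false μ₁ ξ₀ = 0 from s₁.phaseFixed,
      show trigCoef false μ₂ ξ₀ = 0 from s₂.phaseFixed, sub_zero]
  have ham : critPairing ν ξ₀ u v = 0 := by
    have a₁ := s₁.amplitude
    have a₂ := s₂.amplitude
    change 2 / (1 + ν ^ 2) * (trigCoef true _ ξ₀ - ν * trigCoef true _ ξ₀) = A at a₁ a₂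
    change 2 / (1 + ν ^ 2) * (trigCoef true u ξ₀ - ν * trigCoef true v ξ₀) = 0
    rw [hu_def, hv_def, trigCoef_sub cμ₁ cμ₂, trigCoef_sub cw₁ cw₂]
    linear_combination a₁ - a₂
  have dp : ∀ {f : Space d → ℝ}, ContDiff ℝ 2 f → ∀ i, Continuous (pd i f) :=
    fun hf i => (contDiff_pd (m := 1) hf (by norm_num) i).continuous
  have dw₁ := dp s₁.contDiff_w
  have dw₂ := dp s₂.contDiff_w
  have dμ₁ := dp s₁.contDiff_mu
  have dμ₂ := dp s₂.contDiff_mu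
  have du := dp cu
  have dv := dp cv
  have lw₁ := continuous_lap s₁.contDiff_w
  have lu := continuous_lap cu
  have lv := continuous_lap cv
  have cuc := cu.continuous
  have cK := continuous_conv hK cuc pu
  have pdv : ∀ i x, pd i v x = pd i w₁ x - pd i w₂ x := fun i x =>
    pd_sub (s₁.contDiff_w.differentiable (by norm_num))
      (s₂.contDiff_w.differentiable (by norm_num)) i x
  have pdu : ∀ i x, pd i u x = pd i μ₁ x - pd i μ₂ x := fun i x =>
    pd_sub (s₁.contDiff_mu.differentiable (by norm_num))
      (s₂.contDiff_mu.differentiable (by norm_num)) i x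
  set r₁ := reducedValue ν K ξ₀ γ μ₁ w₁ l₁
  set r₂ := reducedValue ν K ξ₀ γ μ₂ w₂ l₂
  -- the right-hand sides of the linearized equation for the difference `(u, v)`
  set F : Space d → ℝ := fun x => (γ - γc) * conv K u x -
    ∑ i, (1 / 2 * (pd i w₁ x + pd i w₂ x)) * pd i v x with hF_def
  set G : Space d → ℝ := fun x => ∑ i, pd i w₁ x * pd i u x + ∑ i, pd i μ₂ x * pd i v x +
    u x * lap w₁ x + μ₂ x * lap v x with hG_def
  have hF : ∀ x, -ν * lap v x - γc * conv K u x + (l₁ - l₂) - (r₁ - r₂) * cosMode ξ₀ x = F x := by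
    intro x
    have a₁ := s₁.complement_hjb x
    have a₂ := s₂.complement_hjb x
    rw [hjbOp_eq s₁.contDiff_w] at a₁
    rw [hjbOp_eq s₂.contDiff_w] at a₂
    have e : ∑ i, (1 / 2 * (pd i w₁ x + pd i w₂ x)) * pd i v x =
        1 / 2 * ∑ i, pd i w₁ x ^ 2 - 1 / 2 * ∑ i, pd i w₂ x ^ 2 := by
      rw [Finset.mul_sum, Finset.mul_sum, ← Finset.sum_sub_distrib]
      refine Finset.sum_congr rfl fun i _ => ?_
      rw [pdv]; ring
    simp only [hF_def]
    rw [e, hv_def, lap_sub s₁.contDiff_w s₂.contDiff_w, hu_def,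
      conv_sub hK.smooth.continuous cμ₁ cμ₂]
    linear_combination a₁ - a₂
  have hG : ∀ x, -ν * lap u x - lap v x + ν * (r₁ - r₂) * cosMode ξ₀ x = G x := by
    intro x
    have a₁ := s₁.complement_fp x
    have a₂ := s₂.complement_fp x
    rw [fpOp_eq s₁.contDiff_mu s₁.contDiff_w] at a₁
    rw [fpOp_eq s₂.contDiff_mu s₂.contDiff_w] at a₂
    have e : ∑ i, pd i w₁ x * pd i u x + ∑ i, pd i μ₂ x * pd i v x =
        ∑ i, pd i μ₁ x * pd i w₁ x - ∑ i, pd i μ₂ x * pd i w₂ x := by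
      rw [← Finset.sum_add_distrib, ← Finset.sum_sub_distrib]
      refine Finset.sum_congr rfl fun i _ => ?_
      rw [pdv, pdu]; ring
    simp only [hG_def]
    rw [e, hv_def, lap_sub s₁.contDiff_w s₂.contDiff_w, hu_def,
      lap_sub s₁.contDiff_mu s₂.contDiff_mu]
    linear_combination a₁ - a₂
  have cF : Continuous F := by fun_prop
  have cG : Continuous G := by fun_prop
  have pF : IsPeriodic F := fun n x => by
    simp only [hF_def, periodic_conv hK u n x, s₁.periodic_w.pd _ n x, s₂.periodic_w.pd _ n x,
      pv.pd _ n x]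
  have pG : IsPeriodic G := fun n x => by
    simp only [hG_def, s₁.periodic_w.pd _ n x, s₂.periodic_mu.pd _ n x, s₁.periodic_w.lap n x,
      pv.pd _ n x, pu.pd _ n x, pu n x, pv.lap n x, s₂.periodic_mu n x]
  have hS := hcoer u v F G (l₁ - l₂) (r₁ - r₂) cu cv pu pv mu0 mv0 hph ham cF cG pF pG hF hG
  set U0 := torusIntegral fun x => u x ^ 2
  set U2 := torusIntegral fun x => lap u x ^ 2
  set V0 := torusIntegral fun x => v x ^ 2
  set V2 := torusIntegral fun x => lap v x ^ 2
  have U0n : 0 ≤ U0 := integral_nonneg fun x => sq_nonneg _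
  have U2n : 0 ≤ U2 := integral_nonneg fun x => sq_nonneg _
  have V0n : 0 ≤ V0 := integral_nonneg fun x => sq_nonneg _
  have V2n : 0 ≤ V2 := integral_nonneg fun x => sq_nonneg _
  have gu := sum_torusIntegral_pd_sq_le cu pu
  have gv := sum_torusIntegral_pd_sq_le cv pv
  set U1 := torusIntegral fun x => ∑ i, pd i u x ^ 2
  set V1 := torusIntegral fun x => ∑ i, pd i v x ^ 2
  have gK := torusIntegral_conv_sq_le hK cuc pu hB
  have hFint : torusIntegral (fun x => F x ^ 2) ≤
      2 * ε ^ 2 * (B ^ 2 * U0) + 2 * d * ε ^ 2 * V1 := by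
    have h1 : torusIntegral (fun x => F x ^ 2) ≤ torusIntegral (fun x =>
        2 * ε ^ 2 * conv K u x ^ 2 + 2 * d * ε ^ 2 * ∑ i, pd i v x ^ 2) := by
      refine torusIntegral_mono (by fun_prop) (by fun_prop) fun x => ?_
      have b1 := sq_sum_mul_le (ε := ε) (a := fun i => 1 / 2 * (pd i w₁ x + pd i w₂ x))
        (b := fun i => pd i v x) fun i => by
          have c1 := abs_lt.1 (n1w.abs_pd_lt i x)
          have c2 := abs_lt.1 (n2w.abs_pd_lt i x)
          exact abs_le.2 ⟨by linarith, by linarith⟩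
      have b2 : (γ - γc) ^ 2 ≤ ε ^ 2 := sq_le_sq' (by linarith [(abs_lt.1 hγ).1]) (abs_lt.1 hγ).2.le
      have b3 : (γ - γc) ^ 2 * conv K u x ^ 2 ≤ ε ^ 2 * conv K u x ^ 2 := by gcongr
      simp only [hF_def]
      nlinarith [sq_nonneg ((γ - γc) * conv K u x +
        ∑ i, (1 / 2 * (pd i w₁ x + pd i w₂ x)) * pd i v x)]
    rw [torusIntegral_add (by fun_prop) (by fun_prop), torusIntegral_const_mul,
      torusIntegral_const_mul] at h1
    have : 2 * ε ^ 2 * torusIntegral (fun x => conv K u x ^ 2) ≤ 2 * ε ^ 2 * (B ^ 2 * U0) := by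
      gcongr
    linarith
  have hGint : torusIntegral (fun x => G x ^ 2) ≤
      4 * (d * ε ^ 2) * U1 + 4 * (d * ε ^ 2) * V1 + 4 * (d ^ 2 * ε ^ 2) * U0 + 4 * ε ^ 2 * V2 := by
    have h1 : torusIntegral (fun x => G x ^ 2) ≤ torusIntegral (fun x =>
        4 * (d * ε ^ 2) * ∑ i, pd i u x ^ 2 + 4 * (d * ε ^ 2) * ∑ i, pd i v x ^ 2 +
        4 * (d ^ 2 * ε ^ 2) * u x ^ 2 + 4 * ε ^ 2 * lap v x ^ 2) := by
      refine torusIntegral_mono (by fun_prop) (by fun_prop) fun x => ?_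
      have b1 := sq_sum_mul_le (ε := ε) (a := fun i => pd i w₁ x) (b := fun i => pd i u x)
        fun i => (n1w.abs_pd_lt i x).le
      have b2 := sq_sum_mul_le (ε := ε) (a := fun i => pd i μ₂ x) (b := fun i => pd i v x)
        fun i => (n2μ.abs_pd_lt i x).le
      have b3 : (u x * lap w₁ x) ^ 2 ≤ d ^ 2 * ε ^ 2 * u x ^ 2 := by
        rw [mul_comm]
        have := n1w.abs_lap_le s₁.contDiff_w x
        have : lap w₁ x ^ 2 ≤ (d * ε) ^ 2 := sq_le_sq.2 (this.trans (le_abs_self _))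
        rw [mul_pow, ← mul_pow (d : ℝ)]
        exact mul_le_mul_of_nonneg_right this (sq_nonneg _)
      have b4 : (μ₂ x * lap v x) ^ 2 ≤ ε ^ 2 * lap v x ^ 2 := by
        rw [mul_pow]
        have : μ₂ x ^ 2 ≤ ε ^ 2 := sq_le_sq.2 ((n2μ.abs_lt x).le.trans (le_abs_self _))
        exact mul_le_mul_of_nonneg_right this (sq_nonneg _)
      simp only [hG_def]
      refine (sq_add_four_le _ _ _ _).trans ?_
      linarith
    rwa [torusIntegral_add (by fun_prop) (by fun_prop), torusIntegral_add (by fun_prop)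
      (by fun_prop), torusIntegral_add (by fun_prop) (by fun_prop), torusIntegral_const_mul,
      torusIntegral_const_mul, torusIntegral_const_mul, torusIntegral_const_mul] at h1
  have hfin : U0 + U2 + V0 + V2 ≤ 1 / 2 * (U0 + U2 + V0 + V2) := by
    have hd : (0 : ℝ) ≤ d := Nat.cast_nonneg d
    have hε2 : ε ^ 2 ≤ ε := by nlinarith
    have e1 : torusIntegral (fun x => F x ^ 2) + torusIntegral (fun x => G x ^ 2) ≤
        M * ε ^ 2 * (U0 + U2 + V0 + V2) := by
      have x1 : 0 ≤ d * ε ^ 2 := by positivity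
      have y1 := mul_le_mul_of_nonneg_left gu x1
      have y2 := mul_le_mul_of_nonneg_left gv x1
      have z1 : 0 ≤ ε ^ 2 * B ^ 2 * (U2 + V0 + V2) := by positivity
      have z2 : 0 ≤ ε ^ 2 * d ^ 2 * (U2 + V0 + V2) := by positivity
      have z3 : 0 ≤ ε ^ 2 * (U0 + U2 + V0) := by positivity
      have z4 : 0 ≤ ε ^ 2 * d * (U0 + U2 + V0 + V2) := by positivity
      have hexp : M * ε ^ 2 * (U0 + U2 + V0 + V2) =
          2 * (ε ^ 2 * B ^ 2 * (U2 + V0 + V2)) + 2 * (ε ^ 2 * B ^ 2 * U0) +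
          10 * (ε ^ 2 * d * (U0 + U2 + V0 + V2)) +
          4 * (ε ^ 2 * d ^ 2 * (U2 + V0 + V2)) + 4 * (ε ^ 2 * d ^ 2 * U0) +
          4 * (ε ^ 2 * (U0 + U2 + V0)) + 4 * ε ^ 2 * V2 := by rw [hM]; ring
      have q1 : 0 ≤ d * ε ^ 2 * (V0 + V2) := by positivity
      have q2 : 0 ≤ d * ε ^ 2 * (U0 + U2) := by positivity
      rw [hexp]
      linarith
    have e2 := mul_le_mul_of_nonneg_left e1 hC.le
    have hSn : 0 ≤ U0 + U2 + V0 + V2 := by positivity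
    have e3 : C * (M * ε ^ 2 * (U0 + U2 + V0 + V2)) ≤ C * (M * ε * (U0 + U2 + V0 + V2)) := by
      gcongr
    have e4 : C * (M * ε * (U0 + U2 + V0 + V2)) ≤ 1 / 2 * (U0 + U2 + V0 + V2) := by
      rw [show C * (M * ε * (U0 + U2 + V0 + V2)) = C * M * ε * (U0 + U2 + V0 + V2) by ring]
      gcongr
    linarith
  have hu0 : u = 0 := eq_zero_of_torusIntegral_sq_le cuc pu (by linarith)
  have hv0 : v = 0 := eq_zero_of_torusIntegral_sq_le cv.continuous pv (by linarith)
  have eμ : μ₁ = μ₂ := by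
    ext x; have := congrFun hu0 x; simpa [hu_def, sub_eq_zero] using this
  have ew : w₁ = w₂ := by
    ext x; have := congrFun hv0 x; simpa [hv_def, sub_eq_zero] using this
  refine ⟨eμ, ew, ?_⟩
  -- the mean of the first equation determines the ergodic constant
  have hmean : ∀ x, (l₁ - l₂) = (r₁ - r₂) * cosMode ξ₀ x := by
    intro x
    have a₁ := s₁.complement_hjb x
    have a₂ := s₂.complement_hjb x
    rw [hjbOp_eq s₁.contDiff_w] at a₁
    rw [hjbOp_eq s₂.contDiff_w] at a₂
    have b₁ : lap w₂ x = lap w₁ x := by rw [ew]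
    have b₂ : ∑ i, pd i w₂ x ^ 2 = ∑ i, pd i w₁ x ^ 2 := by rw [ew]
    have b₃ : conv K μ₂ x = conv K μ₁ x := by rw [eμ]
    rw [b₁, b₂, b₃] at a₂
    linear_combination a₁ - a₂
  have h1 : torusIntegral (fun _ : Space d => l₁ - l₂) = 0 := by
    rw [funext hmean, torusIntegral_const_mul, torusIntegral_cosMode h.ne_zero, mul_zero]
  rw [torusIntegral_const] at h1
  linarith

/-! ### Operators on summable sequences -/

section Lift

variable {ι : Type*} {F : Type*} [NormedAddCommGroup F] [NormedSpace ℝ F]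

theorem summable_abs_seq (a : lp (fun _ : ι => ℝ) 1) : Summable fun i => |a i| := by
  simpa using a.2.summable

theorem norm_seq_eq (a : lp (fun _ : ι => ℝ) 1) : ‖a‖ = ∑' i, |a i| := by
  rw [lp.norm_eq_tsum_rpow (by norm_num)]
  simp

/-- A summable family of reals as an element of `ℓ¹`. -/
def mkSeq (P : ι → ℝ) (h : Summable fun i => |P i|) : lp (fun _ : ι => ℝ) 1 :=
  ⟨P, memℓp_gen (by simpa using h)⟩

@[simp]
theorem mkSeq_apply (P : ι → ℝ) (h : Summable fun i => |P i|) (i : ι) : mkSeq P h i = P i := rfl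

variable [CompleteSpace F]

theorem summable_smul_of_bounded (a : lp (fun _ : ι => ℝ) 1) {v : ι → F} {C : ℝ}
    (hv : ∀ i, ‖v i‖ ≤ C) : Summable fun i => a i • v i := by
  refine Summable.of_norm_bounded ((summable_abs_seq a).mul_right C) fun i => ?_
  rw [norm_smul, Real.norm_eq_abs]
  exact mul_le_mul_of_nonneg_left (hv i) (abs_nonneg _)

/-- The universal property of `ℓ¹`: a bounded family `v` of vectors extends to the operator
`a ↦ ∑ aᵢ vᵢ`. -/
def l1Lift (v : ι → F) (C : ℝ) (hv : ∀ i, ‖v i‖ ≤ C) : lp (fun _ : ι => ℝ) 1 →L[ℝ] F :=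
  LinearMap.mkContinuous
    { toFun := fun a => ∑' i, a i • v i
      map_add' := fun a b => by
        rw [← (summable_smul_of_bounded a hv).tsum_add (summable_smul_of_bounded b hv)]
        simp [add_smul]
      map_smul' := fun c a => by
        rw [← (summable_smul_of_bounded a hv).tsum_const_smul]
        simp [mul_smul] }
    C fun a => by
      rw [norm_seq_eq, ← tsum_mul_left]
      refine tsum_of_norm_bounded ((summable_abs_seq a).mul_left C).hasSum fun i => ?_
      rw [norm_smul, Real.norm_eq_abs, mul_comm]
      exact mul_le_mul_of_nonneg_right (hv i) (abs_nonneg _)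

theorem l1Lift_apply (v : ι → F) (C : ℝ) (hv : ∀ i, ‖v i‖ ≤ C) (a : lp (fun _ : ι => ℝ) 1) :
    l1Lift v C hv a = ∑' i, a i • v i := rfl

theorem norm_l1Lift_le (v : ι → F) (C : ℝ) (hv : ∀ i, ‖v i‖ ≤ C) (hC : 0 ≤ C) :
    ‖l1Lift v C hv‖ ≤ C := LinearMap.mkContinuous_norm_le _ hC _

theorem map_l1Lift {G : Type*} [NormedAddCommGroup G] [NormedSpace ℝ G] (L : F →L[ℝ] G)
    (v : ι → F) (C : ℝ) (hv : ∀ i, ‖v i‖ ≤ C) (a : lp (fun _ : ι => ℝ) 1) :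
    L (l1Lift v C hv a) = ∑' i, a i • L (v i) := by
  rw [l1Lift_apply, L.map_tsum (summable_smul_of_bounded a hv)]
  simp

end Lift

/-- Summable families indexed by the frequencies `ℤ^d`. -/
abbrev Seq (d : ℕ) : Type := lp (fun _ : Fin d → ℤ => ℝ) 1

/-- The coordinate functionals of `ℓ¹(ℤ^d)`. -/
def coord (ζ : Fin d → ℤ) : Seq d →L[ℝ] ℝ := lp.evalCLM ℝ (fun _ : Fin d → ℤ => ℝ) 1 ζ

@[simp]
theorem coord_apply (ζ : Fin d → ℤ) (a : Seq d) : coord ζ a = a ζ := rfl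

theorem norm_coord_le (ζ : Fin d → ℤ) : ‖coord ζ‖ ≤ 1 :=
  ContinuousLinearMap.opNorm_le_bound _ zero_le_one fun a => by
    rw [one_mul, coord_apply]
    exact lp.norm_apply_le_norm one_ne_zero a ζ

theorem norm_single_one (ζ : Fin d → ℤ) (c : ℝ) :
    ‖(lp.single 1 ζ c : Seq d)‖ = |c| := by
  rw [lp.norm_single (by norm_num)]; rfl

/-- Multiplication of a sequence by a bounded sequence. -/
def diagOp (m : (Fin d → ℤ) → ℝ) (C : ℝ) (hm : ∀ ξ, |m ξ| ≤ C) : Seq d →L[ℝ] Seq d :=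
  l1Lift (fun ξ => lp.single 1 ξ (m ξ)) C fun ξ => by rw [norm_single_one]; exact hm ξ

theorem diagOp_apply (m : (Fin d → ℤ) → ℝ) (C : ℝ) (hm : ∀ ξ, |m ξ| ≤ C) (a : Seq d)
    (ζ : Fin d → ℤ) : diagOp m C hm a ζ = m ζ * a ζ := by
  rw [← coord_apply, diagOp, map_l1Lift, tsum_eq_single ζ]
  · simp [mul_comm]
  · intro ξ hξ
    rw [coord_apply, lp.single_apply_ne _ _ _ hξ.symm, smul_zero]

/-- The bilinear operation `(P, Q) ↦ ∑ M(ξ,η) P(ξ) Q(η)` over the pairs with `τ(ξ,η) = ζ`. -/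
def pairSum (M : (Fin d → ℤ) → (Fin d → ℤ) → ℝ)
    (τ : (Fin d → ℤ) → (Fin d → ℤ) → (Fin d → ℤ)) (P Q : (Fin d → ℤ) → ℝ) (ζ : Fin d → ℤ) : ℝ :=
  ∑' ξ, P ξ * ∑' η, Q η * (if τ ξ η = ζ then M ξ η else 0)

/-- The operation `pairSum` with a bounded kernel, as a bounded bilinear operator on `ℓ¹(ℤ^d)`. -/
def pairOp (M : (Fin d → ℤ) → (Fin d → ℤ) → ℝ)
    (τ : (Fin d → ℤ) → (Fin d → ℤ) → (Fin d → ℤ)) (C : ℝ) (hM : ∀ ξ η, |M ξ η| ≤ C) :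
    Seq d →L[ℝ] Seq d →L[ℝ] Seq d :=
  l1Lift (fun ξ => l1Lift (fun η => (lp.single 1 (τ ξ η) (M ξ η) : Seq d)) C fun η => by
    rw [norm_single_one]; exact hM ξ η) C fun _ =>
      norm_l1Lift_le _ _ _ ((abs_nonneg _).trans (hM 0 0))

theorem map_pairOp {M : (Fin d → ℤ) → (Fin d → ℤ) → ℝ}
    {τ : (Fin d → ℤ) → (Fin d → ℤ) → (Fin d → ℤ)} {C : ℝ} (hM : ∀ ξ η, |M ξ η| ≤ C)
    (L : Seq d →L[ℝ] ℝ) (a b : Seq d) :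
    L (pairOp M τ C hM a b) =
      ∑' ξ, a ξ * ∑' η, b η * L (lp.single 1 (τ ξ η) (M ξ η)) := by
  have h := map_l1Lift (L.comp (ContinuousLinearMap.apply ℝ (Seq d) b))
    (fun ξ => l1Lift (fun η => (lp.single 1 (τ ξ η) (M ξ η) : Seq d)) C fun η => by
      rw [norm_single_one]; exact hM ξ η) C
    (fun _ => norm_l1Lift_le _ _ _ ((abs_nonneg _).trans (hM 0 0))) a
  refine Eq.trans h (tsum_congr fun ξ => ?_)
  rw [ContinuousLinearMap.comp_apply, ContinuousLinearMap.apply_apply, map_l1Lift]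
  simp only [smul_eq_mul]

theorem pairOp_apply {M : (Fin d → ℤ) → (Fin d → ℤ) → ℝ}
    {τ : (Fin d → ℤ) → (Fin d → ℤ) → (Fin d → ℤ)} {C : ℝ} (hM : ∀ ξ η, |M ξ η| ≤ C)
    (a b : Seq d) (ζ : Fin d → ℤ) : pairOp M τ C hM a b ζ = pairSum M τ a b ζ := by
  rw [← coord_apply, map_pairOp]
  refine tsum_congr fun ξ => ?_
  congr 1
  refine tsum_congr fun η => ?_
  congr 1
  by_cases h : τ ξ η = ζ
  · rw [if_pos h, h, coord_apply, lp.single_apply_self]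
  · rw [if_neg h, coord_apply, lp.single_apply_ne _ _ _ (Ne.symm h)]

/-! ### Weights and decay -/

/-- The weight `1 + |ξ|`. -/
def rho (ξ : Fin d → ℤ) : ℝ := 1 + ‖latt ξ‖

theorem one_le_rho (ξ : Fin d → ℤ) : 1 ≤ rho ξ := by
  unfold rho; linarith [norm_nonneg (latt ξ)]

theorem rho_pos (ξ : Fin d → ℤ) : 0 < rho ξ := by linarith [one_le_rho ξ]

theorem rho_add_le (ξ η : Fin d → ℤ) : rho (ξ + η) ≤ rho ξ * rho η := by
  unfold rho
  rw [latt_add]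
  nlinarith [norm_add_le (latt ξ) (latt η),
    mul_nonneg (norm_nonneg (latt ξ)) (norm_nonneg (latt η))]

theorem rho_sub_le (ξ η : Fin d → ℤ) : rho (ξ - η) ≤ rho ξ * rho η := by
  unfold rho
  rw [latt_sub]
  nlinarith [norm_sub_le (latt ξ) (latt η),
    mul_nonneg (norm_nonneg (latt ξ)) (norm_nonneg (latt η))]

theorem rho_neg (ξ : Fin d → ℤ) : rho (-ξ) = rho ξ := by simp [rho, latt_neg]

theorem abs_apply_le_norm_latt (ξ : Fin d → ℤ) (i : Fin d) : |(ξ i : ℝ)| ≤ ‖latt ξ‖ := by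
  have := PiLp.norm_apply_le (latt ξ) i
  simpa [latt] using this

theorem abs_apply_le_rho (ξ : Fin d → ℤ) (i : Fin d) : |(ξ i : ℝ)| ≤ rho ξ :=
  (abs_apply_le_norm_latt ξ i).trans (by unfold rho; linarith)

theorem freqSq_le_rho_sq (ξ : Fin d → ℤ) : freqSq ξ ≤ (2 * Real.pi) ^ 2 * rho ξ ^ 2 := by
  rw [freqSq, mul_pow]
  have : ‖latt ξ‖ ≤ rho ξ := by unfold rho; linarith
  gcongr

theorem rho_sq_le {ξ : Fin d → ℤ} (h : ξ ≠ 0) : rho ξ ^ 2 ≤ 4 * freqSq ξ := by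
  have h1 := one_le_norm_latt h
  have h2 : ‖latt ξ‖ ^ 2 ≤ freqSq ξ := by
    rw [freqSq, mul_pow]
    have : 1 ≤ (2 * Real.pi) ^ 2 := one_le_pow₀ (by linarith [Real.pi_gt_three])
    nlinarith [sq_nonneg ‖latt ξ‖]
  unfold rho
  nlinarith

/-- Summability of the sequence with the weight `(1 + |ξ|)^k`. -/
def Decay (k : ℕ) (P : (Fin d → ℤ) → ℝ) : Prop := Summable fun ξ => rho ξ ^ k * |P ξ|

theorem Decay.mono {k l : ℕ} (hkl : k ≤ l) {P : (Fin d → ℤ) → ℝ} (h : Decay l P) : Decay k P :=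
  Summable.of_nonneg_of_le (fun ξ => mul_nonneg (pow_nonneg (rho_pos ξ).le k) (abs_nonneg _))
    (fun ξ => mul_le_mul_of_nonneg_right (pow_le_pow_right₀ (one_le_rho ξ) hkl) (abs_nonneg _)) h

theorem Decay.summable_abs {k : ℕ} {P : (Fin d → ℤ) → ℝ} (h : Decay k P) :
    Summable fun ξ => |P ξ| := by simpa [Decay] using h.mono (Nat.zero_le k)

theorem Decay.of_le {k l : ℕ} {P Q : (Fin d → ℤ) → ℝ} {C : ℝ} (h : Decay (k + l) P)
    (hQ : ∀ ξ, |Q ξ| ≤ C * rho ξ ^ l * |P ξ|) : Decay k Q := by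
  refine Summable.of_nonneg_of_le
    (fun ξ => mul_nonneg (pow_nonneg (rho_pos ξ).le k) (abs_nonneg _)) (fun ξ => ?_)
    (Summable.mul_left C h)
  calc rho ξ ^ k * |Q ξ| ≤ rho ξ ^ k * (C * rho ξ ^ l * |P ξ|) :=
        mul_le_mul_of_nonneg_left (hQ ξ) (pow_nonneg (rho_pos ξ).le k)
    _ = C * (rho ξ ^ (k + l) * |P ξ|) := by rw [pow_add]; ring

theorem Decay.mul_freq {k : ℕ} {P : (Fin d → ℤ) → ℝ} (h : Decay (k + 1) P) (i : Fin d) :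
    Decay k fun ξ => 2 * Real.pi * ξ i * P ξ :=
  h.of_le (C := 2 * Real.pi) fun ξ => by
    rw [abs_mul, abs_mul, abs_of_pos Real.two_pi_pos, pow_one]
    have := abs_apply_le_rho ξ i
    have := Real.pi_pos
    gcongr

theorem Decay.neg {k : ℕ} {P : (Fin d → ℤ) → ℝ} (h : Decay k P) : Decay k fun ξ => -P ξ := by
  simpa [Decay] using h

theorem Decay.mul_bounded {k : ℕ} {P m : (Fin d → ℤ) → ℝ} (h : Decay k P) {C : ℝ}
    (hm : ∀ ξ, |m ξ| ≤ C) : Decay k fun ξ => m ξ * P ξ :=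
  Decay.of_le (k := k) (l := 0) (C := C) h fun ξ => by
    rw [abs_mul, pow_zero, mul_one]
    exact mul_le_mul_of_nonneg_right (hm ξ) (abs_nonneg _)

/-- The series `∑ (1 + |ξ|)^(-2d)` over `ℤ^d` converges. -/
theorem summable_rho_inv : Summable fun ξ : Fin d → ℤ => (rho ξ ^ (2 * d))⁻¹ := by
  set g : ℤ → ℝ := fun n => ((1 + |(n : ℝ)|) ^ 2)⁻¹ with hg
  have hgn : ∀ n, 0 ≤ g n := fun n => by positivity
  have hgs : Summable g := by
    have h1 : Summable fun n : ℕ => ((1 + (n : ℝ)) ^ 2)⁻¹ := by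
      have := (summable_nat_add_iff 1).2 (Real.summable_nat_pow_inv.2 (one_lt_two))
      simpa [add_comm] using this
    refine summable_int_iff_summable_nat_and_neg.2 ⟨?_, ?_⟩ <;> simpa [hg] using h1
  have hle : ∀ ξ : Fin d → ℤ, (rho ξ ^ (2 * d))⁻¹ ≤ ∏ i, g (ξ i) := by
    intro ξ
    have : ∏ i : Fin d, (1 + |(ξ i : ℝ)|) ^ 2 ≤ rho ξ ^ (2 * d) := by
      calc ∏ i : Fin d, (1 + |(ξ i : ℝ)|) ^ 2 ≤ ∏ i : Fin d, rho ξ ^ 2 := by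
            refine Finset.prod_le_prod (fun i _ => by positivity) fun i _ => ?_
            have := abs_apply_le_norm_latt ξ i
            unfold rho
            gcongr
        _ = rho ξ ^ (2 * d) := by simp [← pow_mul]
    simp only [hg, Finset.prod_inv_distrib]
    exact inv_anti₀ (Finset.prod_pos fun i _ => by positivity) this
  refine Summable.of_nonneg_of_le (fun ξ => inv_nonneg.2 (pow_nonneg (rho_pos ξ).le _)) hle ?_
  refine summable_of_sum_le (c := (∑' n, g n) ^ d) (fun ξ => Finset.prod_nonneg fun i _ => hgn _)
    fun s => ?_
  classical
  set t : Finset ℤ := s.biUnion fun ξ => Finset.univ.image ξ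
  have hst : s ⊆ Fintype.piFinset fun _ : Fin d => t := by
    intro ξ hξ
    rw [Fintype.mem_piFinset]
    intro i
    exact Finset.mem_biUnion.2 ⟨ξ, hξ, Finset.mem_image_of_mem _ (Finset.mem_univ i)⟩
  calc ∑ ξ ∈ s, ∏ i, g (ξ i) ≤ ∑ ξ ∈ Fintype.piFinset fun _ : Fin d => t, ∏ i, g (ξ i) :=
        Finset.sum_le_sum_of_subset_of_nonneg hst fun ξ _ _ => Finset.prod_nonneg fun i _ => hgn _
    _ = ∏ _i : Fin d, ∑ n ∈ t, g n := (Finset.prod_univ_sum (fun _ => t) fun _ n => g n).symm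
    _ = (∑ n ∈ t, g n) ^ d := by simp
    _ ≤ (∑' n, g n) ^ d := by
        have := hgs.sum_le_tsum t fun n _ => hgn n
        have : 0 ≤ ∑ n ∈ t, g n := Finset.sum_nonneg fun n _ => hgn n
        gcongr

/-! ### Trigonometric series -/

theorem norm_iteratedFDeriv_trigMode_le (b : Bool) (ξ : Fin d → ℤ) (k : ℕ) (x : Space d) :
    ‖iteratedFDeriv ℝ k (trigMode b ξ) x‖ ≤ (2 * Real.pi) ^ k * rho ξ ^ k := by
  have hp : phase ξ = phaseCLM ξ := funext fun x => (phaseCLM_apply ξ x).symm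
  have main : ∀ f : ℝ → ℝ, ContDiff ℝ ∞ f → (∀ t, |iteratedDeriv k f t| ≤ 1) →
      ‖iteratedFDeriv ℝ k (f ∘ phaseCLM ξ) x‖ ≤ (2 * Real.pi) ^ k * rho ξ ^ k := by
    intro f hf hb
    rw [(phaseCLM ξ).iteratedFDeriv_comp_right hf x (i := k) (by exact_mod_cast le_top)]
    refine (ContinuousMultilinearMap.norm_compContinuousLinearMap_le _ _).trans ?_
    rw [norm_iteratedFDeriv_eq_norm_iteratedDeriv, Finset.prod_const, Finset.card_univ,
      Fintype.card_fin, norm_phaseCLM, ← mul_pow]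
    have h1 := hb (phaseCLM ξ x)
    have h2 : ‖latt ξ‖ ≤ rho ξ := by unfold rho; linarith
    have h3 := Real.pi_pos
    calc ‖iteratedDeriv k f (phaseCLM ξ x)‖ * (2 * Real.pi * ‖latt ξ‖) ^ k
        ≤ 1 * (2 * Real.pi * rho ξ) ^ k := by gcongr; exact h1
      _ = _ := one_mul _
  cases b
  · change ‖iteratedFDeriv ℝ k (fun x => Real.sin (phase ξ x)) x‖ ≤ _
    rw [hp]
    exact main Real.sin Real.contDiff_sin fun t => Real.abs_iteratedDeriv_sin_le_one k t
  · change ‖iteratedFDeriv ℝ k (fun x => Real.cos (phase ξ x)) x‖ ≤ _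
    rw [hp]
    exact main Real.cos Real.contDiff_cos fun t => Real.abs_iteratedDeriv_cos_le_one k t

/-- The cosine series (for `true`) or sine series (for `false`) with coefficients `P`. -/
def trigSeries (b : Bool) (P : (Fin d → ℤ) → ℝ) (x : Space d) : ℝ := ∑' ξ, P ξ * trigMode b ξ x

theorem norm_iteratedFDeriv_const_mul_trigMode_le (b : Bool) (c : ℝ) (ξ : Fin d → ℤ) (k : ℕ)
    (x : Space d) : ‖iteratedFDeriv ℝ k (fun y => c * trigMode b ξ y) x‖ ≤
      (2 * Real.pi) ^ k * (rho ξ ^ k * |c|) := by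
  have h := iteratedFDeriv_const_smul_apply (𝕜 := ℝ) (i := k) (a := c) (x := x)
    (f := trigMode b ξ) (contDiff_trigMode b ξ).contDiffAt
  have e : (fun y => c * trigMode b ξ y) = c • trigMode b ξ := rfl
  rw [e, h, norm_smul, Real.norm_eq_abs]
  calc |c| * ‖iteratedFDeriv ℝ k (trigMode b ξ) x‖
      ≤ |c| * ((2 * Real.pi) ^ k * rho ξ ^ k) :=
        mul_le_mul_of_nonneg_left (norm_iteratedFDeriv_trigMode_le b ξ k x) (abs_nonneg _)
    _ = _ := by ring

theorem Decay.contDiff {N : ℕ} {P : (Fin d → ℤ) → ℝ} (h : Decay N P) (b : Bool) :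
    ContDiff ℝ N (trigSeries b P) := by
  refine contDiff_tsum (v := fun k ξ => (2 * Real.pi) ^ k * (rho ξ ^ k * |P ξ|))
    (fun ξ => contDiff_const.mul (contDiff_trigMode b ξ)) (fun k hk => ?_) fun k ξ x _ =>
      norm_iteratedFDeriv_const_mul_trigMode_le b (P ξ) ξ k x
  exact Summable.mul_left _ (h.mono (by exact_mod_cast hk))

theorem Decay.norm_iteratedFDeriv_le {N : ℕ} {P : (Fin d → ℤ) → ℝ} (h : Decay N P) (b : Bool)
    {k : ℕ} (hk : k ≤ N) (x : Space d) :
    ‖iteratedFDeriv ℝ k (trigSeries b P) x‖ ≤ (2 * Real.pi) ^ k * ∑' ξ, rho ξ ^ N * |P ξ| := by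
  have hs : ∀ j : ℕ, (j : ℕ∞) ≤ N →
      Summable fun ξ : Fin d → ℤ => (2 * Real.pi) ^ j * (rho ξ ^ j * |P ξ|) :=
    fun j hj => Summable.mul_left _ (h.mono (by exact_mod_cast hj))
  unfold trigSeries
  rw [iteratedFDeriv_tsum_apply (N := N)
    (v := fun k ξ => (2 * Real.pi) ^ k * (rho ξ ^ k * |P ξ|))
    (fun ξ => contDiff_const.mul (contDiff_trigMode b ξ)) hs (fun k ξ x _ =>
      norm_iteratedFDeriv_const_mul_trigMode_le b (P ξ) ξ k x) (by exact_mod_cast hk) x,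
    ← tsum_mul_left]
  refine tsum_of_norm_bounded (Summable.mul_left _ h).hasSum fun ξ => ?_
  refine (norm_iteratedFDeriv_const_mul_trigMode_le b (P ξ) ξ k x).trans ?_
  have := Real.pi_pos
  have := one_le_rho ξ
  gcongr

theorem periodic_trigSeries (b : Bool) (P : (Fin d → ℤ) → ℝ) : IsPeriodic (trigSeries b P) :=
  fun n x => by simp only [trigSeries, periodic_trigMode b _ n x]

theorem cosSeries_neg (P : (Fin d → ℤ) → ℝ) (x : Space d) :
    trigSeries true P (-x) = trigSeries true P x := by
  simp only [trigSeries, trigMode, cosMode_neg]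

theorem summable_mul_trigMode {P : (Fin d → ℤ) → ℝ} (h : Summable fun ξ => |P ξ|) (b : Bool)
    (x : Space d) : Summable fun ξ => P ξ * trigMode b ξ x :=
  Summable.of_norm_bounded h fun ξ => by
    rw [norm_mul]
    exact mul_le_of_le_one_right (abs_nonneg _) (abs_trigMode_le b ξ x)

theorem pd_trigSeries_aux {P : (Fin d → ℤ) → ℝ} (h : Decay 1 P) (b : Bool) (i : Fin d)
    (x : Space d) : pd i (trigSeries b P) x = ∑' ξ, P ξ * pd i (trigMode b ξ) x := by
  have hd : ∀ ξ, Differentiable ℝ fun y => P ξ * trigMode b ξ y := fun ξ =>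
    ((contDiff_trigMode (n := 1) b ξ).differentiable (by norm_num)).const_mul _
  have hb : ∀ ξ y, ‖fderiv ℝ (fun y => P ξ * trigMode b ξ y) y‖ ≤
      (2 * Real.pi) ^ 1 * (rho ξ ^ 1 * |P ξ|) := fun ξ y => by
    rw [← norm_iteratedFDeriv_one]
    exact norm_iteratedFDeriv_const_mul_trigMode_le b (P ξ) ξ 1 y
  have hs : Summable fun ξ => (2 * Real.pi) ^ 1 * (rho ξ ^ 1 * |P ξ|) := Summable.mul_left _ h
  have h1 := fderiv_tsum_apply hs hd hb (x₀ := x) (summable_mul_trigMode h.summable_abs b x) x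
  have h2 : Summable fun ξ => fderiv ℝ (fun y => P ξ * trigMode b ξ y) x :=
    Summable.of_norm_bounded hs fun ξ => hb ξ x
  change fderiv ℝ (fun y => ∑' ξ, P ξ * trigMode b ξ y) x (EuclideanSpace.single i 1) = _
  rw [h1]
  have h3 := (ContinuousLinearMap.apply ℝ ℝ (EuclideanSpace.single i (1 : ℝ))).map_tsum h2
  refine Eq.trans h3 (tsum_congr fun ξ => ?_)
  exact pd_const_mul ((contDiff_trigMode (n := 1) b ξ).differentiable (by norm_num)) (P ξ) i x

theorem pd_cosSeries {P : (Fin d → ℤ) → ℝ} (h : Decay 1 P) (i : Fin d) :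
    pd i (trigSeries true P) = trigSeries false fun ξ => -(2 * Real.pi * ξ i * P ξ) := by
  ext x
  rw [pd_trigSeries_aux h]
  refine tsum_congr fun ξ => ?_
  simp only [trigMode, pd_cosMode]; ring

theorem pd_sinSeries {P : (Fin d → ℤ) → ℝ} (h : Decay 1 P) (i : Fin d) :
    pd i (trigSeries false P) = trigSeries true fun ξ => 2 * Real.pi * ξ i * P ξ := by
  ext x
  rw [pd_trigSeries_aux h]
  refine tsum_congr fun ξ => ?_
  simp only [trigMode, pd_sinMode]; ring

theorem lap_cosSeries {P : (Fin d → ℤ) → ℝ} (h : Decay 2 P) (x : Space d) :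
    lap (trigSeries true P) x = trigSeries true (fun ξ => -freqSq ξ * P ξ) x := by
  have h1 : ∀ i, Decay 1 fun ξ => -(2 * Real.pi * ξ i * P ξ) := fun i => (h.mul_freq i).neg
  unfold lap
  simp only [pd_cosSeries (h.mono one_le_two), pd_sinSeries (h1 _)]
  unfold trigSeries
  rw [← Summable.tsum_finsetSum fun i _ => summable_mul_trigMode
    (Decay.mul_freq (k := 0) (h1 i) i).summable_abs true x]
  refine tsum_congr fun ξ => ?_
  rw [← Finset.sum_mul]
  simp only [freqSq_eq_sum, ← Finset.sum_neg_distrib, Finset.sum_mul]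
  exact Finset.sum_congr rfl fun i _ => by ring

theorem torusIntegral_trigSeries_mul {P : (Fin d → ℤ) → ℝ} (h : Summable fun ξ => |P ξ|)
    (b : Bool) {g : Space d → ℝ} (hg : Continuous g) :
    torusIntegral (fun x => trigSeries b P x * g x) =
      ∑' ξ, P ξ * torusIntegral (fun x => trigMode b ξ x * g x) := by
  have hc : ∀ ξ, Continuous fun x => trigMode b ξ x * g x := fun ξ =>
    (continuous_trigMode b ξ).mul hg
  have hi : ∀ ξ, Integrable (fun x => P ξ * (trigMode b ξ x * g x)) (volume.restrict (cell d)) :=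
    fun ξ => integrableOn_cell (continuous_const.mul (hc ξ))
  have hs : Summable fun ξ => ∫ x in cell d, ‖P ξ * (trigMode b ξ x * g x)‖ := by
    refine Summable.of_nonneg_of_le (fun ξ => integral_nonneg fun x => norm_nonneg _) (fun ξ => ?_)
      (h.mul_right (∫ x in cell d, |g x|))
    rw [← integral_const_mul]
    refine integral_mono (integrableOn_cell (continuous_const.mul (hc ξ)).norm)
      (integrableOn_cell (continuous_const.mul hg.abs)) fun x => ?_
    change ‖P ξ * (trigMode b ξ x * g x)‖ ≤ |P ξ| * |g x|
    rw [norm_mul, norm_mul]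
    exact mul_le_mul_of_nonneg_left (mul_le_of_le_one_left (abs_nonneg _)
      (abs_trigMode_le b ξ x)) (abs_nonneg _)
  have h1 := integral_tsum_of_summable_integral_norm hi hs
  calc torusIntegral (fun x => trigSeries b P x * g x)
      = ∫ x in cell d, ∑' ξ, P ξ * (trigMode b ξ x * g x) := by
        refine integral_congr_ae (Eventually.of_forall fun x => ?_)
        simp only [trigSeries, ← tsum_mul_right, mul_assoc]
    _ = ∑' ξ, P ξ * torusIntegral (fun x => trigMode b ξ x * g x) := by
        rw [← h1]
        exact tsum_congr fun ξ => integral_const_mul _ _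

theorem trigCoef_cosSeries {P : (Fin d → ℤ) → ℝ} (h : Summable fun ξ => |P ξ|)
    (η : Fin d → ℤ) : trigCoef true (trigSeries true P) η = (P η + P (-η)) / 2 := by
  classical
  rw [trigCoef, torusIntegral_trigSeries_mul h true (continuous_trigMode true η)]
  have h1 : ∀ ξ, P ξ * torusIntegral (fun x => trigMode true ξ x * trigMode true η x) =
      (if ξ = η then P η / 2 else 0) + (if ξ = -η then P (-η) / 2 else 0) := by
    intro ξ
    change P ξ * trigCoef true (cosMode ξ) η = _
    rw [trigCoef_true_cosMode]
    split_ifs with a b b <;> simp_all <;> ring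
  rw [tsum_congr h1, Summable.tsum_add, tsum_ite_eq, tsum_ite_eq]
  · ring
  · exact (hasSum_ite_eq η (P η / 2)).summable
  · exact (hasSum_ite_eq (-η) (P (-η) / 2)).summable

theorem torusIntegral_cosSeries {P : (Fin d → ℤ) → ℝ} (h : Summable fun ξ => |P ξ|) :
    torusIntegral (trigSeries true P) = P 0 := by
  have h1 := trigCoef_cosSeries h 0
  have h2 : trigMode true (0 : Fin d → ℤ) = fun _ => (1 : ℝ) := by
    ext x; simp [trigMode, cosMode, phase_zero]
  simp only [trigCoef, h2, mul_one, neg_zero, add_self_div_two] at h1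
  exact h1

theorem conv_cosSeries {K : Space d → ℝ} (hK : IsKernel K) {P : (Fin d → ℤ) → ℝ}
    (h : Summable fun ξ => |P ξ|) (x : Space d) :
    conv K (trigSeries true P) x = trigSeries true (fun ξ => kernelCoef K ξ * P ξ) x := by
  have hc := hK.smooth.continuous
  have h1 := torusIntegral_trigSeries_mul h true (g := fun y => K (x - y)) (by fun_prop)
  have e : (fun y => trigSeries true P y * K (x - y)) = fun y => K (x - y) * trigSeries true P y :=
    funext fun y => mul_comm _ _
  rw [e] at h1
  refine Eq.trans h1 (tsum_congr fun ξ => ?_)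
  have h2 := conv_trigMode hK true ξ x
  rw [conv] at h2
  simp only [mul_comm (trigMode true ξ _) (K _), h2]
  ring

theorem trigSeries_const_mul (b : Bool) (c : ℝ) (P : (Fin d → ℤ) → ℝ) (x : Space d) :
    trigSeries b (fun ξ => c * P ξ) x = c * trigSeries b P x := by
  simp only [trigSeries, mul_assoc, tsum_mul_left]

theorem trigSeries_add (b : Bool) {P Q : (Fin d → ℤ) → ℝ} (hP : Summable fun ξ => |P ξ|)
    (hQ : Summable fun ξ => |Q ξ|) (x : Space d) :
    trigSeries b (fun ξ => P ξ + Q ξ) x = trigSeries b P x + trigSeries b Q x := by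
  simp only [trigSeries, add_mul]
  exact (summable_mul_trigMode hP b x).tsum_add (summable_mul_trigMode hQ b x)

/-- Evaluation of cosine series at `x`, as a functional on `ℓ¹(ℤ^d)`. -/
def cosEval (x : Space d) : Seq d →L[ℝ] ℝ :=
  l1Lift (fun ξ => cosMode ξ x) 1 fun ξ => abs_trigMode_le true ξ x

theorem cosEval_apply (x : Space d) (a : Seq d) : cosEval x a = trigSeries true a x := rfl

theorem cosEval_single (x : Space d) (ζ : Fin d → ℤ) (c : ℝ) :
    cosEval x (lp.single 1 ζ c) = c * cosMode ζ x := by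
  rw [cosEval_apply, trigSeries, tsum_eq_single ζ]
  · rw [lp.single_apply_self]; rfl
  · intro ξ hξ
    rw [lp.single_apply_ne _ _ _ hξ, zero_mul]

/-! ### The blown-up complement equation on sequences -/

/-- The Euclidean inner product of two frequencies. -/
def dot (ξ η : Fin d → ℤ) : ℝ := inner ℝ (latt ξ) (latt η)

/-- The cosine coefficients of `½ ∇w·∇v` for cosine series `w`, `v` with coefficients `W`, `V`. -/
def quadGrad (W V : (Fin d → ℤ) → ℝ) (ζ : Fin d → ℤ) : ℝ :=
  pairSum (fun ξ η => Real.pi ^ 2 * dot ξ η) (fun ξ η => ξ - η) W V ζ -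
    pairSum (fun ξ η => Real.pi ^ 2 * dot ξ η) (fun ξ η => ξ + η) W V ζ

/-- The cosine coefficients of `div (μ ∇w)` for cosine series `μ`, `w` with coefficients
`P`, `W`. -/
def quadDiv (P W : (Fin d → ℤ) → ℝ) (ζ : Fin d → ℤ) : ℝ :=
  pairSum (fun ξ η => 2 * Real.pi ^ 2 * dot (ξ - η) η) (fun ξ η => ξ - η) P W ζ -
    pairSum (fun ξ η => 2 * Real.pi ^ 2 * dot (ξ + η) η) (fun ξ η => ξ + η) P W ζ

/-- Division of a sequence by the `k`-th power of the weight. -/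
def wt (k : ℕ) (a : (Fin d → ℤ) → ℝ) (ξ : Fin d → ℤ) : ℝ := (rho ξ ^ k)⁻¹ * a ξ

theorem abs_dot_le (ξ η : Fin d → ℤ) : |dot ξ η| ≤ rho ξ * rho η := by
  refine (abs_real_inner_le_norm _ _).trans ?_
  unfold rho
  nlinarith [norm_nonneg (latt ξ), norm_nonneg (latt η)]

/-- A bilinear operation with unbounded kernel, conjugated with weights which balance the kernel, is
bounded on `ℓ¹(ℤ^d)`. -/
theorem exists_weighted_pairOp (M : (Fin d → ℤ) → (Fin d → ℤ) → ℝ)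
    (τ : (Fin d → ℤ) → (Fin d → ℤ) → (Fin d → ℤ)) (w : (Fin d → ℤ) → ℝ) (p q : ℕ) (C : ℝ)
    (h : ∀ ξ η, |w (τ ξ η) * M ξ η| ≤ C * (rho ξ ^ p * rho η ^ q)) :
    ∃ B : Seq d →L[ℝ] Seq d →L[ℝ] Seq d, ∀ a b ζ,
      B a b ζ = w ζ * pairSum M τ (wt p a) (wt q b) ζ := by
  have hpos : ∀ ξ η : Fin d → ℤ, 0 < rho ξ ^ p * rho η ^ q := fun ξ η =>
    mul_pos (pow_pos (rho_pos ξ) p) (pow_pos (rho_pos η) q)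
  have hM : ∀ ξ η, |w (τ ξ η) * M ξ η / (rho ξ ^ p * rho η ^ q)| ≤ C := fun ξ η => by
    rw [abs_div, abs_of_pos (hpos ξ η), div_le_iff₀ (hpos ξ η)]
    exact h ξ η
  refine ⟨pairOp _ τ C hM, fun a b ζ => ?_⟩
  rw [pairOp_apply, pairSum, pairSum, ← tsum_mul_left]
  refine tsum_congr fun ξ => ?_
  rw [mul_left_comm, ← tsum_mul_left, ← tsum_mul_left, ← tsum_mul_left]
  refine tsum_congr fun η => ?_
  simp only [wt]
  have h1 := (pow_pos (rho_pos ξ) p).ne'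
  have h2 := (pow_pos (rho_pos η) q).ne'
  split_ifs with hτ
  · rw [hτ]; field_simp
  · ring

/-- The quadratic term `½|∇w|²`, followed by a Fourier multiplier of order `n` in weighted
spaces. -/
theorem exists_gradOp (n : ℕ) {w : (Fin d → ℤ) → ℝ} {C : ℝ} (hw : ∀ ζ, |w ζ| ≤ C * rho ζ ^ n) :
    ∃ B : Seq d →L[ℝ] Seq d →L[ℝ] Seq d, ∀ a b ζ,
      B a b ζ = w ζ * quadGrad (wt (n + 1) a) (wt (n + 1) b) ζ := by
  have hC : 0 ≤ C := by
    by_contra hneg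
    have h1 := hw 0
    have h2 : 0 < rho (0 : Fin d → ℤ) ^ n := pow_pos (rho_pos _) n
    nlinarith [abs_nonneg (w 0)]
  have key : ∀ τ : (Fin d → ℤ) → (Fin d → ℤ) → (Fin d → ℤ), (∀ ξ η, rho (τ ξ η) ≤ rho ξ * rho η) →
      ∀ ξ η, |w (τ ξ η) * (Real.pi ^ 2 * dot ξ η)| ≤
        (C * Real.pi ^ 2) * (rho ξ ^ (n + 1) * rho η ^ (n + 1)) := by
    intro τ hτ ξ η
    have h1 := hw (τ ξ η)
    have h2 : rho (τ ξ η) ^ n ≤ (rho ξ * rho η) ^ n :=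
      pow_le_pow_left₀ (rho_pos _).le (hτ ξ η) n
    have h3 := abs_dot_le ξ η
    have h4 := (rho_pos ξ).le
    have h5 := (rho_pos η).le
    rw [abs_mul, abs_mul, abs_of_pos (by positivity : 0 < Real.pi ^ 2)]
    calc |w (τ ξ η)| * (Real.pi ^ 2 * |dot ξ η|)
        ≤ (C * (rho ξ * rho η) ^ n) * (Real.pi ^ 2 * (rho ξ * rho η)) := by
          gcongr
          exact h1.trans (mul_le_mul_of_nonneg_left h2 hC)
      _ = _ := by ring
  obtain ⟨B₁, h₁⟩ := exists_weighted_pairOp (fun ξ η => Real.pi ^ 2 * dot ξ η) (fun ξ η => ξ - η)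
    w (n + 1) (n + 1) _ (key _ rho_sub_le)
  obtain ⟨B₂, h₂⟩ := exists_weighted_pairOp (fun ξ η => Real.pi ^ 2 * dot ξ η) (fun ξ η => ξ + η)
    w (n + 1) (n + 1) _ (key _ rho_add_le)
  refine ⟨B₁ - B₂, fun a b ζ => ?_⟩
  have : (B₁ - B₂) a b ζ = B₁ a b ζ - B₂ a b ζ := rfl
  rw [this, h₁, h₂, quadGrad, mul_sub]

/-- The quadratic term `div (μ ∇w)`, followed by a Fourier multiplier of order `n - 1` in weighted
spaces. -/
theorem exists_divOp (n : ℕ) {w : (Fin d → ℤ) → ℝ} {C : ℝ}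
    (hw : ∀ ζ, |w ζ| * rho ζ ≤ C * rho ζ ^ n) :
    ∃ B : Seq d →L[ℝ] Seq d →L[ℝ] Seq d, ∀ a b ζ,
      B a b ζ = w ζ * quadDiv (wt n a) (wt (n + 1) b) ζ := by
  have hC : 0 ≤ C := by
    by_contra hneg
    have h1 := hw 0
    have h2 : 0 < rho (0 : Fin d → ℤ) ^ n := pow_pos (rho_pos _) n
    have h3 : 0 ≤ |w 0| * rho (0 : Fin d → ℤ) := mul_nonneg (abs_nonneg _) (rho_pos _).le
    nlinarith
  have key : ∀ τ : (Fin d → ℤ) → (Fin d → ℤ) → (Fin d → ℤ), (∀ ξ η, rho (τ ξ η) ≤ rho ξ * rho η) →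
      ∀ ξ η, |w (τ ξ η) * (2 * Real.pi ^ 2 * dot (τ ξ η) η)| ≤
        (C * (2 * Real.pi ^ 2)) * (rho ξ ^ n * rho η ^ (n + 1)) := by
    intro τ hτ ξ η
    have h1 := hw (τ ξ η)
    have h2 : rho (τ ξ η) ^ n ≤ (rho ξ * rho η) ^ n :=
      pow_le_pow_left₀ (rho_pos _).le (hτ ξ η) n
    have h3 := abs_dot_le (τ ξ η) η
    have h4 := (rho_pos ξ).le
    have h5 := (rho_pos η).le
    rw [abs_mul, abs_mul, abs_of_pos (by positivity : 0 < 2 * Real.pi ^ 2)]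
    calc |w (τ ξ η)| * (2 * Real.pi ^ 2 * |dot (τ ξ η) η|)
        ≤ |w (τ ξ η)| * (2 * Real.pi ^ 2 * (rho (τ ξ η) * rho η)) := by gcongr
      _ = (|w (τ ξ η)| * rho (τ ξ η)) * (2 * Real.pi ^ 2 * rho η) := by ring
      _ ≤ (C * (rho ξ * rho η) ^ n) * (2 * Real.pi ^ 2 * rho η) :=
          mul_le_mul_of_nonneg_right (h1.trans (mul_le_mul_of_nonneg_left h2 hC)) (by positivity)
      _ = _ := by ring
  obtain ⟨B₁, h₁⟩ := exists_weighted_pairOp (fun ξ η => 2 * Real.pi ^ 2 * dot (ξ - η) η)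
    (fun ξ η => ξ - η) w n (n + 1) _ (key _ rho_sub_le)
  obtain ⟨B₂, h₂⟩ := exists_weighted_pairOp (fun ξ η => 2 * Real.pi ^ 2 * dot (ξ + η) η)
    (fun ξ η => ξ + η) w n (n + 1) _ (key _ rho_add_le)
  refine ⟨B₁ - B₂, fun a b ζ => ?_⟩
  have : (B₁ - B₂) a b ζ = B₁ a b ζ - B₂ a b ζ := rfl
  rw [this, h₁, h₂, quadDiv, mul_sub]

/-- The entries of a family of `2 × 2` matrices indexed by the frequencies. -/
structure SymbolMatrix (d : ℕ) where
  /-- First row, first column. -/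
  e11 : (Fin d → ℤ) → ℝ
  /-- First row, second column. -/
  e12 : (Fin d → ℤ) → ℝ
  /-- Second row, first column. -/
  e21 : (Fin d → ℤ) → ℝ
  /-- Second row, second column. -/
  e22 : (Fin d → ℤ) → ℝ

open Classical in
/-- The inverse of the symbol of the linearized operator at the critical coupling. At the critical
modes it is the inverse of the rank-one symbol `k (ν,1)⊗(ν,1)` on its range, extended by zero on the
cokernel; at the zero mode it vanishes. -/
def invSymbol (ν : ℝ) (K : Space d → ℝ) (γc : ℝ) (ξ₀ : Fin d → ℤ) : SymbolMatrix d where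
  e11 ζ := if ζ = 0 then 0 else if ζ = ξ₀ ∨ ζ = -ξ₀ then ν ^ 2 / (freqSq ζ * (1 + ν ^ 2) ^ 2)
    else -1 / symbolDet ν K γc ζ
  e12 ζ := if ζ = 0 then 0 else if ζ = ξ₀ ∨ ζ = -ξ₀ then ν / (freqSq ζ * (1 + ν ^ 2) ^ 2)
    else ν / symbolDet ν K γc ζ
  e21 ζ := if ζ = 0 then 0 else if ζ = ξ₀ ∨ ζ = -ξ₀ then ν / (freqSq ζ * (1 + ν ^ 2) ^ 2)
    else ν / symbolDet ν K γc ζ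
  e22 ζ := if ζ = 0 then 0 else if ζ = ξ₀ ∨ ζ = -ξ₀ then 1 / (freqSq ζ * (1 + ν ^ 2) ^ 2)
    else γc * kernelCoef K ζ / (freqSq ζ * symbolDet ν K γc ζ)

/-- The inverse symbol gains two derivatives, and three in its last entry. -/
theorem SimpleCriticalPair.exists_invSymbol_bound {ν : ℝ} (hν : 0 < ν) {K : Space d → ℝ}
    (hK : IsKernel K) {γc : ℝ} {ξ₀ : Fin d → ℤ} (h : SimpleCriticalPair ν K γc ξ₀) :
    ∃ C ≥ 0, ∀ ζ, |(invSymbol ν K γc ξ₀).e11 ζ| * rho ζ ^ 2 ≤ C ∧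
      |(invSymbol ν K γc ξ₀).e12 ζ| * rho ζ ^ 2 ≤ C ∧
      |(invSymbol ν K γc ξ₀).e21 ζ| * rho ζ ^ 2 ≤ C ∧
      |(invSymbol ν K γc ξ₀).e22 ζ| * rho ζ ^ 3 ≤ C := by
  obtain ⟨c, hc, hD⟩ := h.exists_le_symbolDet hν hK
  obtain ⟨B, hB0, hB⟩ := exists_abs_kernelCoef_le hK
  have hγ := h.nonneg
  refine ⟨4 * ν ^ 2 + 4 * ν + 4 * rho ξ₀ + 4 / c + 4 * ν / c + 16 * (γc * B) / c, by
    have := rho_pos ξ₀; positivity, fun ζ => ?_⟩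
  have hρ0 := rho_pos ξ₀
  have t1 : 0 ≤ 4 * ν ^ 2 := by positivity
  have t2 : 0 ≤ 4 * ν := by positivity
  have t3 : 0 ≤ 4 * rho ξ₀ := by positivity
  have t4 : 0 ≤ 4 / c := by positivity
  have t5 : 0 ≤ 4 * ν / c := by positivity
  have t6 : 0 ≤ 16 * (γc * B) / c := by positivity
  by_cases h0 : ζ = 0
  · simp only [invSymbol, h0, if_true, abs_zero, zero_mul]
    refine ⟨?_, ?_, ?_, ?_⟩ <;> linarith
  have hk := one_le_freqSq h0
  have hk0 : 0 < freqSq ζ := by linarith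
  have hr := rho_sq_le h0
  have hρ := rho_pos ζ
  have hρ1 := one_le_rho ζ
  by_cases h1 : ζ = ξ₀ ∨ ζ = -ξ₀
  · have hq : ∀ x, 0 ≤ x → |x / (freqSq ζ * (1 + ν ^ 2) ^ 2)| * rho ζ ^ 2 ≤ 4 * x := by
      intro x hx
      have hν1 : 1 ≤ (1 + ν ^ 2) ^ 2 := one_le_pow₀ (by nlinarith)
      rw [abs_of_nonneg (by positivity), div_mul_eq_mul_div, div_le_iff₀ (by positivity)]
      calc x * rho ζ ^ 2 ≤ x * (4 * freqSq ζ * 1) := by rw [mul_one]; gcongr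
        _ ≤ x * (4 * freqSq ζ * (1 + ν ^ 2) ^ 2) := by gcongr
        _ = _ := by ring
    have hρeq : rho ζ = rho ξ₀ := by rcases h1 with rfl | rfl <;> simp [rho_neg]
    simp only [invSymbol, if_neg h0, if_pos h1]
    refine ⟨?_, ?_, ?_, ?_⟩
    · linarith [hq (ν ^ 2) (by positivity)]
    · linarith [hq ν hν.le]
    · linarith [hq ν hν.le]
    · have := mul_le_mul_of_nonneg_right (hq 1 zero_le_one) hρ.le
      rw [mul_assoc, ← pow_succ, hρeq] at this
      rw [hρeq]
      linarith
  · have h1' := not_or.1 h1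
    have hd := hD ζ h0 h1'.1 h1'.2
    have hd0 : 0 < symbolDet ν K γc ζ := lt_of_lt_of_le (mul_pos hc hk0) hd
    have hq : ∀ x, 0 ≤ x → x / symbolDet ν K γc ζ * rho ζ ^ 2 ≤ 4 * x / c := by
      intro x hx
      rw [div_mul_eq_mul_div, div_le_div_iff₀ hd0 hc]
      calc x * rho ζ ^ 2 * c ≤ x * (4 * freqSq ζ) * c := by gcongr
        _ = 4 * x * (c * freqSq ζ) := by ring
        _ ≤ 4 * x * symbolDet ν K γc ζ := by gcongr
    have a1 : |-1 / symbolDet ν K γc ζ| = 1 / symbolDet ν K γc ζ := by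
      rw [abs_div, abs_neg, abs_one, abs_of_pos hd0]
    have a2 : |ν / symbolDet ν K γc ζ| = ν / symbolDet ν K γc ζ := abs_of_pos (by positivity)
    simp only [invSymbol, if_neg h0, if_neg h1, a1, a2]
    refine ⟨?_, ?_, ?_, ?_⟩
    · have := hq 1 zero_le_one
      rw [mul_one] at this
      linarith
    · linarith [hq ν hν.le]
    · linarith [hq ν hν.le]
    · have a3 : |γc * kernelCoef K ζ / (freqSq ζ * symbolDet ν K γc ζ)| ≤
          γc * B / (freqSq ζ * symbolDet ν K γc ζ) := by
        rw [abs_div, abs_mul, abs_of_nonneg hγ, abs_of_pos (mul_pos hk0 hd0)]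
        have := hB ζ
        gcongr
      have a4 := hq (γc * B) (by positivity)
      have a5 : rho ζ ^ 3 ≤ rho ζ ^ 4 := pow_le_pow_right₀ hρ1 (by norm_num)
      calc _ ≤ γc * B / (freqSq ζ * symbolDet ν K γc ζ) * rho ζ ^ 4 := by gcongr
        _ = (γc * B / symbolDet ν K γc ζ * rho ζ ^ 2) * (rho ζ ^ 2 / freqSq ζ) := by
            field_simp
        _ ≤ (4 * (γc * B) / c) * 4 := by
            have : rho ζ ^ 2 / freqSq ζ ≤ 4 := by rw [div_le_iff₀ hk0]; exact hr
            gcongr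
        _ ≤ _ := by
            have : 4 * (γc * B) / c * 4 = 16 * (γc * B) / c := by ring
            linarith

open Classical in
/-- The coefficients of `cos (2π ξ₀·x)` as a cosine series over `ℤ^d`. -/
def critSeq (ξ₀ : Fin d → ℤ) (ζ : Fin d → ℤ) : ℝ := if ζ = ξ₀ ∨ ζ = -ξ₀ then 1 / 2 else 0

/-- First component of the fixed-point map: after the substitution `(μ, w) = A (P, W)`,
`γ = γc + t`, the complement equation reads `(P, W) = (profileP, profileW)`. -/
def profileP (ν : ℝ) (K : Space d → ℝ) (γc : ℝ) (ξ₀ : Fin d → ℤ) (p : ℝ × ℝ)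
    (P W : (Fin d → ℤ) → ℝ) (ζ : Fin d → ℤ) : ℝ :=
  critSeq ξ₀ ζ + (invSymbol ν K γc ξ₀).e11 ζ * (p.2 * kernelCoef K ζ * P ζ - p.1 * quadGrad W W ζ) +
    (invSymbol ν K γc ξ₀).e12 ζ * (p.1 * quadDiv P W ζ)

/-- Second component of the fixed-point map. -/
def profileW (ν : ℝ) (K : Space d → ℝ) (γc : ℝ) (ξ₀ : Fin d → ℤ) (p : ℝ × ℝ)
    (P W : (Fin d → ℤ) → ℝ) (ζ : Fin d → ℤ) : ℝ :=
  -ν * critSeq ξ₀ ζ +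
    (invSymbol ν K γc ξ₀).e21 ζ * (p.2 * kernelCoef K ζ * P ζ - p.1 * quadGrad W W ζ) +
    (invSymbol ν K γc ξ₀).e22 ζ * (p.1 * quadDiv P W ζ)

theorem summable_critSeq (ξ₀ : Fin d → ℤ) (m : (Fin d → ℤ) → ℝ) :
    Summable fun ζ => |m ζ * critSeq ξ₀ ζ| := by
  refine summable_of_ne_finset_zero (s := {ξ₀, -ξ₀}) fun ζ hζ => ?_
  simp only [Finset.mem_insert, Finset.mem_singleton] at hζ
  simp [critSeq, hζ]

/-- In the scale of weighted `ℓ¹` spaces the fixed-point map gains one derivative; being quadratic,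
it is analytic. -/
theorem SimpleCriticalPair.exists_levelMap {ν : ℝ} (hν : 0 < ν) {K : Space d → ℝ}
    (hK : IsKernel K) {γc : ℝ} {ξ₀ : Fin d → ℤ} (h : SimpleCriticalPair ν K γc ξ₀) (n : ℕ) :
    ∃ L : (ℝ × ℝ) × (Seq d × Seq d) → Seq d × Seq d, ContDiff ℝ ω L ∧
      (∀ p V ζ, (L (p, V)).1 ζ = rho ζ ^ (n + 1) *
        profileP ν K γc ξ₀ p (wt n V.1) (wt (n + 1) V.2) ζ) ∧
      (∀ p V ζ, (L (p, V)).2 ζ = rho ζ ^ (n + 2) *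
        profileW ν K γc ξ₀ p (wt n V.1) (wt (n + 1) V.2) ζ) := by
  obtain ⟨C, hC0, hC⟩ := h.exists_invSymbol_bound hν hK
  obtain ⟨B, hB0, hB⟩ := exists_abs_kernelCoef_le hK
  set S := invSymbol ν K γc ξ₀
  have hmul : ∀ (e : (Fin d → ℤ) → ℝ) (j k : ℕ), (∀ ζ, |e ζ| * rho ζ ^ j ≤ C) → ∀ ζ,
      |rho ζ ^ (k + j) * e ζ| ≤ C * rho ζ ^ k := by
    intro e j k he ζ
    have h1 := pow_pos (rho_pos ζ) k
    rw [abs_mul, abs_of_pos (pow_pos (rho_pos ζ) _), pow_add]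
    calc rho ζ ^ k * rho ζ ^ j * |e ζ| = rho ζ ^ k * (|e ζ| * rho ζ ^ j) := by ring
      _ ≤ rho ζ ^ k * C := mul_le_mul_of_nonneg_left (he ζ) h1.le
      _ = _ := mul_comm _ _
  have hdown : ∀ (e : (Fin d → ℤ) → ℝ), (∀ ζ, |e ζ| * rho ζ ^ 2 ≤ C) →
      ∀ ζ, |e ζ| * rho ζ ^ 1 ≤ C := fun e he ζ =>
    (mul_le_mul_of_nonneg_left (pow_le_pow_right₀ (one_le_rho ζ) one_le_two)
      (abs_nonneg _)).trans (he ζ)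
  -- the linear terms
  have hdiag : ∀ (e : (Fin d → ℤ) → ℝ) (j : ℕ), (∀ ζ, |e ζ| * rho ζ ^ j ≤ C) → ∀ ζ,
      |rho ζ ^ j * e ζ * kernelCoef K ζ| ≤ C * B := by
    intro e j he ζ
    have h1 := hmul e j 0 he ζ
    rw [zero_add, pow_zero, mul_one] at h1
    rw [abs_mul]
    exact mul_le_mul h1 (hB ζ) (abs_nonneg _) hC0
  set D₁ := diagOp _ _ (hdiag S.e11 1 (hdown _ fun ζ => (hC ζ).1))
  set D₂ := diagOp _ _ (hdiag S.e21 2 fun ζ => (hC ζ).2.2.1)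
  -- the quadratic terms
  obtain ⟨G₁, hG₁⟩ := exists_gradOp n (hmul S.e11 1 n (hdown _ fun ζ => (hC ζ).1))
  obtain ⟨G₂, hG₂⟩ := exists_gradOp n (hmul S.e21 2 n fun ζ => (hC ζ).2.2.1)
  obtain ⟨E₁, hE₁⟩ := exists_divOp n (w := fun ζ => rho ζ ^ (n + 1) * S.e12 ζ) (C := C) fun ζ => by
    have := hmul S.e12 2 n (fun ζ => (hC ζ).2.1) ζ
    rw [abs_mul, abs_of_pos (pow_pos (rho_pos ζ) _)] at this ⊢
    rw [pow_succ] at this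
    linarith
  obtain ⟨E₂, hE₂⟩ := exists_divOp n (w := fun ζ => rho ζ ^ (n + 2) * S.e22 ζ) (C := C) fun ζ => by
    have := hmul S.e22 3 n (fun ζ => (hC ζ).2.2.2) ζ
    rw [abs_mul, abs_of_pos (pow_pos (rho_pos ζ) _)] at this ⊢
    rw [pow_succ] at this
    linarith
  set c₁ : Seq d := mkSeq (fun ζ => rho ζ ^ (n + 1) * critSeq ξ₀ ζ) (summable_critSeq ξ₀ _)
  set c₂ : Seq d := mkSeq (fun ζ => (rho ζ ^ (n + 2) * -ν) * critSeq ξ₀ ζ) (summable_critSeq ξ₀ _)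
  refine ⟨fun x => (c₁ + x.1.2 • D₁ x.2.1 - x.1.1 • G₁ x.2.2 x.2.2 + x.1.1 • E₁ x.2.1 x.2.2,
    c₂ + x.1.2 • D₂ x.2.1 - x.1.1 • G₂ x.2.2 x.2.2 + x.1.1 • E₂ x.2.1 x.2.2), ?_, ?_, ?_⟩
  · have q1 : ContDiff ℝ ω fun x : (ℝ × ℝ) × (Seq d × Seq d) => x.2.1 :=
      contDiff_fst.comp contDiff_snd
    have q2 : ContDiff ℝ ω fun x : (ℝ × ℝ) × (Seq d × Seq d) => x.2.2 :=
      contDiff_snd.comp contDiff_snd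
    have q3 : ContDiff ℝ ω fun x : (ℝ × ℝ) × (Seq d × Seq d) => x.1.1 :=
      contDiff_fst.comp contDiff_fst
    have q4 : ContDiff ℝ ω fun x : (ℝ × ℝ) × (Seq d × Seq d) => x.1.2 :=
      contDiff_snd.comp contDiff_fst
    have bil : ∀ (T : Seq d →L[ℝ] Seq d →L[ℝ] Seq d)
        {f g : (ℝ × ℝ) × (Seq d × Seq d) → Seq d}, ContDiff ℝ ω f → ContDiff ℝ ω g →
        ContDiff ℝ ω fun x => T (f x) (g x) := fun T f g hf hg =>
      (T.contDiff.comp hf).clm_apply hg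
    exact ((((contDiff_const.add (q4.smul (D₁.contDiff.comp q1)))).sub
        (q3.smul (bil G₁ q2 q2))).add (q3.smul (bil E₁ q1 q2))).prodMk
      ((((contDiff_const.add (q4.smul (D₂.contDiff.comp q1)))).sub
        (q3.smul (bil G₂ q2 q2))).add (q3.smul (bil E₂ q1 q2)))
  · intro p V ζ
    change c₁ ζ + p.2 * D₁ V.1 ζ - p.1 * G₁ V.2 V.2 ζ + p.1 * E₁ V.1 V.2 ζ = _
    rw [hG₁, hE₁, diagOp_apply, mkSeq_apply]
    have : V.1 ζ = rho ζ ^ n * wt n V.1 ζ := by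
      rw [wt, mul_inv_cancel_left₀ (pow_pos (rho_pos ζ) n).ne']
    rw [this, profileP]
    ring
  · intro p V ζ
    change c₂ ζ + p.2 * D₂ V.1 ζ - p.1 * G₂ V.2 V.2 ζ + p.1 * E₂ V.1 V.2 ζ = _
    rw [hG₂, hE₂, diagOp_apply, mkSeq_apply]
    have : V.1 ζ = rho ζ ^ n * wt n V.1 ζ := by
      rw [wt, mul_inv_cancel_left₀ (pow_pos (rho_pos ζ) n).ne']
    rw [this, profileW]
    ring

/-! ### Solving the blown-up equation -/

/-- A family of sequences, indexed by the parameters `p ∈ O`, which depends smoothly on `p` in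
every weighted space `ℓ¹(ρ^n)`. -/
def SmoothFamily (O : Set (ℝ × ℝ)) (P : ℝ × ℝ → (Fin d → ℤ) → ℝ) : Prop :=
  ∀ n : ℕ, ∃ a : ℝ × ℝ → Seq d, ContDiffOn ℝ ∞ a O ∧ ∀ p ∈ O, ∀ ζ, a p ζ = rho ζ ^ n * P p ζ

/-- A family of profiles `(P, W)`, indexed by an open neighbourhood `O` of zero in the plane of the
parameters `p = (A, γ - γc)`, which solves the fixed-point equation and depends smoothly
on `p`. -/
structure IsProfile (ν : ℝ) (K : Space d → ℝ) (γc : ℝ) (ξ₀ : Fin d → ℤ) (O : Set (ℝ × ℝ))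
    (P W : ℝ × ℝ → (Fin d → ℤ) → ℝ) : Prop where
  isOpen : IsOpen O
  zero_mem : (0 : ℝ × ℝ) ∈ O
  eqP : ∀ p ∈ O, ∀ ζ, P p ζ = profileP ν K γc ξ₀ p (P p) (W p) ζ
  eqW : ∀ p ∈ O, ∀ ζ, W p ζ = profileW ν K γc ξ₀ p (P p) (W p) ζ
  smoothP : SmoothFamily O P
  smoothW : SmoothFamily O W

theorem wt_eq (n : ℕ) (a : (Fin d → ℤ) → ℝ) {P : (Fin d → ℤ) → ℝ}
    (h : ∀ ζ, a ζ = rho ζ ^ n * P ζ) : wt n a = P := by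
  funext ζ
  rw [wt, h, inv_mul_cancel_left₀ (pow_pos (rho_pos ζ) n).ne']

theorem exists_rhoInvOp : ∃ J : Seq d →L[ℝ] Seq d, ∀ a ζ, J a ζ = (rho ζ)⁻¹ * a ζ := by
  refine ⟨diagOp (fun ζ => (rho ζ)⁻¹) 1 fun ζ => ?_, fun a ζ => diagOp_apply _ _ _ a ζ⟩
  rw [abs_of_pos (inv_pos.2 (rho_pos ζ))]
  exact inv_le_one_of_one_le₀ (one_le_rho ζ)

/-- At `p = 0` the fixed-point map is constant, so the analytic implicit function theorem solves the
fixed-point equation for small `p` in the weakest of the weighted spaces. Since the fixed-point map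
gains one derivative, the solution is smooth in all the others. -/
theorem SimpleCriticalPair.exists_isProfile {ν : ℝ} (hν : 0 < ν) {K : Space d → ℝ}
    (hK : IsKernel K) {γc : ℝ} {ξ₀ : Fin d → ℤ} (h : SimpleCriticalPair ν K γc ξ₀) :
    ∃ O P W, IsProfile ν K γc ξ₀ O P W := by
  choose L hL hL1 hL2 using h.exists_levelMap hν hK
  obtain ⟨J, hJ⟩ := exists_rhoInvOp (d := d)
  set JJ : Seq d × Seq d →L[ℝ] Seq d × Seq d := J.prodMap J
  set f : (ℝ × ℝ) × (Seq d × Seq d) → Seq d × Seq d := fun x => x.2 - JJ (L 0 x)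
  have hf : ContDiff ℝ ω f := contDiff_snd.sub (JJ.contDiff.comp (hL 0))
  have hconst : ∀ V, L 0 (0, V) = L 0 (0, 0) := by
    intro V
    refine Prod.ext (lp.ext (funext fun ζ => ?_)) (lp.ext (funext fun ζ => ?_))
    · rw [hL1, hL1]; simp [profileP]
    · rw [hL2, hL2]; simp [profileW]
  set V₀ : Seq d × Seq d := JJ (L 0 (0, 0))
  set u : (ℝ × ℝ) × (Seq d × Seq d) := (0, V₀)
  have hfu : f u = 0 := by simp [f, u, hconst V₀, V₀]
  have hid : fderiv ℝ f u ∘L .inr ℝ (ℝ × ℝ) (Seq d × Seq d) =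
      ContinuousLinearMap.id ℝ (Seq d × Seq d) := by
    have h1 : HasFDerivAt (fun V => f (0, V))
        (fderiv ℝ f u ∘L .inr ℝ (ℝ × ℝ) (Seq d × Seq d)) V₀ :=
      HasFDerivAt.comp (f := fun V : Seq d × Seq d => ((0 : ℝ × ℝ), V)) V₀
        ((hf.differentiable (by simp)) u).hasFDerivAt (hasFDerivAt_prodMk_right (0 : ℝ × ℝ) V₀)
    have h2 : HasFDerivAt (fun V => f (0, V)) (ContinuousLinearMap.id ℝ (Seq d × Seq d)) V₀ := by
      have : (fun V => f (0, V)) = fun V => V - V₀ := funext fun V => by simp [f, hconst V, V₀]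
      rw [this]
      exact (hasFDerivAt_id V₀).sub_const V₀
    exact h1.unique h2
  have hinv : (fderiv ℝ f u ∘L .inr ℝ (ℝ × ℝ) (Seq d × Seq d)).IsInvertible := by
    rw [hid]
    exact ⟨ContinuousLinearEquiv.refl ℝ _, rfl⟩
  have hcd : ContDiffAt ℝ ω f u := hf.contDiffAt
  set V : ℝ × ℝ → Seq d × Seq d := hcd.implicitFunction (by simp) hinv
  have hV : ContDiffAt ℝ ω V 0 := hcd.contDiffAt_implicitFunction (by simp) hinv
  have hsol : ∀ᶠ p in 𝓝 (0 : ℝ × ℝ), f (p, V p) = f u :=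
    hcd.eventually_apply_implicitFunction (by simp) hinv
  obtain ⟨O, hO, hOo, h0⟩ := eventually_nhds_iff.1 (hsol.and (hV.eventually (by simp)))
  have hfix : ∀ p ∈ O, V p = JJ (L 0 (p, V p)) := by
    intro p hp
    have := (hO p hp).1
    rw [hfu] at this
    exact sub_eq_zero.1 this
  set P : ℝ × ℝ → (Fin d → ℤ) → ℝ := fun p => wt 0 (V p).1
  set W : ℝ × ℝ → (Fin d → ℤ) → ℝ := fun p => wt 1 (V p).2
  have hV1 : ∀ p ζ, (V p).1 ζ = rho ζ ^ 0 * P p ζ := fun p ζ => by simp [P, wt]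
  have hV2 : ∀ p ζ, (V p).2 ζ = rho ζ ^ 1 * W p ζ := fun p ζ => by
    simp [W, wt, mul_inv_cancel_left₀ (rho_pos ζ).ne']
  have eqP : ∀ p ∈ O, ∀ ζ, P p ζ = profileP ν K γc ξ₀ p (P p) (W p) ζ := by
    intro p hp ζ
    have h1 := congrArg (fun v : Seq d × Seq d => v.1 ζ) (hfix p hp)
    change (V p).1 ζ = J (L 0 (p, V p)).1 ζ at h1
    rw [hJ, hL1, hV1, pow_zero, one_mul, zero_add, pow_one,
      inv_mul_cancel_left₀ (rho_pos ζ).ne'] at h1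
    exact h1
  have eqW : ∀ p ∈ O, ∀ ζ, W p ζ = profileW ν K γc ξ₀ p (P p) (W p) ζ := by
    intro p hp ζ
    have h1 := congrArg (fun v : Seq d × Seq d => v.2 ζ) (hfix p hp)
    change (V p).2 ζ = J (L 0 (p, V p)).2 ζ at h1
    have hρ := (rho_pos ζ).ne'
    rw [hJ, hL2, hV2, pow_one, zero_add, pow_two, mul_assoc, inv_mul_cancel_left₀ hρ] at h1
    exact mul_left_cancel₀ hρ h1
  -- each application of the fixed-point map raises the weight by one
  have key : ∀ n : ℕ, ∃ U : ℝ × ℝ → Seq d × Seq d, ContDiffOn ℝ ω U O ∧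
      ∀ p ∈ O, ∀ ζ, (U p).1 ζ = rho ζ ^ n * P p ζ ∧ (U p).2 ζ = rho ζ ^ (n + 1) * W p ζ := by
    intro n
    induction n with
    | zero => exact ⟨V, fun p hp => (hO p hp).2.contDiffWithinAt, fun p _ ζ => ⟨hV1 p ζ, hV2 p ζ⟩⟩
    | succ n ih =>
      obtain ⟨U, hU, hUe⟩ := ih
      refine ⟨fun p => L n (p, U p), (hL n).comp_contDiffOn (contDiffOn_id.prodMk hU),
        fun p hp ζ => ?_⟩
      have e1 := wt_eq n (U p).1 fun ζ => (hUe p hp ζ).1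
      have e2 := wt_eq (n + 1) (U p).2 fun ζ => (hUe p hp ζ).2
      rw [hL1, hL2, e1, e2, ← eqP p hp, ← eqW p hp]
      exact ⟨rfl, rfl⟩
  refine ⟨O, P, W, hOo, h0, eqP, eqW, fun n => ?_, fun n => ?_⟩
  · obtain ⟨U, hU, hUe⟩ := key n
    exact ⟨fun p => (U p).1, (contDiff_fst.comp_contDiffOn hU).of_le le_top,
      fun p hp ζ => (hUe p hp ζ).1⟩
  · obtain ⟨U, hU, hUe⟩ := key n
    refine ⟨fun p => J (U p).2, (J.contDiff.comp_contDiffOn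
      (contDiff_snd.comp_contDiffOn hU)).of_le le_top, fun p hp ζ => ?_⟩
    rw [hJ, (hUe p hp ζ).2, pow_succ']
    rw [mul_assoc, inv_mul_cancel_left₀ (rho_pos ζ).ne']

/-! ### Quadratic expressions in cosine series -/

theorem dot_eq_sum (ξ η : Fin d → ℤ) : dot ξ η = ∑ i, (ξ i : ℝ) * η i := by
  simp [dot, latt, PiLp.inner_apply, mul_comm]

theorem summable_pairing {P Q : (Fin d → ℤ) → ℝ} {p q : ℕ} (hP : Decay p P) (hQ : Decay q Q)
    {N : (Fin d → ℤ) → (Fin d → ℤ) → ℝ} {C : ℝ}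
    (hN : ∀ ξ η, |N ξ η| ≤ C * (rho ξ ^ p * rho η ^ q)) :
    (∀ ξ, Summable fun η => Q η * N ξ η) ∧ Summable fun ξ => P ξ * ∑' η, Q η * N ξ η := by
  have hb : ∀ ξ η, ‖Q η * N ξ η‖ ≤ (C * rho ξ ^ p) * (rho η ^ q * |Q η|) := fun ξ η => by
    rw [norm_mul, Real.norm_eq_abs, Real.norm_eq_abs]
    calc |Q η| * |N ξ η| ≤ |Q η| * (C * (rho ξ ^ p * rho η ^ q)) :=
          mul_le_mul_of_nonneg_left (hN ξ η) (abs_nonneg _)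
      _ = _ := by ring
  refine ⟨fun ξ => Summable.of_norm_bounded (Summable.mul_left _ hQ) (hb ξ),
    Summable.of_norm_bounded
      (Summable.mul_right (C * ∑' η, rho η ^ q * |Q η|) hP) fun ξ => ?_⟩
  have h1 : ‖∑' η, Q η * N ξ η‖ ≤ (C * rho ξ ^ p) * ∑' η, rho η ^ q * |Q η| := by
    rw [← tsum_mul_left]
    exact tsum_of_norm_bounded (Summable.mul_left _ hQ).hasSum (hb ξ)
  rw [norm_mul, Real.norm_eq_abs (P ξ)]
  calc |P ξ| * ‖∑' η, Q η * N ξ η‖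
      ≤ |P ξ| * ((C * rho ξ ^ p) * ∑' η, rho η ^ q * |Q η|) :=
        mul_le_mul_of_nonneg_left h1 (abs_nonneg _)
    _ = _ := by ring

/-- The cosine series with coefficients `pairSum M τ P Q`, for an unbounded kernel `M` balanced by
the decay of `P` and `Q`. -/
theorem cosSeries_pairSum {P Q : (Fin d → ℤ) → ℝ} {p q : ℕ} (hP : Decay p P) (hQ : Decay q Q)
    {M : (Fin d → ℤ) → (Fin d → ℤ) → ℝ} {C : ℝ} (hM : ∀ ξ η, |M ξ η| ≤ C * (rho ξ ^ p * rho η ^ q))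
    (τ : (Fin d → ℤ) → (Fin d → ℤ) → (Fin d → ℤ)) :
    (Summable fun ζ => |pairSum M τ P Q ζ|) ∧ ∀ x, trigSeries true (pairSum M τ P Q) x =
      ∑' ξ, P ξ * ∑' η, Q η * (M ξ η * cosMode (τ ξ η) x) := by
  have hpos : ∀ ξ η : Fin d → ℤ, 0 < rho ξ ^ p * rho η ^ q := fun ξ η =>
    mul_pos (pow_pos (rho_pos ξ) p) (pow_pos (rho_pos η) q)
  have hN : ∀ ξ η, |M ξ η / (rho ξ ^ p * rho η ^ q)| ≤ C := fun ξ η => by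
    rw [abs_div, abs_of_pos (hpos ξ η), div_le_iff₀ (hpos ξ η)]
    exact hM ξ η
  have habs : ∀ {k : ℕ} {R : (Fin d → ℤ) → ℝ}, Decay k R →
      Summable fun ξ => |rho ξ ^ k * R ξ| := fun {k R} hR => by
    simp only [abs_mul, abs_of_pos (pow_pos (rho_pos _) k)]
    exact hR
  set a := mkSeq _ (habs hP)
  set b := mkSeq _ (habs hQ)
  have hcancel : ∀ (ξ η : Fin d → ℤ) (c : ℝ),
      (rho ξ ^ p * P ξ) * ((rho η ^ q * Q η) * (M ξ η / (rho ξ ^ p * rho η ^ q) * c)) =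
        P ξ * (Q η * (M ξ η * c)) := fun ξ η c => by
    have h1 := (pow_pos (rho_pos ξ) p).ne'
    have h2 := (pow_pos (rho_pos η) q).ne'
    field_simp
  have hcancel' : ∀ (ξ : Fin d → ℤ) (c : (Fin d → ℤ) → ℝ),
      (rho ξ ^ p * P ξ) * ∑' η, (rho η ^ q * Q η) * (M ξ η / (rho ξ ^ p * rho η ^ q) * c η) =
        P ξ * ∑' η, Q η * (M ξ η * c η) := fun ξ c => by
    rw [← tsum_mul_left, ← tsum_mul_left]
    exact tsum_congr fun η => hcancel ξ η _
  have hpair : ∀ ζ, pairOp _ τ C hN a b ζ = pairSum M τ P Q ζ := fun ζ => by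
    rw [pairOp_apply, pairSum, pairSum]
    refine tsum_congr fun ξ => ?_
    have := hcancel' ξ fun η => if τ ξ η = ζ then 1 else 0
    simpa only [mul_ite, mul_one, mul_zero, a, b, mkSeq_apply] using this
  have hfun : (fun ζ => pairOp _ τ C hN a b ζ) = pairSum M τ P Q := funext hpair
  refine ⟨?_, fun x => ?_⟩
  · simpa only [hpair] using summable_abs_seq (pairOp _ τ C hN a b)
  · rw [← hfun, ← cosEval_apply, map_pairOp]
    refine tsum_congr fun ξ => ?_
    simp only [cosEval_single]
    exact hcancel' ξ fun η => cosMode (τ ξ η) x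

/-- A double series whose kernel is a finite sum of products is a finite sum of products of
series. -/
theorem tsum_tsum_finsetSum {ι : Type*} [Fintype ι] {P Q : (Fin d → ℤ) → ℝ} {p q : ℕ}
    (hP : Decay p P) (hQ : Decay q Q) {f g : ι → (Fin d → ℤ) → ℝ} {C : ℝ}
    (hf : ∀ i ξ, |f i ξ| ≤ C * rho ξ ^ p) (hg : ∀ i η, |g i η| ≤ C * rho η ^ q) :
    ∑' ξ, P ξ * ∑' η, Q η * ∑ i, f i ξ * g i η =
      ∑ i, (∑' ξ, P ξ * f i ξ) * ∑' η, Q η * g i η := by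
  have aux : ∀ {k : ℕ} {R : (Fin d → ℤ) → ℝ} {u : ι → (Fin d → ℤ) → ℝ}, Decay k R →
      (∀ i ξ, |u i ξ| ≤ C * rho ξ ^ k) → ∀ c : ι → ℝ,
      ∑' ξ, R ξ * ∑ i, c i * u i ξ = ∑ i, c i * ∑' ξ, R ξ * u i ξ := by
    intro k R u hR hu c
    have hs : ∀ i, Summable fun ξ => R ξ * u i ξ := fun i =>
      Summable.of_norm_bounded (Summable.mul_left C hR) fun ξ => by
        rw [norm_mul, Real.norm_eq_abs, Real.norm_eq_abs]
        calc |R ξ| * |u i ξ| ≤ |R ξ| * (C * rho ξ ^ k) :=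
              mul_le_mul_of_nonneg_left (hu i ξ) (abs_nonneg _)
          _ = _ := by ring
    simp only [← tsum_mul_left]
    rw [← Summable.tsum_finsetSum fun i _ => (hs i).mul_left (c i)]
    refine tsum_congr fun ξ => ?_
    rw [Finset.mul_sum]
    exact Finset.sum_congr rfl fun i _ => by ring
  have h1 : ∀ ξ, ∑' η, Q η * ∑ i, f i ξ * g i η = ∑ i, (∑' η, Q η * g i η) * f i ξ := fun ξ => by
    rw [aux hQ hg fun i => f i ξ]
    exact Finset.sum_congr rfl fun i _ => mul_comm _ _
  simp only [h1]
  rw [aux hP hf]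
  exact Finset.sum_congr rfl fun i _ => mul_comm _ _

theorem abs_two_pi_mul_trigMode_le (b : Bool) (ξ : Fin d → ℤ) (i : Fin d) (x : Space d) :
    |2 * Real.pi * ξ i * trigMode b ξ x| ≤ 2 * Real.pi * rho ξ := by
  have h := Real.two_pi_pos
  rw [abs_mul, abs_mul, abs_of_pos h]
  have h1 := abs_apply_le_rho ξ i
  have h2 := abs_trigMode_le b ξ x
  have h3 := rho_pos ξ
  calc 2 * Real.pi * |(ξ i : ℝ)| * |trigMode b ξ x| ≤ 2 * Real.pi * rho ξ * 1 := by gcongr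
    _ = _ := mul_one _

theorem abs_mul_dot_le {c : ℝ} (hc : 0 ≤ c) (ξ η : Fin d → ℤ) :
    |c * dot ξ η| ≤ c * (rho ξ ^ 1 * rho η ^ 1) := by
  rw [abs_mul, abs_of_nonneg hc, pow_one, pow_one]
  exact mul_le_mul_of_nonneg_left (abs_dot_le ξ η) hc

theorem pd_cosSeries_apply {P : (Fin d → ℤ) → ℝ} (h : Decay 1 P) (i : Fin d) (x : Space d) :
    pd i (trigSeries true P) x = -∑' ξ, P ξ * (2 * Real.pi * ξ i * sinMode ξ x) := by
  rw [pd_cosSeries h, trigSeries, ← tsum_neg]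
  exact tsum_congr fun ξ => by simp only [trigMode]; ring

/-- `½|∇w|²` is the cosine series with coefficients `quadGrad W W`. -/
theorem cosSeries_quadGrad {W : (Fin d → ℤ) → ℝ} (hW : Decay 1 W) :
    (Summable fun ζ => |quadGrad W W ζ|) ∧ ∀ x, trigSeries true (quadGrad W W) x =
      (1 / 2) * ∑ i, pd i (trigSeries true W) x ^ 2 := by
  have hM := abs_mul_dot_le (d := d) (sq_nonneg Real.pi)
  obtain ⟨s1, e1⟩ := cosSeries_pairSum hW hW hM fun ξ η => ξ - η
  obtain ⟨s2, e2⟩ := cosSeries_pairSum hW hW hM fun ξ η => ξ + η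
  have e : quadGrad W W = fun ζ =>
    pairSum (fun ξ η => Real.pi ^ 2 * dot ξ η) (fun ξ η => ξ - η) W W ζ +
      -1 * pairSum (fun ξ η => Real.pi ^ 2 * dot ξ η) (fun ξ η => ξ + η) W W ζ :=
    funext fun ζ => by rw [quadGrad]; ring
  have s2' : Summable fun ζ =>
      |-1 * pairSum (fun ξ η => Real.pi ^ 2 * dot ξ η) (fun ξ η => ξ + η) W W ζ| := by
    simpa using s2
  refine ⟨?_, fun x => ?_⟩
  · rw [e]
    exact Summable.of_nonneg_of_le (fun _ => abs_nonneg _) (fun _ => abs_add_le _ _) (s1.add s2')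
  have hN : ∀ τ : (Fin d → ℤ) → (Fin d → ℤ) → (Fin d → ℤ), ∀ ξ η,
      |Real.pi ^ 2 * dot ξ η * cosMode (τ ξ η) x| ≤ Real.pi ^ 2 * (rho ξ ^ 1 * rho η ^ 1) := by
    intro τ ξ η
    rw [abs_mul]
    exact (mul_le_of_le_one_right (abs_nonneg _) (abs_trigMode_le true _ x)).trans (hM ξ η)
  have t1 := summable_pairing hW hW (hN fun ξ η => ξ - η)
  have t2 := summable_pairing hW hW (hN fun ξ η => ξ + η)
  rw [e, trigSeries_add true s1 s2', trigSeries_const_mul, e1, e2, neg_one_mul, ← sub_eq_add_neg,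
    ← t1.2.tsum_sub t2.2]
  have hb : ∀ (i : Fin d) (ξ : Fin d → ℤ),
      |2 * Real.pi * ξ i * sinMode ξ x| ≤ (2 * Real.pi) * rho ξ ^ 1 := fun i ξ => by
    rw [pow_one]
    exact abs_two_pi_mul_trigMode_le false ξ i x
  have key := tsum_tsum_finsetSum hW hW hb hb
  simp only [pd_cosSeries_apply hW, neg_sq, pow_two (∑' ξ, _ : ℝ)]
  rw [← key, ← tsum_mul_left]
  refine tsum_congr fun ξ => ?_
  rw [← mul_sub, ← (t1.1 ξ).tsum_sub (t2.1 ξ), mul_left_comm, ← tsum_mul_left (a := (1 / 2 : ℝ))]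
  congr 1
  refine tsum_congr fun η => ?_
  have e3 : ∑ i, 2 * Real.pi * ξ i * sinMode ξ x * (2 * Real.pi * η i * sinMode η x) =
      (4 * Real.pi ^ 2 * sinMode ξ x * sinMode η x) * dot ξ η := by
    rw [dot_eq_sum, Finset.mul_sum]
    exact Finset.sum_congr rfl fun i _ => by ring
  rw [e3]
  simp only [cosMode, sinMode, phase_sub, phase_add, Real.cos_sub, Real.cos_add]
  ring

/-- `div (μ ∇w)` is the cosine series with coefficients `quadDiv P W`. -/
theorem cosSeries_quadDiv {P W : (Fin d → ℤ) → ℝ} (hP : Decay 1 P) (hW : Decay 2 W) :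
    (Summable fun ζ => |quadDiv P W ζ|) ∧ ∀ x, trigSeries true (quadDiv P W) x =
      ∑ i, pd i (trigSeries true P) x * pd i (trigSeries true W) x +
        trigSeries true P x * lap (trigSeries true W) x := by
  have hM : ∀ τ : (Fin d → ℤ) → (Fin d → ℤ) → (Fin d → ℤ), (∀ ξ η, rho (τ ξ η) ≤ rho ξ * rho η) →
      ∀ ξ η, |2 * Real.pi ^ 2 * dot (τ ξ η) η| ≤ 2 * Real.pi ^ 2 * (rho ξ ^ 1 * rho η ^ 2) := by
    intro τ hτ ξ η
    have h0 : 0 ≤ 2 * Real.pi ^ 2 := by positivity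
    refine (abs_mul_dot_le h0 _ _).trans ?_
    have h1 := hτ ξ η
    have h2 := rho_pos η
    calc 2 * Real.pi ^ 2 * (rho (τ ξ η) ^ 1 * rho η ^ 1)
        ≤ 2 * Real.pi ^ 2 * ((rho ξ * rho η) ^ 1 * rho η ^ 1) := by
          rw [pow_one, pow_one, pow_one]; gcongr
      _ = _ := by ring
  have hM1 := hM _ rho_sub_le
  have hM2 := hM _ rho_add_le
  obtain ⟨s1, e1⟩ := cosSeries_pairSum hP hW hM1 fun ξ η => ξ - η
  obtain ⟨s2, e2⟩ := cosSeries_pairSum hP hW hM2 fun ξ η => ξ + η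
  have e : quadDiv P W = fun ζ =>
    pairSum (fun ξ η => 2 * Real.pi ^ 2 * dot (ξ - η) η) (fun ξ η => ξ - η) P W ζ +
      -1 * pairSum (fun ξ η => 2 * Real.pi ^ 2 * dot (ξ + η) η) (fun ξ η => ξ + η) P W ζ :=
    funext fun ζ => by rw [quadDiv]; ring
  have s2' : Summable fun ζ =>
      |-1 * pairSum (fun ξ η => 2 * Real.pi ^ 2 * dot (ξ + η) η) (fun ξ η => ξ + η) P W ζ| := by
    simpa using s2
  refine ⟨?_, fun x => ?_⟩
  · rw [e]
    exact Summable.of_nonneg_of_le (fun _ => abs_nonneg _) (fun _ => abs_add_le _ _) (s1.add s2')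
  have hN : ∀ {M : (Fin d → ℤ) → (Fin d → ℤ) → ℝ},
      (∀ ξ η, |M ξ η| ≤ 2 * Real.pi ^ 2 * (rho ξ ^ 1 * rho η ^ 2)) →
      ∀ τ : (Fin d → ℤ) → (Fin d → ℤ) → (Fin d → ℤ), ∀ ξ η,
      |M ξ η * cosMode (τ ξ η) x| ≤ 2 * Real.pi ^ 2 * (rho ξ ^ 1 * rho η ^ 2) := by
    intro M h τ ξ η
    rw [abs_mul]
    exact (mul_le_of_le_one_right (abs_nonneg _) (abs_trigMode_le true _ x)).trans (h ξ η)
  have t1 := summable_pairing hP hW (hN hM1 fun ξ η => ξ - η)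
  have t2 := summable_pairing hP hW (hN hM2 fun ξ η => ξ + η)
  rw [e, trigSeries_add true s1 s2', trigSeries_const_mul, e1, e2, neg_one_mul, ← sub_eq_add_neg,
    ← t1.2.tsum_sub t2.2]
  -- the gradient terms are indexed by `some i`, the Laplacian term by `none`
  let f : Option (Fin d) → (Fin d → ℤ) → ℝ := fun o ξ =>
    o.elim (cosMode ξ x) fun i => 2 * Real.pi * ξ i * sinMode ξ x
  let g : Option (Fin d) → (Fin d → ℤ) → ℝ := fun o η =>
    o.elim (-freqSq η * cosMode η x) fun i => 2 * Real.pi * η i * sinMode η x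
  have hpi : 1 ≤ 2 * Real.pi := by linarith [Real.pi_gt_three]
  have hpi2 : 2 * Real.pi ≤ (2 * Real.pi) ^ 2 := by nlinarith
  have hf : ∀ o ξ, |f o ξ| ≤ (2 * Real.pi) ^ 2 * rho ξ ^ 1 := by
    intro o ξ
    rw [pow_one]
    have h1 := one_le_rho ξ
    rcases o with _ | i
    · have := abs_trigMode_le true ξ x
      change |cosMode ξ x| ≤ 1 at this
      change |cosMode ξ x| ≤ _
      nlinarith
    · exact (abs_two_pi_mul_trigMode_le false ξ i x).trans
        (mul_le_mul_of_nonneg_right hpi2 (rho_pos ξ).le)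
  have hg : ∀ o ξ, |g o ξ| ≤ (2 * Real.pi) ^ 2 * rho ξ ^ 2 := by
    intro o ξ
    have h1 := one_le_rho ξ
    rcases o with _ | i
    · change |-freqSq ξ * cosMode ξ x| ≤ _
      rw [abs_mul, abs_neg, abs_of_nonneg (freqSq_nonneg ξ)]
      exact (mul_le_of_le_one_right (freqSq_nonneg ξ) (abs_trigMode_le true ξ x)).trans
        (freqSq_le_rho_sq ξ)
    · refine (abs_two_pi_mul_trigMode_le false ξ i x).trans ?_
      have : rho ξ ≤ rho ξ ^ 2 := by nlinarith
      exact mul_le_mul hpi2 this (rho_pos ξ).le (by positivity)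
  have key := tsum_tsum_finsetSum hP hW hf hg
  rw [Fintype.sum_option] at key
  have e4 : lap (trigSeries true W) x = ∑' η, W η * (-freqSq η * cosMode η x) := by
    rw [lap_cosSeries hW, trigSeries]
    exact tsum_congr fun η => by simp only [trigMode]; ring
  have e5 : trigSeries true P x = ∑' ξ, P ξ * cosMode ξ x := rfl
  simp only [pd_cosSeries_apply hP, pd_cosSeries_apply (hW.mono one_le_two), neg_mul_neg, e4, e5]
  rw [add_comm]
  refine Eq.trans ?_ key
  refine tsum_congr fun ξ => ?_
  rw [← mul_sub, ← (t1.1 ξ).tsum_sub (t2.1 ξ)]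
  congr 1
  refine tsum_congr fun η => ?_
  have e3 : ∑ i, 2 * Real.pi * ξ i * sinMode ξ x * (2 * Real.pi * η i * sinMode η x) =
      (4 * Real.pi ^ 2 * sinMode ξ x * sinMode η x) * dot ξ η := by
    rw [dot_eq_sum, Finset.mul_sum]
    exact Finset.sum_congr rfl fun i _ => by ring
  have e6 : freqSq η = 4 * Real.pi ^ 2 * dot η η := by
    rw [freqSq, dot, real_inner_self_eq_norm_sq]; ring
  have e7 : dot (ξ - η) η = dot ξ η - dot η η := by simp [dot, latt_sub, inner_sub_left]
  have e8 : dot (ξ + η) η = dot ξ η + dot η η := by simp [dot, latt_add, inner_add_left]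
  rw [Fintype.sum_option]
  simp only [f, g, Option.elim]
  rw [e3, e6, e7, e8]
  simp only [cosMode, sinMode, phase_sub, phase_add, Real.cos_sub, Real.cos_add]
  ring

/-! ### The constructed solutions of the complement equation -/

/-- The cosine coefficients of the first component of the stationary operator at
`(A μ, A w, 0)`, divided by `A`. -/
def hjbResidual (ν : ℝ) (K : Space d → ℝ) (γ A : ℝ) (P W : (Fin d → ℤ) → ℝ) (ζ : Fin d → ℤ) : ℝ :=
  ν * freqSq ζ * W ζ + A * quadGrad W W ζ - γ * kernelCoef K ζ * P ζ

/-- The cosine coefficients of the second component of the stationary operator at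
`(A μ, A w, 0)`, divided by `A`. -/
def fpResidual (ν A : ℝ) (P W : (Fin d → ℤ) → ℝ) (ζ : Fin d → ℤ) : ℝ :=
  ν * freqSq ζ * P ζ + freqSq ζ * W ζ - A * quadDiv P W ζ

theorem Decay.summable_freqSq {P : (Fin d → ℤ) → ℝ} (h : Decay 2 P) :
    Summable fun ζ => |freqSq ζ * P ζ| := by
  have : Decay 0 fun ζ => freqSq ζ * P ζ :=
    Decay.of_le (k := 0) (l := 2) (C := (2 * Real.pi) ^ 2) h fun ζ => by
      rw [abs_mul, abs_of_nonneg (freqSq_nonneg ζ)]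
      exact mul_le_mul_of_nonneg_right (freqSq_le_rho_sq ζ) (abs_nonneg _)
  exact this.summable_abs

theorem lap_const_mul {f : Space d → ℝ} (hf : ContDiff ℝ 2 f) (c : ℝ) (x : Space d) :
    lap (fun y => c * f y) x = c * lap f x := by
  have h1 : ∀ i, pd i (fun y => c * f y) = fun y => c * pd i f y := fun i =>
    funext fun y => pd_const_mul (hf.differentiable (by norm_num)) c i y
  simp only [lap, h1, Finset.mul_sum]
  refine Finset.sum_congr rfl fun i _ => ?_
  exact pd_const_mul ((contDiff_pd (m := 1) hf (by norm_num) i).differentiable (by norm_num)) c i x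

theorem trigSeries_const_mul_fun (b : Bool) (c : ℝ) (P : (Fin d → ℤ) → ℝ) :
    (trigSeries b fun ξ => c * P ξ) = fun x => c * trigSeries b P x :=
  funext fun x => trigSeries_const_mul b c P x

theorem hjbOp_cosSeries {ν : ℝ} {K : Space d → ℝ} (hK : IsKernel K) {P W : (Fin d → ℤ) → ℝ}
    (hP : Decay 2 P) (hW : Decay 2 W) (γ A l : ℝ) (x : Space d) :
    hjbOp ν K γ (fun y => A * trigSeries true P y) (fun y => A * trigSeries true W y) l x =
      A * trigSeries true (hjbResidual ν K γ A P W) x + l := by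
  have cW : ContDiff ℝ 2 (trigSeries true W) := hW.contDiff true
  obtain ⟨B, hB0, hB⟩ := exists_abs_kernelCoef_le hK
  obtain ⟨sq, eq⟩ := cosSeries_quadGrad (hW.mono one_le_two)
  have s1 : Summable fun ζ => |ν * (freqSq ζ * W ζ)| := by
    simpa only [abs_mul] using hW.summable_freqSq.mul_left |ν|
  have s2 : Summable fun ζ => |A * quadGrad W W ζ| := by
    simpa only [abs_mul] using sq.mul_left |A|
  have s3 : Summable fun ζ => |-γ * (kernelCoef K ζ * P ζ)| := by
    simpa only [abs_mul] using (hP.mul_bounded hB).summable_abs.mul_left |-γ|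
  have e : hjbResidual ν K γ A P W = fun ζ =>
      (ν * (freqSq ζ * W ζ) + A * quadGrad W W ζ) + -γ * (kernelCoef K ζ * P ζ) :=
    funext fun ζ => by rw [hjbResidual]; ring
  have s12 : Summable fun ζ => |ν * (freqSq ζ * W ζ) + A * quadGrad W W ζ| :=
    Summable.of_nonneg_of_le (fun _ => abs_nonneg _) (fun _ => abs_add_le _ _) (s1.add s2)
  have hl := lap_cosSeries hW x
  have e1 : (fun ξ => -freqSq ξ * W ξ) = fun ξ => (-1) * (freqSq ξ * W ξ) :=
    funext fun ξ => by ring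
  rw [e1, trigSeries_const_mul] at hl
  have hpd : ∀ i, pd i (fun y => A * trigSeries true W y) x = A * pd i (trigSeries true W) x :=
    fun i => pd_const_mul (cW.differentiable (by norm_num)) A i x
  rw [hjbOp_eq (contDiff_const.mul cW), lap_const_mul cW, conv_const_mul,
    conv_cosSeries hK hP.summable_abs, hl, e, trigSeries_add true s12 s3,
    trigSeries_add true s1 s2, trigSeries_const_mul, trigSeries_const_mul, trigSeries_const_mul, eq]
  simp only [hpd, mul_pow, ← Finset.mul_sum]
  ring

theorem fpOp_cosSeries {ν : ℝ} {P W : (Fin d → ℤ) → ℝ}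
    (hP : Decay 2 P) (hW : Decay 2 W) (A : ℝ) (x : Space d) :
    fpOp ν (fun y => A * trigSeries true P y) (fun y => A * trigSeries true W y) x =
      A * trigSeries true (fpResidual ν A P W) x := by
  have cP : ContDiff ℝ 2 (trigSeries true P) := hP.contDiff true
  have cW : ContDiff ℝ 2 (trigSeries true W) := hW.contDiff true
  obtain ⟨sq, eq⟩ := cosSeries_quadDiv (hP.mono one_le_two) hW
  have s1 : Summable fun ζ => |ν * (freqSq ζ * P ζ)| := by
    simpa only [abs_mul] using hP.summable_freqSq.mul_left |ν|
  have s2 : Summable fun ζ => |freqSq ζ * W ζ| := hW.summable_freqSq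
  have s3 : Summable fun ζ => |-A * quadDiv P W ζ| := by
    simpa only [abs_mul] using sq.mul_left |-A|
  have e : fpResidual ν A P W = fun ζ =>
      (ν * (freqSq ζ * P ζ) + freqSq ζ * W ζ) + -A * quadDiv P W ζ :=
    funext fun ζ => by rw [fpResidual]; ring
  have s12 : Summable fun ζ => |ν * (freqSq ζ * P ζ) + freqSq ζ * W ζ| :=
    Summable.of_nonneg_of_le (fun _ => abs_nonneg _) (fun _ => abs_add_le _ _) (s1.add s2)
  have hl : ∀ {R : (Fin d → ℤ) → ℝ}, Decay 2 R →
      lap (trigSeries true R) x = -1 * trigSeries true (fun ξ => freqSq ξ * R ξ) x := by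
    intro R hR
    rw [lap_cosSeries hR, ← trigSeries_const_mul]
    congr 1; funext ξ; ring
  have hpd : ∀ {R : (Fin d → ℤ) → ℝ}, ContDiff ℝ 2 (trigSeries true R) → ∀ i,
      pd i (fun y => A * trigSeries true R y) x = A * pd i (trigSeries true R) x :=
    fun c i => pd_const_mul (c.differentiable (by norm_num)) A i x
  have hsum : ∑ i, pd i (fun y => A * trigSeries true P y) x *
      pd i (fun y => A * trigSeries true W y) x =
      A ^ 2 * ∑ i, pd i (trigSeries true P) x * pd i (trigSeries true W) x := by
    rw [Finset.mul_sum]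
    exact Finset.sum_congr rfl fun i _ => by rw [hpd cP, hpd cW]; ring
  rw [fpOp_eq (contDiff_const.mul cP) (contDiff_const.mul cW), lap_const_mul cP, lap_const_mul cW,
    hsum, e, trigSeries_add true s12 s3, trigSeries_add true s1 s2, trigSeries_const_mul,
    trigSeries_const_mul, eq, hl hP, hl hW]
  ring

/-- A cosine series with coefficients supported on `0` and `±ξ₀`. -/
theorem cosSeries_eq_of_support {ξ₀ : Fin d → ℤ} (h0 : ξ₀ ≠ 0) {S : (Fin d → ℤ) → ℝ}
    (hS : ∀ ζ, ζ ≠ 0 → ζ ≠ ξ₀ → ζ ≠ -ξ₀ → S ζ = 0) (x : Space d) :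
    trigSeries true S x = S 0 + (S ξ₀ + S (-ξ₀)) * cosMode ξ₀ x := by
  classical
  have hne : ξ₀ ≠ -ξ₀ := fun h => h0 (self_eq_neg.1 h)
  rw [trigSeries, tsum_eq_sum (s := {0, ξ₀, -ξ₀}) fun ζ hζ => ?_]
  · have h1 : (0 : Fin d → ℤ) ∉ ({ξ₀, -ξ₀} : Finset (Fin d → ℤ)) := by
      simp only [Finset.mem_insert, Finset.mem_singleton, not_or]
      exact ⟨h0.symm, fun h => h0 (neg_eq_zero.1 h.symm)⟩
    rw [Finset.sum_insert h1, Finset.sum_pair hne]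
    simp only [trigMode, cosMode, phase_zero, phase_neg, Real.cos_zero, Real.cos_neg]
    ring
  · simp only [Finset.mem_insert, Finset.mem_singleton, not_or] at hζ
    rw [hS ζ hζ.1 hζ.2.1 hζ.2.2, zero_mul]

/-- A divergence has zero mean. -/
theorem quadDiv_zero (P W : (Fin d → ℤ) → ℝ) : quadDiv P W 0 = 0 := by
  have h : ∀ τ : (Fin d → ℤ) → (Fin d → ℤ) → (Fin d → ℤ),
      pairSum (fun ξ η => 2 * Real.pi ^ 2 * dot (τ ξ η) η) τ P W 0 = 0 := fun τ => by
    rw [pairSum]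
    refine (tsum_congr fun ξ => ?_).trans tsum_zero
    refine mul_eq_zero_of_right _ ((tsum_congr fun η => ?_).trans tsum_zero)
    split_ifs with hτ
    · have : latt (0 : Fin d → ℤ) = 0 := by ext i; simp [latt]
      rw [hτ, dot, this, inner_zero_left, mul_zero, mul_zero]
    · exact mul_zero _
  rw [quadDiv, h (fun ξ η => ξ - η), h (fun ξ η => ξ + η), sub_zero]

section Profile

variable {ν : ℝ} {K : Space d → ℝ} {γc : ℝ} {ξ₀ : Fin d → ℤ} {O : Set (ℝ × ℝ)}
  {P W : ℝ × ℝ → (Fin d → ℤ) → ℝ}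

theorem SmoothFamily.decay (hP : SmoothFamily O P) {p : ℝ × ℝ} (hp : p ∈ O) (n : ℕ) :
    Decay n (P p) := by
  obtain ⟨a, -, ha⟩ := hP n
  have := summable_abs_seq (a p)
  simp only [ha p hp, abs_mul, abs_of_pos (pow_pos (rho_pos _) n)] at this
  exact this

theorem IsProfile.apply_zero (hP : IsProfile ν K γc ξ₀ O P W) (h0 : ξ₀ ≠ 0) {p : ℝ × ℝ}
    (hp : p ∈ O) : P p 0 = 0 ∧ W p 0 = 0 := by
  constructor
  · rw [hP.eqP p hp, profileP]; simp [invSymbol, critSeq, h0, h0.symm]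
  · rw [hP.eqW p hp, profileW]; simp [invSymbol, critSeq, h0, h0.symm]

/-- Off the critical modes the fixed-point equation is the complement equation multiplied by the
inverse symbol. -/
theorem IsProfile.residual_eq_zero (hν : 0 < ν) (h : SimpleCriticalPair ν K γc ξ₀)
    (hP : IsProfile ν K γc ξ₀ O P W) {p : ℝ × ℝ} (hp : p ∈ O) {ζ : Fin d → ℤ} (h0 : ζ ≠ 0)
    (h1 : ζ ≠ ξ₀) (h2 : ζ ≠ -ξ₀) :
    hjbResidual ν K (γc + p.2) p.1 (P p) (W p) ζ = 0 ∧ fpResidual ν p.1 (P p) (W p) ζ = 0 := by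
  have hD := (h.symbolDet_pos hν h0 h1 h2).ne'
  have hk : freqSq ζ ≠ 0 := by linarith [one_le_freqSq h0]
  have h12 := not_or.2 ⟨h1, h2⟩
  have eP := hP.eqP p hp ζ
  have eW := hP.eqW p hp ζ
  simp only [profileP, profileW, invSymbol, critSeq, if_neg h0, if_neg h12] at eP eW
  rw [hjbResidual, fpResidual]
  set f := p.2 * kernelCoef K ζ * P p ζ - p.1 * quadGrad (W p) (W p) ζ with hf
  set g := p.1 * quadDiv (P p) (W p) ζ with hg
  have e1 : ν * freqSq ζ * W p ζ + p.1 * quadGrad (W p) (W p) ζ -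
      (γc + p.2) * kernelCoef K ζ * P p ζ =
      ν * freqSq ζ * W p ζ - γc * kernelCoef K ζ * P p ζ - f := by rw [hf]; ring
  rw [e1, eP, eW]
  constructor
  · field_simp
    rw [symbolDet]; ring
  · field_simp
    rw [symbolDet]; ring

/-- At the critical modes the fixed-point equation only makes the residual a multiple of `(1, -ν)`;
since the range of the inverse symbol is orthogonal to `(1, -ν)`, it also normalizes the
amplitude. -/
theorem IsProfile.residual_crit (hK : IsKernel K) (h : SimpleCriticalPair ν K γc ξ₀)
    (hP : IsProfile ν K γc ξ₀ O P W) {p : ℝ × ℝ} (hp : p ∈ O) {ζ : Fin d → ℤ}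
    (h12 : ζ = ξ₀ ∨ ζ = -ξ₀) :
    fpResidual ν p.1 (P p) (W p) ζ = -ν * hjbResidual ν K (γc + p.2) p.1 (P p) (W p) ζ ∧
      P p ζ - ν * W p ζ = (1 + ν ^ 2) / 2 := by
  have h0 : ζ ≠ 0 := by
    rcases h12 with rfl | rfl
    · exact h.ne_zero
    · exact neg_ne_zero.2 h.ne_zero
  have hk : freqSq ζ ≠ 0 := by linarith [one_le_freqSq h0]
  have hν1 : (1 + ν ^ 2) ≠ 0 := by positivity
  have hγ : γc * kernelCoef K ζ = -(ν ^ 2 * freqSq ζ) := by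
    rcases h12 with rfl | rfl
    · exact h.symbolDet_eq_zero
    · rw [kernelCoef_neg hK.smooth.continuous, freqSq_neg]; exact h.symbolDet_eq_zero
  have eP := hP.eqP p hp ζ
  have eW := hP.eqW p hp ζ
  simp only [profileP, profileW, invSymbol, critSeq, if_neg h0, if_pos h12] at eP eW
  rw [hjbResidual, fpResidual]
  set f := p.2 * kernelCoef K ζ * P p ζ - p.1 * quadGrad (W p) (W p) ζ with hf
  set g := p.1 * quadDiv (P p) (W p) ζ with hg
  have e1 : ν * freqSq ζ * W p ζ + p.1 * quadGrad (W p) (W p) ζ -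
      (γc + p.2) * kernelCoef K ζ * P p ζ =
      ν * freqSq ζ * W p ζ - (γc * kernelCoef K ζ) * P p ζ - f := by rw [hf]; ring
  rw [e1, hγ, eP, eW]
  constructor
  · field_simp
    ring
  · field_simp
    ring

/-- The reduced bifurcation function divided by the amplitude. -/
def reducedQuotient (ν : ℝ) (K : Space d → ℝ) (γc : ℝ) (ξ₀ : Fin d → ℤ)
    (P W : ℝ × ℝ → (Fin d → ℤ) → ℝ) (p : ℝ × ℝ) : ℝ :=
  hjbResidual ν K (γc + p.2) p.1 (P p) (W p) ξ₀ + hjbResidual ν K (γc + p.2) p.1 (P p) (W p) (-ξ₀)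

/-- The density perturbation (for `P`) or the value function (for `W`) given by the profile. -/
def profileFun (P : ℝ × ℝ → (Fin d → ℤ) → ℝ) (p : ℝ × ℝ) (x : Space d) : ℝ :=
  p.1 * trigSeries true (P p) x

/-- The constant `λ` given by the profile. -/
def profileConst (W : ℝ × ℝ → (Fin d → ℤ) → ℝ) (p : ℝ × ℝ) : ℝ :=
  -(p.1 ^ 2 * quadGrad (W p) (W p) 0)

theorem critPairing_smul_cosMode (h0 : ξ₀ ≠ 0) (r : ℝ) :
    critPairing ν ξ₀ (fun x => r * cosMode ξ₀ x) (fun x => r * (-ν * cosMode ξ₀ x)) = r := by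
  have hne : ξ₀ ≠ -ξ₀ := fun h => h0 (self_eq_neg.1 h)
  have h1 : torusIntegral (fun x => cosMode ξ₀ x * cosMode ξ₀ x) = 1 / 2 := by
    have := trigCoef_true_cosMode ξ₀ ξ₀
    rw [if_pos rfl, if_neg hne, add_zero] at this
    exact this
  have e1 : (fun x => r * cosMode ξ₀ x * cosMode ξ₀ x) =
      fun x => r * (cosMode ξ₀ x * cosMode ξ₀ x) := funext fun x => by ring
  have e2 : (fun x => r * (-ν * cosMode ξ₀ x) * cosMode ξ₀ x) =
      fun x => (r * -ν) * (cosMode ξ₀ x * cosMode ξ₀ x) := funext fun x => by ring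
  rw [critPairing, e1, e2, torusIntegral_const_mul, torusIntegral_const_mul, h1]
  have : (1 + ν ^ 2) ≠ 0 := by positivity
  field_simp
  ring

/-- The profiles yield solutions of the complement equation. -/
theorem IsProfile.solvesComplement (hν : 0 < ν) (hK : IsKernel K)
    (h : SimpleCriticalPair ν K γc ξ₀) (hP : IsProfile ν K γc ξ₀ O P W) {p : ℝ × ℝ} (hp : p ∈ O) :
    SolvesComplement ν K ξ₀ (γc + p.2) p.1 (profileFun P p) (profileFun W p) (profileConst W p) ∧
      reducedValue ν K ξ₀ (γc + p.2) (profileFun P p) (profileFun W p) (profileConst W p) =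
        p.1 * reducedQuotient ν K γc ξ₀ P W p := by
  have d1 := hP.smoothP.decay hp 2
  have d2 := hP.smoothW.decay hp 2
  have z := hP.apply_zero h.ne_zero hp
  have c1 : ContDiff ℝ 2 (trigSeries true (P p)) := d1.contDiff true
  have c2 : ContDiff ℝ 2 (trigSeries true (W p)) := d2.contDiff true
  have r1 := hP.residual_crit hK h hp (Or.inl rfl)
  have r2 := hP.residual_crit hK h hp (Or.inr rfl)
  set r := p.1 * reducedQuotient ν K γc ξ₀ P W p with hr
  have e1 : ∀ x, hjbOp ν K (γc + p.2) (profileFun P p) (profileFun W p) (profileConst W p) x =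
      r * cosMode ξ₀ x := fun x => by
    unfold profileFun
    rw [hjbOp_cosSeries hK d1 d2, cosSeries_eq_of_support h.ne_zero fun ζ h0 h1 h2 =>
      (hP.residual_eq_zero hν h hp h0 h1 h2).1]
    have : hjbResidual ν K (γc + p.2) p.1 (P p) (W p) 0 = p.1 * quadGrad (W p) (W p) 0 := by
      rw [hjbResidual, z.1, z.2]; ring
    rw [this, hr, reducedQuotient, profileConst]
    ring
  have e2 : ∀ x, fpOp ν (profileFun P p) (profileFun W p) x = r * (-ν * cosMode ξ₀ x) := fun x => by
    unfold profileFun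
    rw [fpOp_cosSeries d1 d2, cosSeries_eq_of_support h.ne_zero fun ζ h0 h1 h2 =>
      (hP.residual_eq_zero hν h hp h0 h1 h2).2]
    have : fpResidual ν p.1 (P p) (W p) 0 = 0 := by
      rw [fpResidual, z.1, z.2, quadDiv_zero]; ring
    rw [this, r1.1, r2.1, hr, reducedQuotient]
    ring
  have er : reducedValue ν K ξ₀ (γc + p.2) (profileFun P p) (profileFun W p) (profileConst W p) =
      r := by
    rw [reducedValue, funext e1, funext e2, critPairing_smul_cosMode h.ne_zero]
  have hcos : ∀ {S : (Fin d → ℤ) → ℝ}, Decay 2 S →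
      torusIntegral (fun x => p.1 * trigSeries true S x * cosMode ξ₀ x) =
        p.1 * ((S ξ₀ + S (-ξ₀)) / 2) := fun {S} hS => by
    rw [← trigCoef_cosSeries hS.summable_abs ξ₀, trigCoef, ← torusIntegral_const_mul]
    congr 1; funext x; simp only [trigMode]; ring
  refine ⟨⟨contDiff_const.mul c1, contDiff_const.mul c2, fun n x => ?_, fun n x => ?_, ?_, ?_, ?_,
    ?_,
    fun x => by rw [er, e1], fun x => by rw [er, e2]⟩, er⟩
  · simp only [profileFun, periodic_trigSeries true (P p) n x]
  · simp only [profileFun, periodic_trigSeries true (W p) n x]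
  · unfold profileFun
    rw [torusIntegral_const_mul, torusIntegral_cosSeries d1.summable_abs, z.1, mul_zero]
  · unfold profileFun
    rw [torusIntegral_const_mul, torusIntegral_cosSeries d2.summable_abs, z.2, mul_zero]
  · have := trigCoef_false_even (f := profileFun P p)
      (fun n x => by simp only [profileFun, periodic_trigSeries true (P p) n x])
      (fun x => by simp only [profileFun, cosSeries_neg]) ξ₀
    exact this
  · unfold profileFun
    rw [critPairing, hcos d1, hcos d2]
    have hν1 : (1 + ν ^ 2) ≠ 0 := by positivity
    have e3 : p.1 * ((P p ξ₀ + P p (-ξ₀)) / 2) - ν * (p.1 * ((W p ξ₀ + W p (-ξ₀)) / 2)) =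
        p.1 * (((P p ξ₀ - ν * W p ξ₀) + (P p (-ξ₀) - ν * W p (-ξ₀))) / 2) := by ring
    rw [e3, r1.2, r2.2]
    field_simp
    ring

end Profile

/-! ### Smooth dependence and Sobolev estimates -/

section Family

variable {O : Set (ℝ × ℝ)} {P : ℝ × ℝ → (Fin d → ℤ) → ℝ}

theorem SmoothFamily.contDiffOn_apply (hP : SmoothFamily O P) (ζ : Fin d → ℤ) :
    ContDiffOn ℝ ∞ (fun p => P p ζ) O := by
  obtain ⟨a, ha, hae⟩ := hP 0
  refine ((coord ζ).contDiff.comp_contDiffOn ha).congr fun p hp => ?_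
  rw [Function.comp_apply, coord_apply, hae p hp, pow_zero, one_mul]

theorem SmoothFamily.contDiffOn_quadGrad (hP : SmoothFamily O P) (ζ : Fin d → ℤ) :
    ContDiffOn ℝ ∞ (fun p => quadGrad (P p) (P p) ζ) O := by
  obtain ⟨a, ha, hae⟩ := hP 1
  obtain ⟨B, hB⟩ := exists_gradOp (d := d) 0 (w := fun _ => 1) (C := 1) fun ζ => by simp
  have h1 : ContDiffOn ℝ ∞ (fun p => B (a p) (a p)) O :=
    (B.contDiff.comp_contDiffOn ha).clm_apply ha
  refine ((coord ζ).contDiff.comp_contDiffOn h1).congr fun p hp => ?_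
  rw [Function.comp_apply, coord_apply, hB, one_mul, wt_eq 1 (a p) (hae p hp)]

/-- Evaluation at `x` of the cosine series of a weighted sequence is a functional which is of class
`C^N` in `x` once the weight is strong enough. -/
theorem exists_contDiff_weightedEval (N : ℕ) : ∃ E : Space d → Seq d →L[ℝ] ℝ, ContDiff ℝ N E ∧
    ∀ (a : Seq d) (Q : (Fin d → ℤ) → ℝ), (∀ ζ, a ζ = rho ζ ^ (2 * d + N) * Q ζ) →
      ∀ x, E x a = trigSeries true Q x := by
  set T : (Fin d → ℤ) → Seq d →L[ℝ] ℝ := fun ξ => (rho ξ ^ (2 * d + N))⁻¹ • coord ξ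
  have hT : ∀ ξ, ‖T ξ‖ ≤ (rho ξ ^ (2 * d + N))⁻¹ := fun ξ => by
    have h1 := inv_pos.2 (pow_pos (rho_pos ξ) (2 * d + N))
    rw [norm_smul, Real.norm_eq_abs, abs_of_pos h1]
    exact mul_le_of_le_one_right h1.le (norm_coord_le ξ)
  have hb : ∀ (k : ℕ) (ξ : Fin d → ℤ) (x : Space d), (k : ℕ∞) ≤ N →
      ‖iteratedFDeriv ℝ k (fun y => cosMode ξ y • T ξ) x‖ ≤
        (2 * Real.pi) ^ k * (rho ξ ^ (2 * d))⁻¹ := by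
    intro k ξ x hk
    have e : (fun y => cosMode ξ y • T ξ) =
        (ContinuousLinearMap.toSpanSingleton ℝ (T ξ)) ∘ trigMode true ξ := by
      funext y; simp [trigMode]
    have h1 := ContinuousLinearMap.norm_iteratedFDeriv_comp_left
      (ContinuousLinearMap.toSpanSingleton ℝ (T ξ)) (x := x)
      (contDiff_trigMode (n := k) true ξ).contDiffAt (le_refl (k : ℕ∞ω))
    rw [← e, ContinuousLinearMap.norm_toSpanSingleton] at h1
    have hkN : k ≤ N := by exact_mod_cast hk
    have hρ := rho_pos ξ
    have h2 := norm_iteratedFDeriv_trigMode_le true ξ k x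
    calc _ ≤ ‖T ξ‖ * ‖iteratedFDeriv ℝ k (trigMode true ξ) x‖ := h1
      _ ≤ (rho ξ ^ (2 * d + N))⁻¹ * ((2 * Real.pi) ^ k * rho ξ ^ N) := by
          refine mul_le_mul (hT ξ) (h2.trans ?_) (norm_nonneg _) (by positivity)
          gcongr
          exact one_le_rho ξ
      _ = _ := by rw [pow_add]; field_simp
  refine ⟨fun x => ∑' ξ, cosMode ξ x • T ξ, ?_, fun a Q ha x => ?_⟩
  · exact contDiff_tsum (v := fun k ξ => (2 * Real.pi) ^ k * (rho ξ ^ (2 * d))⁻¹)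
      (fun ξ => (contDiff_trigMode true ξ).smul contDiff_const)
      (fun k _ => summable_rho_inv.mul_left _) fun k ξ x hk => hb k ξ x hk
  · have hs : Summable fun ξ => cosMode ξ x • T ξ := by
      refine Summable.of_norm_bounded summable_rho_inv fun ξ => ?_
      simpa using hb 0 ξ x (by simp)
    have h1 := (ContinuousLinearMap.apply ℝ ℝ a).map_tsum hs
    simp only [ContinuousLinearMap.apply_apply] at h1
    rw [h1, trigSeries]
    refine tsum_congr fun ξ => ?_
    have h2 := (pow_pos (rho_pos ξ) (2 * d + N)).ne'
    simp only [_root_.smul_apply, T, coord_apply, ha, smul_eq_mul,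
      inv_mul_cancel_left₀ h2, trigMode]
    ring

/-- The functions given by a smooth family are jointly smooth in the parameters and in `x`. -/
theorem SmoothFamily.contDiffOn_profileFun (hP : SmoothFamily O P) :
    ContDiffOn ℝ ∞ (fun q : (ℝ × ℝ) × Space d => profileFun P q.1 q.2) (O ×ˢ univ) := by
  refine contDiffOn_infty.2 fun N => ?_
  obtain ⟨E, hE, hEe⟩ := exists_contDiff_weightedEval (d := d) N
  obtain ⟨a, ha, hae⟩ := hP (2 * d + N)
  have h1 : ContDiffOn ℝ N (fun q : (ℝ × ℝ) × Space d => E q.2 (a q.1)) (O ×ˢ univ) :=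
    ((hE.comp contDiff_snd).contDiffOn).clm_apply
      ((ha.of_le (by exact_mod_cast le_top)).comp contDiff_fst.contDiffOn fun q hq => hq.1)
  have h2 : ContDiffOn ℝ N (fun q : (ℝ × ℝ) × Space d => q.1.1) (O ×ˢ univ) :=
    (contDiff_fst.comp contDiff_fst).contDiffOn
  refine (h2.mul h1).congr fun q hq => ?_
  rw [profileFun, hEe (a q.1) (P q.1) (hae q.1 hq.1)]

/-- Near zero the family is bounded and Lipschitz at zero in every weighted space. -/
theorem SmoothFamily.exists_eventually_tsum_le (hP : SmoothFamily O P) (hO : O ∈ 𝓝 (0 : ℝ × ℝ))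
    (n : ℕ) : ∃ C ≥ 0, ∀ᶠ p in 𝓝 (0 : ℝ × ℝ), ∑' ξ, rho ξ ^ n * |P p ξ| ≤ C ∧
      ∑' ξ, rho ξ ^ n * |P p ξ - P 0 ξ| ≤ C * ‖p‖ := by
  obtain ⟨a, ha, hae⟩ := hP n
  have hda : DifferentiableAt ℝ a 0 := (ha.contDiffAt hO).differentiableAt (by simp)
  obtain ⟨C, hC⟩ := hda.hasFDerivAt.isBigO_sub.bound
  have hcont := hda.continuousAt.norm.eventually (gt_mem_nhds (lt_add_one ‖a 0‖))
  refine ⟨max C (‖a 0‖ + 1), le_max_of_le_right (by positivity), ?_⟩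
  filter_upwards [hC, hcont, hO] with p h1 h2 h3
  have h0 : (0 : ℝ × ℝ) ∈ O := mem_of_mem_nhds hO
  have e1 : ∑' ξ, rho ξ ^ n * |P p ξ| = ‖a p‖ := by
    rw [norm_seq_eq]
    exact tsum_congr fun ξ => by rw [hae p h3, abs_mul, abs_of_pos (pow_pos (rho_pos ξ) n)]
  have e2 : ∑' ξ, rho ξ ^ n * |P p ξ - P 0 ξ| = ‖a p - a 0‖ := by
    rw [norm_seq_eq]
    refine tsum_congr fun ξ => ?_
    rw [lp.coeFn_sub, Pi.sub_apply, hae p h3, hae 0 h0, ← mul_sub, abs_mul,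
      abs_of_pos (pow_pos (rho_pos ξ) n)]
  rw [e1, e2]
  refine ⟨h2.le.trans (le_max_right _ _), h1.trans ?_⟩
  rw [sub_zero]
  exact mul_le_mul_of_nonneg_right (le_max_left _ _) (norm_nonneg _)

theorem tendsto_abs_fst_mul (C : ℝ) :
    Tendsto (fun p : ℝ × ℝ => |p.1| * C) (𝓝 0) (𝓝 0) := by
  have : Continuous fun p : ℝ × ℝ => |p.1| * C := by fun_prop
  simpa using this.tendsto 0

theorem SmoothFamily.eventually_c2Small (hP : SmoothFamily O P) (hO : O ∈ 𝓝 (0 : ℝ × ℝ))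
    {ε : ℝ} (hε : 0 < ε) : ∀ᶠ p in 𝓝 (0 : ℝ × ℝ), C2Small ε (profileFun P p) := by
  obtain ⟨C, hC0, hC⟩ := hP.exists_eventually_tsum_le hO 2
  have hlim := (tendsto_abs_fst_mul ((2 * Real.pi) ^ 2 * C)).eventually (gt_mem_nhds hε)
  filter_upwards [hC, hlim, hO] with p h1 h2 h3
  intro k hk x
  have hd := hP.decay h3 2
  have hc : ContDiffAt ℝ k (trigSeries true (P p)) x :=
    ((hd.contDiff true).of_le (by exact_mod_cast hk)).contDiffAt
  have e : profileFun P p = p.1 • trigSeries true (P p) := rfl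
  have hpi : 1 ≤ 2 * Real.pi := by linarith [Real.pi_gt_three]
  rw [e, iteratedFDeriv_const_smul_apply hc, norm_smul, Real.norm_eq_abs]
  refine lt_of_le_of_lt (mul_le_mul_of_nonneg_left ?_ (abs_nonneg _)) h2
  refine (hd.norm_iteratedFDeriv_le true hk x).trans ?_
  exact mul_le_mul (pow_le_pow_right₀ hpi hk) h1.1
    (tsum_nonneg fun ξ => mul_nonneg (pow_pos (rho_pos ξ) 2).le (abs_nonneg _)) (by positivity)

theorem fourierCoef_cosSeries {Q : (Fin d → ℤ) → ℝ} (h : Summable fun ξ => |Q ξ|)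
    (ξ : Fin d → ℤ) : ‖fourierCoef (trigSeries true Q) ξ‖ = |(Q ξ + Q (-ξ)) / 2| := by
  have h0 : Decay 0 Q := by simpa [Decay] using h
  have hc : Continuous (trigSeries true Q) := (h0.contDiff true).continuous
  rw [fourierCoef_eq hc, trigCoef_false_even (periodic_trigSeries true Q) (cosSeries_neg Q),
    trigCoef_cosSeries h, Complex.ofReal_zero, zero_mul, sub_zero, Complex.norm_real,
    Real.norm_eq_abs]

/-- The `H^s` norm of a cosine series is dominated by the weighted `ℓ¹` norms of its
coefficients. -/
theorem sobolevNorm_cosSeries_le {Q : (Fin d → ℤ) → ℝ} {n : ℕ} (hQ : Decay n Q) {s : ℝ}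
    (hs : s ≤ n) : sobolevNorm s (trigSeries true Q) ≤
      ENNReal.ofReal ((2 * Real.pi) ^ n * ∑' ξ, rho ξ ^ n * |Q ξ|) := by
  set u : (Fin d → ℤ) → ℝ := fun ξ => rho ξ ^ n * |Q ξ|
  have hu0 : ∀ ξ, 0 ≤ u ξ := fun ξ => mul_nonneg (pow_pos (rho_pos ξ) n).le (abs_nonneg _)
  have hu : Summable u := hQ
  have hun : Summable fun ξ => u (-ξ) := (Equiv.neg (Fin d → ℤ)).summable_iff.2 hu
  set t : (Fin d → ℤ) → ℝ := fun ξ => (2 * Real.pi) ^ n * ((u ξ + u (-ξ)) / 2)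
  have ht0 : ∀ ξ, 0 ≤ t ξ := fun ξ => by
    have := hu0 ξ; have := hu0 (-ξ); have := Real.pi_pos; positivity
  have ht : Summable t := ((hu.add hun).div_const 2).mul_left _
  have hsum : ∑' ξ, t ξ = (2 * Real.pi) ^ n * ∑' ξ, u ξ := by
    have h2 : ∑' ξ, u (-ξ) = ∑' ξ, u ξ := (Equiv.neg (Fin d → ℤ)).tsum_eq u
    rw [tsum_mul_left, tsum_div_const, hu.tsum_add hun, h2, add_self_div_two]
  have hterm : ∀ ξ, (1 + (2 * Real.pi * ‖latt ξ‖) ^ 2) ^ s *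
      ‖fourierCoef (trigSeries true Q) ξ‖ ^ 2 ≤ t ξ * t ξ := by
    intro ξ
    have hpi : 1 ≤ 2 * Real.pi := by linarith [Real.pi_gt_three]
    have hn := norm_nonneg (latt ξ)
    have b1 : 1 ≤ 1 + (2 * Real.pi * ‖latt ξ‖) ^ 2 := by
      nlinarith [sq_nonneg (2 * Real.pi * ‖latt ξ‖)]
    have b2 : 1 + (2 * Real.pi * ‖latt ξ‖) ^ 2 ≤ (2 * Real.pi * rho ξ) ^ 2 := by
      have : 2 * Real.pi * rho ξ = 2 * Real.pi + 2 * Real.pi * ‖latt ξ‖ := by rw [rho]; ring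
      rw [this]
      nlinarith [mul_nonneg (zero_le_one.trans hpi) (mul_nonneg (zero_le_one.trans hpi) hn)]
    have b3 : (1 + (2 * Real.pi * ‖latt ξ‖) ^ 2) ^ s ≤ ((2 * Real.pi) ^ n * rho ξ ^ n) ^ 2 := by
      calc (1 + (2 * Real.pi * ‖latt ξ‖) ^ 2) ^ s
          ≤ (1 + (2 * Real.pi * ‖latt ξ‖) ^ 2) ^ (n : ℝ) := Real.rpow_le_rpow_of_exponent_le b1 hs
        _ = (1 + (2 * Real.pi * ‖latt ξ‖) ^ 2) ^ n := Real.rpow_natCast _ _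
        _ ≤ ((2 * Real.pi * rho ξ) ^ 2) ^ n := pow_le_pow_left₀ (by positivity) b2 n
        _ = _ := by rw [← mul_pow, ← pow_mul, ← pow_mul, mul_comm 2 n]
    have b4 : (2 * Real.pi) ^ n * rho ξ ^ n * |(Q ξ + Q (-ξ)) / 2| ≤ t ξ := by
      have h1 : |(Q ξ + Q (-ξ)) / 2| ≤ (|Q ξ| + |Q (-ξ)|) / 2 := by
        rw [abs_div, abs_two]
        exact div_le_div_of_nonneg_right (abs_add_le _ _) zero_le_two
      have h2 : 0 ≤ (2 * Real.pi) ^ n * rho ξ ^ n := by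
        have := rho_pos ξ; have := Real.pi_pos; positivity
      refine (mul_le_mul_of_nonneg_left h1 h2).trans (le_of_eq ?_)
      simp only [t, u, rho_neg]; ring
    rw [fourierCoef_cosSeries hQ.summable_abs, ← pow_two (t ξ)]
    calc _ ≤ ((2 * Real.pi) ^ n * rho ξ ^ n) ^ 2 * |(Q ξ + Q (-ξ)) / 2| ^ 2 :=
          mul_le_mul_of_nonneg_right b3 (sq_nonneg _)
      _ = ((2 * Real.pi) ^ n * rho ξ ^ n * |(Q ξ + Q (-ξ)) / 2|) ^ 2 := (mul_pow _ _ 2).symm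
      _ ≤ t ξ ^ 2 := pow_le_pow_left₀ (by
          have := rho_pos ξ; have := Real.pi_pos; positivity) b4 2
  have hfinal : ∑' ξ, ENNReal.ofReal ((1 + (2 * Real.pi * ‖latt ξ‖) ^ 2) ^ s *
      ‖fourierCoef (trigSeries true Q) ξ‖ ^ 2) ≤ (∑' ξ, ENNReal.ofReal (t ξ)) ^ (2 : ℝ) := by
    rw [ENNReal.rpow_two, pow_two, ← ENNReal.tsum_mul_right]
    refine ENNReal.tsum_le_tsum fun ξ => ?_
    refine (ENNReal.ofReal_le_ofReal (hterm ξ)).trans ?_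
    rw [ENNReal.ofReal_mul (ht0 ξ)]
    exact mul_le_mul_right (ENNReal.le_tsum ξ) _
  rw [sobolevNorm, ← hsum, ENNReal.ofReal_tsum_of_nonneg ht0 ht]
  refine (ENNReal.rpow_le_rpow hfinal (by norm_num)).trans (le_of_eq ?_)
  rw [← ENNReal.rpow_mul]
  norm_num

theorem sobolevNorm_smul_cosSeries_le {Q : (Fin d → ℤ) → ℝ} {n : ℕ} (hQ : Decay n Q) {s : ℝ}
    (hs : s ≤ n) (c : ℝ) : sobolevNorm s (fun x => c * trigSeries true Q x) ≤
      ENNReal.ofReal ((2 * Real.pi) ^ n * (|c| * ∑' ξ, rho ξ ^ n * |Q ξ|)) := by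
  have h1 : Decay n fun ξ => c * Q ξ := hQ.mul_bounded fun _ => le_rfl
  rw [← trigSeries_const_mul_fun]
  refine (sobolevNorm_cosSeries_le h1 hs).trans (le_of_eq ?_)
  rw [← tsum_mul_left (a := |c|)]
  congr 2
  exact tsum_congr fun ξ => by rw [abs_mul]; ring

theorem SmoothFamily.exists_sobolevNorm_le (hP : SmoothFamily O P) (hO : O ∈ 𝓝 (0 : ℝ × ℝ))
    (s : ℝ) : ∃ C, ∀ᶠ p in 𝓝 (0 : ℝ × ℝ), sobolevNorm s (profileFun P p) ≤
      ENNReal.ofReal (C * |p.1|) ∧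
      sobolevNorm s (fun x => profileFun P p x - p.1 * trigSeries true (P 0) x) ≤
        ENNReal.ofReal (C * (|p.1| * ‖p‖)) := by
  obtain ⟨n, hn⟩ := exists_nat_ge s
  obtain ⟨C, hC0, hC⟩ := hP.exists_eventually_tsum_le hO n
  refine ⟨(2 * Real.pi) ^ n * C, ?_⟩
  filter_upwards [hC, hO] with p h1 h2
  have hd := hP.decay h2 n
  have h0 := hP.decay (mem_of_mem_nhds hO) n
  have hpi := Real.pi_pos
  constructor
  · refine (sobolevNorm_smul_cosSeries_le hd hn p.1).trans (ENNReal.ofReal_le_ofReal ?_)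
    calc _ ≤ (2 * Real.pi) ^ n * (|p.1| * C) := by gcongr; exact h1.1
      _ = _ := by ring
  · have hs : Decay n fun ξ => P p ξ - P 0 ξ := by
      refine Summable.of_nonneg_of_le
        (fun ξ => mul_nonneg (pow_pos (rho_pos ξ) n).le (abs_nonneg _)) (fun ξ => ?_) (hd.add h0)
      rw [← mul_add]
      exact mul_le_mul_of_nonneg_left (abs_sub _ _) (pow_pos (rho_pos ξ) n).le
    have e : (fun x => profileFun P p x - p.1 * trigSeries true (P 0) x) =
        fun x => p.1 * trigSeries true (fun ξ => P p ξ - P 0 ξ) x := by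
      funext x
      have h3 := trigSeries_add true (P := fun ξ => P p ξ - P 0 ξ) (Q := P 0)
        hs.summable_abs h0.summable_abs x
      simp only [sub_add_cancel] at h3
      rw [profileFun, h3]
      ring
    rw [e]
    refine (sobolevNorm_smul_cosSeries_le hs hn p.1).trans (ENNReal.ofReal_le_ofReal ?_)
    calc _ ≤ (2 * Real.pi) ^ n * (|p.1| * (C * ‖p‖)) := by gcongr; exact h1.2
      _ = _ := by ring

end Family

section Profile

variable {ν : ℝ} {K : Space d → ℝ} {γc : ℝ} {ξ₀ : Fin d → ℤ} {O : Set (ℝ × ℝ)}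
  {P W : ℝ × ℝ → (Fin d → ℤ) → ℝ}

theorem IsProfile.mem_nhds (hP : IsProfile ν K γc ξ₀ O P W) : O ∈ 𝓝 (0 : ℝ × ℝ) :=
  hP.isOpen.mem_nhds hP.zero_mem

theorem IsProfile.cosSeries_zero (h0 : ξ₀ ≠ 0) (hP : IsProfile ν K γc ξ₀ O P W) :
    trigSeries true (P 0) = cosMode ξ₀ := by
  have hP0 : P 0 = critSeq ξ₀ := funext fun ζ => by
    rw [hP.eqP 0 hP.zero_mem, profileP]; simp
  funext x
  rw [hP0, cosSeries_eq_of_support h0 (S := critSeq ξ₀)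
    fun ζ _ h1 h2 => if_neg (not_or.2 ⟨h1, h2⟩)]
  have : critSeq ξ₀ 0 = 0 := if_neg (by
    rintro (h | h)
    · exact h0 h.symm
    · exact h0 (neg_eq_zero.1 h.symm))
  rw [this]
  simp only [critSeq, true_or, or_true, if_true]
  ring

theorem IsProfile.contDiffOn_reducedQuotient (hP : IsProfile ν K γc ξ₀ O P W) :
    ContDiffOn ℝ ∞ (reducedQuotient ν K γc ξ₀ P W) O := by
  have f1 : ContDiffOn ℝ ∞ (fun p : ℝ × ℝ => p.1) O := contDiff_fst.contDiffOn
  have f2 : ContDiffOn ℝ ∞ (fun p : ℝ × ℝ => p.2) O := contDiff_snd.contDiffOn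
  have key : ∀ ζ, ContDiffOn ℝ ∞
      (fun p => hjbResidual ν K (γc + p.2) p.1 (P p) (W p) ζ) O := fun ζ =>
    ((contDiffOn_const.mul (hP.smoothW.contDiffOn_apply ζ)).add
      (f1.mul (hP.smoothW.contDiffOn_quadGrad ζ))).sub
      (((contDiffOn_const.add f2).mul contDiffOn_const).mul (hP.smoothP.contDiffOn_apply ζ))
  exact (key ξ₀).add (key (-ξ₀))

theorem IsProfile.contDiffOn_profileConst (hP : IsProfile ν K γc ξ₀ O P W) :
    ContDiffOn ℝ ∞ (profileConst W) O := by
  have f1 : ContDiffOn ℝ ∞ (fun p : ℝ × ℝ => p.1) O := contDiff_fst.contDiffOn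
  exact ((f1.pow 2).mul (hP.smoothW.contDiffOn_quadGrad 0)).neg

theorem IsProfile.tendsto_profileConst (hP : IsProfile ν K γc ξ₀ O P W) :
    Tendsto (profileConst W) (𝓝 0) (𝓝 0) := by
  have h1 := (hP.contDiffOn_profileConst.continuousOn.continuousAt hP.mem_nhds).tendsto
  simpa [profileConst] using h1

theorem IsProfile.eventually_nearUniform (hP : IsProfile ν K γc ξ₀ O P W) {ε : ℝ} (hε : 0 < ε) :
    ∀ᶠ p in 𝓝 (0 : ℝ × ℝ),
      NearUniform ε (profileFun W p) (fun x => 1 + profileFun P p x) (profileConst W p) := by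
  have h3 := hP.tendsto_profileConst.abs.eventually (gt_mem_nhds (by simpa using hε))
  filter_upwards [hP.smoothP.eventually_c2Small hP.mem_nhds hε,
    hP.smoothW.eventually_c2Small hP.mem_nhds hε, h3] with p h1 h2 h3
  refine ⟨h2, ?_, h3⟩
  simpa only [add_sub_cancel_left] using h1

end Profile

/-! ### Zeros of an even scalar function with a nondegenerate quadratic part -/

section Pitchfork

variable {G : ℝ × ℝ → ℝ} {O : Set (ℝ × ℝ)}

/-- The derivative in the first variable. -/
def dfst (G : ℝ × ℝ → ℝ) (p : ℝ × ℝ) : ℝ := fderiv ℝ G p (1, 0)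

theorem contDiffOn_dfst (hO : IsOpen O) (hG : ContDiffOn ℝ ∞ G O) : ContDiffOn ℝ ∞ (dfst G) O :=
  (hG.fderiv_of_isOpen hO (m := ∞) (by simp)).clm_apply contDiffOn_const

theorem hasDerivAt_dfst (hO : IsOpen O) (hG : ContDiffOn ℝ ∞ G O) {a t : ℝ} (h : (a, t) ∈ O) :
    HasDerivAt (fun b => G (b, t)) (dfst G (a, t)) a := by
  have h1 : HasFDerivAt G (fderiv ℝ G (a, t)) (a, t) :=
    ((hG.contDiffAt (hO.mem_nhds h)).differentiableAt (by simp)).hasFDerivAt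
  have h2 : HasDerivAt (fun b : ℝ => (b, t)) ((1 : ℝ), (0 : ℝ)) a :=
    (hasDerivAt_id a).prodMk (hasDerivAt_const a t)
  exact h1.comp_hasDerivAt a h2

theorem mem_ball_zero_prod {r a t : ℝ} :
    (a, t) ∈ Metric.ball (0 : ℝ × ℝ) r ↔ |a| < r ∧ |t| < r := by
  rw [mem_ball_zero_iff, Prod.norm_def, max_lt_iff]; rfl

theorem eventually_abs_lt {r : ℝ} (hr : 0 < r) : ∀ᶠ b : ℝ in 𝓝 0, |b| < r :=
  continuous_abs.continuousAt.eventually (gt_mem_nhds (by simpa using hr))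

/-- Division of the cubic equation by the amplitude. -/
theorem abs_sub_quadratic_le {r α β C : ℝ} (hG : ContinuousOn G (Metric.ball 0 r))
    (hcub : ∀ p ∈ Metric.ball (0 : ℝ × ℝ) r, |p.1 * G p - (α * p.2 * p.1 - β * p.1 ^ 3)| ≤
      C * (|p.2| ^ 2 * |p.1| + |p.2| * |p.1| ^ 3 + |p.1| ^ 5)) {a t : ℝ} (ha : |a| < r)
    (ht : |t| < r) :
    |G (a, t) - (α * t - β * a ^ 2)| ≤ C * (t ^ 2 + |t| * a ^ 2 + a ^ 4) := by
  have key : ∀ b, b ≠ 0 → |b| < r →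
      |G (b, t) - (α * t - β * b ^ 2)| ≤ C * (t ^ 2 + |t| * b ^ 2 + b ^ 4) := by
    intro b hb hbr
    have h1 := hcub (b, t) (mem_ball_zero_prod.2 ⟨hbr, ht⟩)
    have hb0 := abs_pos.2 hb
    have e1 : b * G (b, t) - (α * t * b - β * b ^ 3) = b * (G (b, t) - (α * t - β * b ^ 2)) := by
      ring
    have e2 : C * (|t| ^ 2 * |b| + |t| * |b| ^ 3 + |b| ^ 5) =
        |b| * (C * (|t| ^ 2 + |t| * |b| ^ 2 + (|b| ^ 2) ^ 2)) := by ring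
    change |b * G (b, t) - (α * t * b - β * b ^ 3)| ≤ _ at h1
    rw [e1, abs_mul] at h1
    have h2 := le_of_mul_le_mul_left (h1.trans_eq e2) hb0
    rw [sq_abs, sq_abs, ← pow_mul] at h2
    exact h2
  by_cases h0 : a = 0
  · subst h0
    have hr : 0 < r := lt_of_le_of_lt (abs_nonneg _) ht
    have hc : ContinuousAt (fun b => G (b, t)) 0 :=
      ContinuousAt.comp (f := fun b : ℝ => (b, t))
        (hG.continuousAt (Metric.isOpen_ball.mem_nhds (mem_ball_zero_prod.2 ⟨ha, ht⟩)))
        (by fun_prop)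
    have h1 : ContinuousAt (fun b => |G (b, t) - (α * t - β * b ^ 2)|) 0 :=
      (hc.sub (by fun_prop)).abs
    have h2 : ContinuousAt (fun b : ℝ => C * (t ^ 2 + |t| * b ^ 2 + b ^ 4)) 0 := by fun_prop
    refine le_of_tendsto_of_tendsto (h1.tendsto.mono_left (nhdsWithin_le_nhds (s := {0}ᶜ)))
      (h2.tendsto.mono_left nhdsWithin_le_nhds) ?_
    have h3 : ∀ᶠ b : ℝ in 𝓝 0, |b| < r := eventually_abs_lt hr
    filter_upwards [self_mem_nhdsWithin, nhdsWithin_le_nhds h3] with b hb hbr using key b hb hbr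
  · exact key a h0 ha

/-- The second derivative at the origin does not vanish. -/
theorem dfst_dfst_ne_zero (hO : IsOpen O) (h0 : (0 : ℝ × ℝ) ∈ O) (hG : ContDiffOn ℝ ∞ G O)
    (hD : dfst G 0 = 0) {r β C : ℝ} (hr : 0 < r) (hβ : 0 < β)
    (hq : ∀ a, |a| < r → |G (a, 0) + β * a ^ 2| ≤ C * a ^ 4) : dfst (dfst G) 0 ≠ 0 := by
  intro hDD
  have h1 := hasDerivAt_dfst hO (contDiffOn_dfst hO hG) (a := 0) (t := 0) h0
  change HasDerivAt (fun b => dfst G (b, 0)) (dfst (dfst G) 0) 0 at h1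
  rw [hDD, hasDerivAt_iff_isLittleO] at h1
  have h2 := h1.def (half_pos hβ)
  have h3 : ∀ᶠ b : ℝ in 𝓝 0, (b, (0 : ℝ)) ∈ O :=
    (Continuous.tendsto (f := fun b : ℝ => (b, (0 : ℝ))) (by fun_prop) 0).eventually
      (hO.mem_nhds h0)
  obtain ⟨ρ, hρ, hb⟩ := Metric.eventually_nhds_iff_ball.1 (h2.and h3)
  have hlim : Tendsto (fun a : ℝ => C * a ^ 2) (𝓝[>] 0) (𝓝 0) := by
    have : Continuous fun a : ℝ => C * a ^ 2 := by fun_prop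
    simpa using (this.tendsto 0).mono_left nhdsWithin_le_nhds
  have hsmall : ∀ᶠ a : ℝ in 𝓝[>] 0, a < min ρ r := nhdsWithin_le_nhds (gt_mem_nhds (lt_min hρ hr))
  obtain ⟨a, ⟨ha1, ha2⟩, ha0⟩ := ((hlim.eventually (gt_mem_nhds (half_pos hβ))).and
    hsmall |>.and self_mem_nhdsWithin).exists
  have ha0 : 0 < a := ha0
  have hin : ∀ b ∈ Icc 0 a, b ∈ Metric.ball (0 : ℝ) ρ := fun b hb => by
    rw [mem_ball_zero_iff, Real.norm_eq_abs, abs_of_nonneg hb.1]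
    exact lt_of_le_of_lt hb.2 (ha2.trans_le (min_le_left _ _))
  have hder : ∀ b ∈ Icc 0 a, HasDerivAt (fun b => G (b, 0)) (dfst G (b, 0)) b := fun b hb' =>
    hasDerivAt_dfst hO hG (hb b (hin b hb')).2
  obtain ⟨c, hc, hce⟩ := exists_hasDerivAt_eq_slope (fun b => G (b, 0)) (fun b => dfst G (b, 0)) ha0
    (fun b hb' => (hder b hb').continuousAt.continuousWithinAt)
    fun b hb' => hder b (Ioo_subset_Icc_self hb')
  have h4 := (hb c (hin c (Ioo_subset_Icc_self hc))).1
  change dfst G (0, 0) = 0 at hD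
  simp only [hD, sub_zero, smul_zero, Real.norm_eq_abs, hce, abs_of_pos hc.1] at h4
  have hG0 : G (0, 0) = 0 := by
    have := hq 0 (by simpa using hr)
    simpa using this
  rw [hG0, sub_zero, abs_div, abs_of_pos ha0, div_le_iff₀ ha0] at h4
  have h5 := abs_le.1 (hq a (by rw [abs_of_pos ha0]; exact ha2.trans_le (min_le_right _ _)))
  have h6 := abs_le.1 h4
  have h7 : c * a < a * a := mul_lt_mul_of_pos_right hc.2 ha0
  have h8 : C * a ^ 4 < β / 2 * a ^ 2 := by
    have : 0 < a ^ 2 := by positivity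
    nlinarith
  nlinarith

theorem isInvertible_of_apply_one_ne_zero {L : ℝ →L[ℝ] ℝ} (h : L 1 ≠ 0) : L.IsInvertible :=
  ⟨ContinuousLinearEquiv.unitsEquivAut ℝ (Units.mk0 (L 1) h), by ext; simp⟩

/-- An even function `G(·, t)` of the form `α t - β a² + …` has for small `t > 0` exactly one small
positive zero `A t`, and none for `t ≤ 0`. Two positive zeros, or a degenerate one, would produce by
Rolle's theorem a zero of the second derivative, which is close to `-2β`. -/
theorem exists_pitchfork (hO : IsOpen O) (h0 : (0 : ℝ × ℝ) ∈ O) (hG : ContDiffOn ℝ ∞ G O)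
    {α β C : ℝ} (hα : 0 < α) (hβ : 0 < β)
    (heven : ∀ᶠ p in 𝓝 (0 : ℝ × ℝ), G (-p.1, p.2) = G p)
    (hcub : ∀ᶠ p in 𝓝 (0 : ℝ × ℝ), |p.1 * G p - (α * p.2 * p.1 - β * p.1 ^ 3)| ≤
      C * (|p.2| ^ 2 * |p.1| + |p.2| * |p.1| ^ 3 + |p.1| ^ 5)) :
    ∃ r > 0, ∃ δ > 0, ∃ A : ℝ → ℝ, ∃ M,
      (∀ t ∈ Ioo 0 δ, 0 < A t ∧ A t < r ∧ ∀ a, 0 < a → a < r → (G (a, t) = 0 ↔ a = A t)) ∧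
      (∀ t ∈ Ioc (-δ) 0, ∀ a, 0 < a → a < r → G (a, t) ≠ 0) ∧
      ContDiffOn ℝ ∞ A (Ioo 0 δ) ∧ (∀ t ∈ Ioo 0 δ, A t ^ 2 ≤ M * t) ∧
      (fun t => A t - √(α / β) * √t) =O[𝓝[>] 0] fun t => t := by
  obtain ⟨r₀, hr₀, hball⟩ := Metric.eventually_nhds_iff_ball.1
    ((heven.and hcub).and (hO.mem_nhds h0))
  have hq : ∀ {a t : ℝ}, |a| < r₀ → |t| < r₀ →
      |G (a, t) - (α * t - β * a ^ 2)| ≤ C * (t ^ 2 + |t| * a ^ 2 + a ^ 4) := fun ha ht =>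
    abs_sub_quadratic_le (hG.continuousOn.mono fun p hp => (hball p hp).2)
      (fun p hp => (hball p hp).1.2) ha ht
  -- the first derivative vanishes on the axis by symmetry
  have hD : ∀ t, |t| < r₀ → dfst G (0, t) = 0 := by
    intro t ht
    have hmem : ((0 : ℝ), t) ∈ O := (hball _ (mem_ball_zero_prod.2 ⟨by simpa using hr₀, ht⟩)).2
    have h1 := hasDerivAt_dfst hO hG hmem
    have h2 : HasDerivAt (fun b : ℝ => G (-b, t)) (-dfst G (0, t)) 0 := by
      have h3 : HasDerivAt (fun b => G (b, t)) (dfst G (0, t)) (-0) := by simpa using h1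
      rw [← mul_neg_one]
      exact h3.comp (0 : ℝ) (hasDerivAt_neg (0 : ℝ))
    have h4 : (fun b : ℝ => G (-b, t)) =ᶠ[𝓝 0] fun b => G (b, t) := by
      have : ∀ᶠ b : ℝ in 𝓝 0, |b| < r₀ := eventually_abs_lt hr₀
      filter_upwards [this] with b hb
      exact (hball (b, t) (mem_ball_zero_prod.2 ⟨hb, ht⟩)).1.1
    have h5 := h2.unique (h1.congr_of_eventuallyEq h4)
    linarith
  have hDD : dfst (dfst G) 0 ≠ 0 :=
    dfst_dfst_ne_zero hO h0 hG (hD 0 (by simpa using hr₀)) hr₀ hβ (C := C) fun a ha => by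
      have := hq ha (t := 0) (by simpa using hr₀)
      simpa [sub_eq_add_neg] using this
  have hcont : ContinuousAt (dfst (dfst G)) 0 :=
    (contDiffOn_dfst hO (contDiffOn_dfst hO hG)).continuousOn.continuousAt (hO.mem_nhds h0)
  obtain ⟨r₁, hr₁, hDDb⟩ := Metric.eventually_nhds_iff_ball.1 (hcont.eventually_ne hDD)
  set C' := |C| + 1 with hC'
  have hC'0 : 0 < C' := by positivity
  have hq' : ∀ {a t : ℝ}, |a| < r₀ → |t| < r₀ →
      |G (a, t) - (α * t - β * a ^ 2)| ≤ C' * (t ^ 2 + |t| * a ^ 2 + a ^ 4) := fun ha ht =>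
    (hq ha ht).trans (mul_le_mul_of_nonneg_right
      ((le_abs_self C).trans (by rw [hC']; linarith)) (by positivity))
  -- radii for which the error terms are dominated by the linear and quadratic ones
  set κ := min α β / (4 * C')
  have hκ : 0 < κ := div_pos (lt_min hα hβ) (by positivity)
  have hκα : C' * κ ≤ α / 4 := by
    have : C' * κ = min α β / 4 := by simp only [κ]; field_simp
    rw [this]; linarith [min_le_left α β]
  have hκβ : C' * κ ≤ β / 4 := by
    have : C' * κ = min α β / 4 := by simp only [κ]; field_simp
    rw [this]; linarith [min_le_right α β]
  set r := min (min r₀ r₁) (min 1 κ) / 2 with hr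
  have hmin : 0 < min (min r₀ r₁) (min 1 κ) := lt_min (lt_min hr₀ hr₁) (lt_min one_pos hκ)
  have hrpos : 0 < r := half_pos hmin
  have hrlt : r < min (min r₀ r₁) (min 1 κ) := half_lt_self hmin
  have hrr₀ : r < r₀ := hrlt.trans_le ((min_le_left _ _).trans (min_le_left _ _))
  have hrr₁ : r < r₁ := hrlt.trans_le ((min_le_left _ _).trans (min_le_right _ _))
  have hr1 : r < 1 := hrlt.trans_le ((min_le_right _ _).trans (min_le_left _ _))
  have hrκ : r < κ := hrlt.trans_le ((min_le_right _ _).trans (min_le_right _ _))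
  have hsq : ∀ {a : ℝ}, |a| ≤ r → a ^ 2 < κ := fun {a} ha => by
    rw [← sq_abs]; nlinarith [abs_nonneg a]
  set δ := min r (β * r ^ 2 / (4 * α))
  have hδ : 0 < δ := lt_min hrpos (by positivity)
  have hδr : δ ≤ r := min_le_left _ _
  have hδα : α * δ ≤ β * r ^ 2 / 4 := by
    have : δ ≤ β * r ^ 2 / (4 * α) := min_le_right _ _
    calc α * δ ≤ α * (β * r ^ 2 / (4 * α)) := by gcongr
      _ = _ := by field_simp
  have hbox : ∀ {a t : ℝ}, |a| ≤ r → |t| < δ → |a| < r₀ ∧ |t| < r₀ ∧ (a, t) ∈ O ∧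
      dfst (dfst G) (a, t) ≠ 0 := by
    intro a t ha ht
    have h1 : |a| < r₀ := ha.trans_lt hrr₀
    have h2 : |t| < r₀ := ht.trans (hδr.trans_lt hrr₀)
    exact ⟨h1, h2, (hball _ (mem_ball_zero_prod.2 ⟨h1, h2⟩)).2,
      hDDb _ (mem_ball_zero_prod.2 ⟨ha.trans_lt hrr₁, ht.trans (hδr.trans_lt hrr₁)⟩)⟩
  -- no degenerate points off the axis
  have hDne : ∀ {a t : ℝ}, 0 < a → a ≤ r → |t| < δ → dfst G (a, t) ≠ 0 := by
    intro a t ha har ht hz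
    have hin : ∀ b ∈ Icc 0 a, (b, t) ∈ O ∧ dfst (dfst G) (b, t) ≠ 0 := fun b hb =>
      (hbox (by rw [abs_of_nonneg hb.1]; exact hb.2.trans har) ht).2.2
    have hder : ∀ b ∈ Icc 0 a, HasDerivAt (fun b => dfst G (b, t)) (dfst (dfst G) (b, t)) b :=
      fun b hb => hasDerivAt_dfst hO (contDiffOn_dfst hO hG) (hin b hb).1
    obtain ⟨c, hc, hce⟩ := exists_hasDerivAt_eq_zero (f := fun b => dfst G (b, t)) ha
      (fun b hb => (hder b hb).continuousAt.continuousWithinAt)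
      (by simp only [hz, hD t (ht.trans (hδr.trans_lt hrr₀))])
      fun b hb => hder b (Ioo_subset_Icc_self hb)
    exact (hin c (Ioo_subset_Icc_self hc)).2 hce
  have huniq : ∀ {a b t : ℝ}, 0 < a → a < b → b ≤ r → |t| < δ → G (a, t) = 0 →
      G (b, t) = 0 → False := by
    intro a b t ha hab hbr ht hza hzb
    have hder : ∀ c ∈ Icc a b, HasDerivAt (fun b => G (b, t)) (dfst G (c, t)) c := fun c hc =>
      hasDerivAt_dfst hO hG
        (hbox (by rw [abs_of_pos (ha.trans_le hc.1)]; exact hc.2.trans hbr) ht).2.2.1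
    obtain ⟨c, hc, hce⟩ := exists_hasDerivAt_eq_zero (f := fun b => G (b, t)) hab
      (fun c hc => (hder c hc).continuousAt.continuousWithinAt) (by simp only [hza, hzb])
      fun c hc => hder c (Ioo_subset_Icc_self hc)
    exact hDne (ha.trans hc.1) (hc.2.le.trans hbr) ht hce
  have hex : ∀ t ∈ Ioo 0 δ, ∃ a, 0 < a ∧ a < r ∧ G (a, t) = 0 := by
    intro t ht
    have htδ : |t| < δ := by rw [abs_of_pos ht.1]; exact ht.2
    have ht1 : t < κ := ht.2.trans_le (hδr.trans hrκ.le)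
    have hcontG : ContinuousOn (fun b => G (b, t)) (Icc 0 r) := fun b hb =>
      (hasDerivAt_dfst hO hG (hbox (by rw [abs_of_nonneg hb.1]; exact hb.2)
        htδ).2.2.1).continuousAt.continuousWithinAt
    have hpos : 0 < G (0, t) := by
      have h1 := abs_le.1 (hq' (a := 0) (t := t) (by simpa using hr₀)
        (htδ.trans (hδr.trans_lt hrr₀)))
      have h2 : C' * (t * t) ≤ α / 4 * t := by
        have : C' * t ≤ α / 4 := (mul_le_mul_of_nonneg_left ht1.le hC'0.le).trans hκα
        calc C' * (t * t) = (C' * t) * t := by ring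
          _ ≤ _ := mul_le_mul_of_nonneg_right this ht.1.le
      have h3 := mul_pos hα ht.1
      norm_num at h1
      nlinarith [h1.1]
    have hneg : G (r, t) < 0 := by
      have h1 := abs_le.1 (hq' (a := r) (t := t) (by rwa [abs_of_pos hrpos])
        (htδ.trans (hδr.trans_lt hrr₀)))
      rw [abs_of_pos ht.1] at h1
      have hr2 : r ^ 2 < κ := hsq (by rw [abs_of_pos hrpos])
      have hrp : 0 < r ^ 2 := by positivity
      have h2 : C' * (t * t) ≤ α / 4 * t := by
        have : C' * t ≤ α / 4 := (mul_le_mul_of_nonneg_left ht1.le hC'0.le).trans hκα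
        calc C' * (t * t) = (C' * t) * t := by ring
          _ ≤ _ := mul_le_mul_of_nonneg_right this ht.1.le
      have h3 : C' * (t * r ^ 2) ≤ β / 4 * r ^ 2 := by
        have : C' * t ≤ β / 4 := (mul_le_mul_of_nonneg_left ht1.le hC'0.le).trans hκβ
        calc C' * (t * r ^ 2) = (C' * t) * r ^ 2 := by ring
          _ ≤ _ := mul_le_mul_of_nonneg_right this hrp.le
      have h4 : C' * r ^ 4 ≤ β / 4 * r ^ 2 := by
        have : C' * r ^ 2 ≤ β / 4 := (mul_le_mul_of_nonneg_left hr2.le hC'0.le).trans hκβ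
        calc C' * r ^ 4 = (C' * r ^ 2) * r ^ 2 := by ring
          _ ≤ _ := mul_le_mul_of_nonneg_right this hrp.le
      have h5 : α * t ≤ β * r ^ 2 / 4 := (mul_le_mul_of_nonneg_left ht.2.le hα.le).trans hδα
      have h6 : C' * (t ^ 2 + t * r ^ 2 + r ^ 4) =
          C' * (t * t) + C' * (t * r ^ 2) + C' * r ^ 4 := by ring
      have h7 := mul_pos hβ hrp
      rw [h6] at h1
      linarith [h1.2]
    obtain ⟨a, ha, hza⟩ := intermediate_value_Ioo' hrpos.le hcontG ⟨hneg, hpos⟩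
    exact ⟨a, ha.1, ha.2, hza⟩
  choose! A hA0 hAr hAz using hex
  have hAiff : ∀ t ∈ Ioo 0 δ, ∀ a, 0 < a → a < r → (G (a, t) = 0 ↔ a = A t) := by
    intro t ht a ha har
    have htδ : |t| < δ := by rw [abs_of_pos ht.1]; exact ht.2
    refine ⟨fun hz => ?_, fun h => h ▸ hAz t ht⟩
    rcases lt_trichotomy a (A t) with h | h | h
    · exact (huniq ha h (hAr t ht).le htδ hz (hAz t ht)).elim
    · exact h
    · exact (huniq (hA0 t ht) h har.le htδ (hAz t ht) hz).elim
  -- size of the zero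
  set M := 2 * (α + C') / β with hM
  have hM0 : 0 < M := by positivity
  have hsize : ∀ t ∈ Ioo 0 δ, A t ^ 2 ≤ M * t ∧
      |A t ^ 2 - α / β * t| ≤ C' * (1 + M + M ^ 2) / β * t ^ 2 := by
    intro t ht
    have htδ : |t| < δ := by rw [abs_of_pos ht.1]; exact ht.2
    have ht1 : t < κ := ht.2.trans_le (hδr.trans hrκ.le)
    have ht2 : t < 1 := ht.2.trans_le (hδr.trans hr1.le)
    have hA := hA0 t ht
    have hAabs : |A t| ≤ r := by rw [abs_of_pos hA]; exact (hAr t ht).le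
    have h1 := hq' (hbox hAabs htδ).1 (hbox hAabs htδ).2.1
    rw [hAz t ht, abs_of_pos ht.1, zero_sub, abs_neg] at h1
    have hA2 : A t ^ 2 < κ := hsq hAabs
    have hAp : 0 < A t ^ 2 := by positivity
    have h3 : C' * (t * A t ^ 2) ≤ β / 4 * A t ^ 2 := by
      have : C' * t ≤ β / 4 := (mul_le_mul_of_nonneg_left ht1.le hC'0.le).trans hκβ
      calc C' * (t * A t ^ 2) = (C' * t) * A t ^ 2 := by ring
        _ ≤ _ := mul_le_mul_of_nonneg_right this hAp.le
    have h4 : C' * A t ^ 4 ≤ β / 4 * A t ^ 2 := by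
      have : C' * A t ^ 2 ≤ β / 4 := (mul_le_mul_of_nonneg_left hA2.le hC'0.le).trans hκβ
      calc C' * A t ^ 4 = (C' * A t ^ 2) * A t ^ 2 := by ring
        _ ≤ _ := mul_le_mul_of_nonneg_right this hAp.le
    have h5 : C' * t ^ 2 ≤ C' * t := mul_le_mul_of_nonneg_left (by nlinarith [ht.1]) hC'0.le
    have h6 : A t ^ 2 ≤ M * t := by
      rw [hM, div_mul_eq_mul_div, le_div_iff₀ hβ]
      have h7 := (abs_le.1 h1).1
      have h8 : C' * (t ^ 2 + t * A t ^ 2 + A t ^ 4) =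
          C' * t ^ 2 + C' * (t * A t ^ 2) + C' * A t ^ 4 := by ring
      rw [h8] at h7
      linarith
    refine ⟨h6, ?_⟩
    have e1 : A t ^ 2 - α / β * t = -(α * t - β * A t ^ 2) / β := by field_simp; ring
    rw [e1, abs_div, abs_neg, abs_of_pos hβ, div_mul_eq_mul_div]
    refine div_le_div_of_nonneg_right (h1.trans ?_) hβ.le
    have h9 : A t ^ 4 ≤ (M * t) ^ 2 := by
      have := pow_le_pow_left₀ hAp.le h6 2
      rwa [← pow_mul] at this
    have h10 : t * A t ^ 2 ≤ t * (M * t) := mul_le_mul_of_nonneg_left h6 ht.1.le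
    calc C' * (t ^ 2 + t * A t ^ 2 + A t ^ 4) ≤ C' * (t ^ 2 + t * (M * t) + (M * t) ^ 2) := by
          gcongr
      _ = _ := by ring
  refine ⟨r, hrpos, δ, hδ, A, M, fun t ht => ⟨hA0 t ht, hAr t ht, hAiff t ht⟩, ?_, ?_,
    fun t ht => (hsize t ht).1, ?_⟩
  · intro t ht a ha har hz
    have htδ : |t| < δ := by rw [abs_of_nonpos ht.2]; linarith [ht.1]
    have haabs : |a| ≤ r := by rw [abs_of_pos ha]; exact har.le
    have h1 := (abs_le.1 (hq' (hbox haabs htδ).1 (hbox haabs htδ).2.1)).2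
    rw [hz] at h1
    have hs0 : 0 ≤ |t| := abs_nonneg t
    have es : t = -|t| := by rw [abs_of_nonpos ht.2, neg_neg]
    have hs1 : |t| < κ := htδ.trans_le (hδr.trans hrκ.le)
    have ha2 : a ^ 2 < κ := hsq haabs
    have hap : 0 < a ^ 2 := by positivity
    have h2 : C' * (|t| * |t|) ≤ α / 4 * |t| := by
      have : C' * |t| ≤ α / 4 := (mul_le_mul_of_nonneg_left hs1.le hC'0.le).trans hκα
      calc C' * (|t| * |t|) = (C' * |t|) * |t| := by ring
        _ ≤ _ := mul_le_mul_of_nonneg_right this hs0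
    have h3 : C' * (|t| * a ^ 2) ≤ β / 4 * a ^ 2 := by
      have : C' * |t| ≤ β / 4 := (mul_le_mul_of_nonneg_left hs1.le hC'0.le).trans hκβ
      calc C' * (|t| * a ^ 2) = (C' * |t|) * a ^ 2 := by ring
        _ ≤ _ := mul_le_mul_of_nonneg_right this hap.le
    have h4 : C' * a ^ 4 ≤ β / 4 * a ^ 2 := by
      have : C' * a ^ 2 ≤ β / 4 := (mul_le_mul_of_nonneg_left ha2.le hC'0.le).trans hκβ
      calc C' * a ^ 4 = (C' * a ^ 2) * a ^ 2 := by ring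
        _ ≤ _ := mul_le_mul_of_nonneg_right this hap.le
    have h5 : C' * (t ^ 2 + |t| * a ^ 2 + a ^ 4) =
        C' * (|t| * |t|) + C' * (|t| * a ^ 2) + C' * a ^ 4 := by
      rw [abs_mul_abs_self]; ring
    have h6 : α * t = -(α * |t|) := by rw [abs_of_nonpos ht.2]; ring
    have h7 := mul_pos hβ hap
    have h8 := mul_nonneg hα.le hs0
    rw [h5, h6] at h1
    linarith
  · intro t₀ ht₀
    refine ContDiffAt.contDiffWithinAt ?_
    have htδ : |t₀| < δ := by rw [abs_of_pos ht₀.1]; exact ht₀.2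
    have hAabs : |A t₀| ≤ r := by rw [abs_of_pos (hA0 t₀ ht₀)]; exact (hAr t₀ ht₀).le
    have hmem := (hbox hAabs htδ).2.2.1
    set f : ℝ × ℝ → ℝ := fun x => G (x.2, x.1)
    set u : ℝ × ℝ := (t₀, A t₀)
    have hf : ContDiffAt ℝ ∞ f u :=
      ContDiffAt.comp (f := fun x : ℝ × ℝ => (x.2, x.1)) u
        (hG.contDiffAt (hO.mem_nhds hmem)) (contDiff_snd.prodMk contDiff_fst).contDiffAt
    have hder : (fderiv ℝ f u ∘L .inr ℝ ℝ ℝ) 1 = dfst G (A t₀, t₀) := by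
      have h1 : HasDerivAt (fun b => f (t₀, b)) (fderiv ℝ f u (0, 1)) (A t₀) :=
        HasFDerivAt.comp_hasDerivAt (f := fun b : ℝ => (t₀, b)) (A t₀)
          (hf.differentiableAt (by simp)).hasFDerivAt
          ((hasDerivAt_const (A t₀) t₀).prodMk (hasDerivAt_id (A t₀)))
      exact h1.unique (hasDerivAt_dfst hO hG hmem)
    have hinv : (fderiv ℝ f u ∘L .inr ℝ ℝ ℝ).IsInvertible :=
      isInvertible_of_apply_one_ne_zero (by
        rw [hder]; exact hDne (hA0 t₀ ht₀) (hAr t₀ ht₀).le htδ)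
    have hψ := hf.contDiffAt_implicitFunction (by simp) hinv
    have hψ0 := hf.implicitFunction_apply_self (by simp) hinv
    have hψe := hf.eventually_apply_implicitFunction (by simp) hinv
    set ψ := hf.implicitFunction (by simp) hinv
    change ContDiffAt ℝ ∞ ψ t₀ at hψ
    change ψ t₀ = A t₀ at hψ0
    have hψc : ∀ᶠ t in 𝓝 t₀, ψ t ∈ Ioo 0 r :=
      hψ.continuousAt.eventually (by rw [hψ0]; exact Ioo_mem_nhds (hA0 t₀ ht₀) (hAr t₀ ht₀))
    refine hψ.congr_of_eventuallyEq ?_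
    filter_upwards [hψe, hψc, Ioo_mem_nhds ht₀.1 ht₀.2] with t h1 h2 h3
    have h4 : G (ψ t, t) = 0 := h1.trans (hAz t₀ ht₀)
    exact ((hAiff t h3 (ψ t) h2.1 h2.2).1 h4).symm
  · have hab : 0 < √(α / β) := Real.sqrt_pos.2 (div_pos hα hβ)
    refine Asymptotics.IsBigO.of_bound (C' * (1 + M + M ^ 2) / β / √(α / β)) ?_
    filter_upwards [Ioo_mem_nhdsGT hδ] with t ht
    have ht2 : t < 1 := ht.2.trans_le (hδr.trans hr1.le)
    set y := √(α / β) * √t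
    have hst : t ≤ √t := Real.le_sqrt_of_sq_le (by nlinarith [ht.1])
    have hy : √(α / β) * t ≤ y := mul_le_mul_of_nonneg_left hst hab.le
    have hy0 : 0 < √(α / β) * t := mul_pos hab ht.1
    have hy2 : y ^ 2 = α / β * t := by
      rw [mul_pow, Real.sq_sqrt (div_pos hα hβ).le, Real.sq_sqrt ht.1.le]
    have h1 := (hsize t ht).2
    rw [← hy2, sq_sub_sq, abs_mul] at h1
    have h2 : √(α / β) * t ≤ |A t + y| := by
      rw [abs_of_pos (add_pos (hA0 t ht) (hy0.trans_le hy))]; linarith [hA0 t ht]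
    have h3 : (√(α / β) * t) * |A t - y| ≤ C' * (1 + M + M ^ 2) / β * t ^ 2 :=
      (mul_le_mul_of_nonneg_right h2 (abs_nonneg _)).trans h1
    rw [Real.norm_eq_abs, Real.norm_eq_abs, abs_of_pos ht.1, div_mul_eq_mul_div, le_div_iff₀ hab]
    refine le_of_mul_le_mul_right ?_ ht.1
    calc |A t - y| * √(α / β) * t = (√(α / β) * t) * |A t - y| := by ring
      _ ≤ _ := h3
      _ = _ := by ring

end Pitchfork

/-! ### Stationary solutions, translations and phases -/

theorem lap_sub_one (f : Space d → ℝ) (x : Space d) : lap (fun y => f y - 1) x = lap f x := by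
  have h : ∀ i, pd i (fun y => f y - 1) = pd i f := fun i => funext fun y => by
    rw [pd, pd, fderiv_sub_const]
  simp only [lap, h]

/-- The stationary system in terms of the operator whose components are `hjbOp` and `fpOp`. -/
theorem isStationary_iff {ν : ℝ} {K : Space d → ℝ} (hK : IsKernel K) {γ l : ℝ}
    {φ m : Space d → ℝ} : IsStationary ν K γ φ m l ↔
      (ContDiff ℝ 2 φ ∧ ContDiff ℝ 2 (fun x => m x - 1)) ∧
      (IsPeriodic φ ∧ IsPeriodic fun x => m x - 1) ∧
      (∀ x, hjbOp ν K γ (fun x => m x - 1) φ l x = 0) ∧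
      (∀ x, fpOp ν (fun x => m x - 1) φ x = 0) ∧
      torusIntegral (fun x => m x - 1) = 0 ∧ torusIntegral φ = 0 := by
  have hcd : ContDiff ℝ 2 (fun x => m x - 1) ↔ ContDiff ℝ 2 m :=
    ⟨fun h => by simpa using h.add (contDiff_const (c := (1 : ℝ))), fun h => h.sub contDiff_const⟩
  have hper : IsPeriodic (fun x => m x - 1) ↔ IsPeriodic m := by
    simp only [IsPeriodic, sub_left_inj]
  have hconv : Continuous m → ∀ x, conv K (fun x => m x - 1) x = conv K m x := fun hm x => by
    rw [conv_sub hK.smooth.continuous hm continuous_const, conv_const hK, sub_zero]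
  have hint : Continuous m → torusIntegral (fun x => m x - 1) = torusIntegral m - 1 := fun hm => by
    rw [torusIntegral_sub hm continuous_const, torusIntegral_const]
  have hlap : ContDiff ℝ 2 m → ∀ x,
      Laplacian.laplacian (fun x => m x - 1) x = Laplacian.laplacian m x := fun hm x => by
    rw [laplacian_eq_lap hm, laplacian_eq_lap (hcd.2 hm), lap_sub_one]
  constructor
  · intro h
    have hc := h.contDiff_m.continuous
    refine ⟨⟨h.contDiff_phi, hcd.2 h.contDiff_m⟩, ⟨h.periodic_phi, hper.2 h.periodic_m⟩,
      fun x => ?_, fun x => ?_, ?_, h.mean_phi⟩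
    · rw [hjbOp, h.hjb x, hconv hc]; ring
    · rw [fpOp, hlap h.contDiff_m, ← h.fp x]; simp only [add_sub_cancel]
    · rw [hint hc, h.mass, sub_self]
  · rintro ⟨⟨h1, h2⟩, ⟨h3, h4⟩, h5, h6, h7, h8⟩
    have hm := hcd.1 h2
    have hc := hm.continuous
    refine ⟨h1, hm, h3, hper.1 h4, fun x => ?_, fun x => ?_, ?_, h8⟩
    · have := h5 x
      rw [hjbOp, hconv hc] at this
      linarith
    · have := h6 x
      rw [fpOp, hlap hm] at this
      simpa only [add_sub_cancel] using this
    · rw [hint hc] at h7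
      linarith

/-- A solution of the complement equation with vanishing critical component is stationary. -/
theorem SolvesComplement.isStationary {ν : ℝ} {K : Space d → ℝ} (hK : IsKernel K)
    {ξ₀ : Fin d → ℤ} {γ A l : ℝ} {μ w : Space d → ℝ} (h : SolvesComplement ν K ξ₀ γ A μ w l)
    (h0 : reducedValue ν K ξ₀ γ μ w l = 0) : IsStationary ν K γ w (fun x => 1 + μ x) l := by
  rw [isStationary_iff hK]
  simp only [add_sub_cancel_left]
  refine ⟨⟨h.contDiff_w, h.contDiff_mu⟩, ⟨h.periodic_w, h.periodic_mu⟩, fun x => ?_, fun x => ?_,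
    h.mean_mu, h.mean_w⟩
  · rw [h.complement_hjb, h0, zero_mul]
  · rw [h.complement_fp, h0, zero_mul]

/-- Phase-fixed stationary solutions solve the complement equation, with vanishing critical
component. -/
theorem IsStationary.solvesComplement {ν : ℝ} {K : Space d → ℝ} (hK : IsKernel K)
    {ξ₀ : Fin d → ℤ} {γ l : ℝ} {φ m : Space d → ℝ} (h : IsStationary ν K γ φ m l)
    (hp : PhaseFixed ξ₀ fun x => m x - 1) :
    SolvesComplement ν K ξ₀ γ (critPairing ν ξ₀ (fun x => m x - 1) φ) (fun x => m x - 1) φ l ∧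
      reducedValue ν K ξ₀ γ (fun x => m x - 1) φ l = 0 := by
  obtain ⟨⟨h1, h2⟩, ⟨h3, h4⟩, h5, h6, h7, h8⟩ := (isStationary_iff hK).1 h
  have h0 : reducedValue ν K ξ₀ γ (fun x => m x - 1) φ l = 0 := by
    rw [reducedValue, funext h5, funext h6, critPairing]
    simp [torusIntegral]
  exact ⟨⟨h2, h1, h4, h3, h7, h8, hp, rfl, fun x => by rw [h0, h5, zero_mul],
    fun x => by rw [h0, h6, zero_mul]⟩, h0⟩

theorem contDiff_translate {n : ℕ∞ω} {f : Space d → ℝ} (hf : ContDiff ℝ n f) (τ : Space d) :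
    ContDiff ℝ n (translate τ f) :=
  hf.comp (contDiff_id.add contDiff_const)

theorem lap_translate (f : Space d → ℝ) (τ x : Space d) :
    lap (translate τ f) x = lap f (x + τ) := by
  simp only [lap, pd_translate, translate]

theorem hjbOp_translate {ν : ℝ} {K : Space d → ℝ} (hK : IsKernel K) {γ l : ℝ} {μ w : Space d → ℝ}
    (hw : ContDiff ℝ 2 w) (hμ : IsPeriodic μ) (τ : Space d) :
    hjbOp ν K γ (translate τ μ) (translate τ w) l = translate τ (hjbOp ν K γ μ w l) := by
  funext x
  rw [translate, hjbOp_eq hw, hjbOp_eq (contDiff_translate hw τ), lap_translate,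
    conv_translate hK hμ]
  simp only [pd_translate, translate]

theorem fpOp_translate {ν : ℝ} {μ w : Space d → ℝ} (hμ : ContDiff ℝ 2 μ) (hw : ContDiff ℝ 2 w)
    (τ : Space d) : fpOp ν (translate τ μ) (translate τ w) = translate τ (fpOp ν μ w) := by
  funext x
  rw [translate, fpOp_eq hμ hw, fpOp_eq (contDiff_translate hμ τ) (contDiff_translate hw τ),
    lap_translate, lap_translate]
  simp only [pd_translate, translate]

theorem IsStationary.translate {ν : ℝ} {K : Space d → ℝ} (hK : IsKernel K) {γ l : ℝ}
    {φ m : Space d → ℝ} (h : IsStationary ν K γ φ m l) (τ : Space d) :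
    IsStationary ν K γ (translate τ φ) (translate τ m) l := by
  obtain ⟨⟨h1, h2⟩, ⟨h3, h4⟩, h5, h6, h7, h8⟩ := (isStationary_iff hK).1 h
  have e : (fun x => MFGTorus.translate τ m x - 1) = MFGTorus.translate τ fun x => m x - 1 := rfl
  rw [isStationary_iff hK, e, hjbOp_translate hK h1 h4, fpOp_translate h2 h1]
  exact ⟨⟨contDiff_translate h1 τ, contDiff_translate h2 τ⟩, ⟨h3.translate τ, h4.translate τ⟩,
    fun x => h5 _, fun x => h6 _, by rw [torusIntegral_translate h4, h7],
    by rw [torusIntegral_translate h3, h8]⟩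

theorem C2Small.translate {ε : ℝ} {f : Space d → ℝ} (h : C2Small ε f) (τ : Space d) :
    C2Small ε (translate τ f) := by
  intro k hk x
  have := iteratedFDeriv_comp_add_right (𝕜 := ℝ) (f := f) k τ x
  change iteratedFDeriv ℝ k (MFGTorus.translate τ f) x = _ at this
  rw [this]
  exact h k hk _

theorem NearUniform.translate {ε l : ℝ} {φ m : Space d → ℝ} (h : NearUniform ε φ m l)
    (τ : Space d) : NearUniform ε (translate τ φ) (translate τ m) l :=
  ⟨h.1.translate τ, h.2.1.translate τ, h.2.2⟩

theorem translate_translate_neg (τ : Space d) (f : Space d → ℝ) :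
    translate (-τ) (translate τ f) = f := by
  funext x; simp [translate]

theorem translate_one_add_sub_one (τ : Space d) (f : Space d → ℝ) :
    (fun x => translate τ (fun y => 1 + f y) x - 1) = translate τ f :=
  funext fun _ => add_sub_cancel_left _ _

theorem trigMode_sub (ξ : Fin d → ℤ) (τ x : Space d) :
    cosMode ξ (x - τ) = cosMode ξ x * Real.cos (phase ξ τ) + sinMode ξ x * Real.sin (phase ξ τ) ∧
      sinMode ξ (x - τ) =
        sinMode ξ x * Real.cos (phase ξ τ) - cosMode ξ x * Real.sin (phase ξ τ) := by
  simp only [cosMode, sinMode, phase_sub_right, Real.cos_sub, Real.sin_sub, and_self]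

theorem torusIntegral_translate_mul {f g : Space d → ℝ} (hf : IsPeriodic f) (hg : IsPeriodic g)
    (τ : Space d) :
    torusIntegral (fun x => translate τ f x * g x) = torusIntegral (fun x => f x * g (x - τ)) := by
  have hp : IsPeriodic fun x => f x * g (x - τ) := fun n x => by
    have : x + latt n - τ = (x - τ) + latt n := by abel
    simp only [this, hf n x, hg n (x - τ)]
  rw [← torusIntegral_translate hp τ]
  congr 1; funext x
  simp [translate]

theorem torusIntegral_translate_cos {f : Space d → ℝ} (hf : IsPeriodic f) (hc : Continuous f)
    (ξ : Fin d → ℤ) (τ : Space d) :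
    torusIntegral (fun x => translate τ f x * cosMode ξ x) =
      Real.cos (phase ξ τ) * torusIntegral (fun x => f x * cosMode ξ x) +
        Real.sin (phase ξ τ) * torusIntegral (fun x => f x * sinMode ξ x) := by
  have c1 : Continuous (cosMode ξ) := continuous_trigMode true ξ
  have c2 : Continuous (sinMode ξ) := continuous_trigMode false ξ
  rw [torusIntegral_translate_mul (g := cosMode ξ) hf (periodic_trigMode true ξ),
    ← torusIntegral_const_mul,
    ← torusIntegral_const_mul, ← torusIntegral_add (by fun_prop) (by fun_prop)]
  congr 1; funext x
  rw [(trigMode_sub ξ τ x).1]; ring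

theorem torusIntegral_translate_sin {f : Space d → ℝ} (hf : IsPeriodic f) (hc : Continuous f)
    (ξ : Fin d → ℤ) (τ : Space d) :
    torusIntegral (fun x => translate τ f x * sinMode ξ x) =
      Real.cos (phase ξ τ) * torusIntegral (fun x => f x * sinMode ξ x) -
        Real.sin (phase ξ τ) * torusIntegral (fun x => f x * cosMode ξ x) := by
  have c1 : Continuous (cosMode ξ) := continuous_trigMode true ξ
  have c2 : Continuous (sinMode ξ) := continuous_trigMode false ξ
  rw [torusIntegral_translate_mul (g := sinMode ξ) hf (periodic_trigMode false ξ),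
    ← torusIntegral_const_mul,
    ← torusIntegral_const_mul, ← torusIntegral_sub (by fun_prop) (by fun_prop)]
  congr 1; funext x
  rw [(trigMode_sub ξ τ x).2]; ring

theorem exists_phase_eq {ξ : Fin d → ℤ} (h : ξ ≠ 0) (θ : ℝ) : ∃ τ : Space d, phase ξ τ = θ := by
  have h1 : ‖latt ξ‖ ≠ 0 := by linarith [one_le_norm_latt h]
  have h2 := Real.pi_pos.ne'
  refine ⟨(θ / (2 * Real.pi * ‖latt ξ‖ ^ 2)) • latt ξ, ?_⟩
  rw [phase, inner_smul_right, real_inner_self_eq_norm_sq]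
  field_simp

/-- Every function has a translate satisfying the phase and sign conditions. -/
theorem exists_translate_phaseFixed {ξ₀ : Fin d → ℤ} (h : ξ₀ ≠ 0) {f : Space d → ℝ}
    (hf : IsPeriodic f) (hc : Continuous f) :
    ∃ τ, PhaseFixed ξ₀ (translate τ f) ∧ SignFixed ξ₀ (translate τ f) := by
  set a := torusIntegral fun x => f x * cosMode ξ₀ x with ha
  set b := torusIntegral fun x => f x * sinMode ξ₀ x with hb
  set z : ℂ := ⟨a, b⟩
  obtain ⟨τ, hτ⟩ := exists_phase_eq h z.arg
  have e1 : a = ‖z‖ * Real.cos z.arg := (Complex.norm_mul_cos_arg z).symm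
  have e2 : b = ‖z‖ * Real.sin z.arg := (Complex.norm_mul_sin_arg z).symm
  refine ⟨τ, ?_, ?_⟩
  · rw [PhaseFixed, torusIntegral_translate_sin hf hc, hτ, ← ha, ← hb, e1, e2]; ring
  · rw [SignFixed, torusIntegral_translate_cos hf hc, hτ, ← ha, ← hb, e1, e2]
    have := norm_nonneg z
    nlinarith [mul_nonneg this (sq_nonneg (Real.cos z.arg)),
      mul_nonneg this (sq_nonneg (Real.sin z.arg))]

theorem cos_sin_phase_of_half {ξ : Fin d → ℤ} {τ : Space d}
    (h : ∃ n : ℤ, inner ℝ (latt ξ) τ = (n : ℝ) + 1 / 2) :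
    Real.cos (phase ξ τ) = -1 ∧ Real.sin (phase ξ τ) = 0 := by
  obtain ⟨n, hn⟩ := h
  have e : phase ξ τ = Real.pi + n * (2 * Real.pi) := by rw [phase, hn]; ring
  rw [e, Real.cos_add_int_mul_two_pi, Real.sin_add_int_mul_two_pi]
  simp

section HalfPeriod

variable {ξ₀ : Fin d → ℤ} {τ : Space d}

theorem critPairing_translate_half (hτ : ∃ n : ℤ, inner ℝ (latt ξ₀) τ = (n : ℝ) + 1 / 2) {ν : ℝ}
    {f g : Space d → ℝ} (hf : IsPeriodic f) (hg : IsPeriodic g) (hfc : Continuous f)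
    (hgc : Continuous g) :
    critPairing ν ξ₀ (translate τ f) (translate τ g) = -critPairing ν ξ₀ f g := by
  obtain ⟨h1, h2⟩ := cos_sin_phase_of_half hτ
  rw [critPairing, critPairing, torusIntegral_translate_cos hf hfc,
    torusIntegral_translate_cos hg hgc, h1, h2]
  ring

theorem PhaseFixed.translate_half (hτ : ∃ n : ℤ, inner ℝ (latt ξ₀) τ = (n : ℝ) + 1 / 2)
    {f : Space d → ℝ} (hf : IsPeriodic f) (hfc : Continuous f) (h : PhaseFixed ξ₀ f) :
    PhaseFixed ξ₀ (translate τ f) := by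
  obtain ⟨h1, h2⟩ := cos_sin_phase_of_half hτ
  rw [PhaseFixed, torusIntegral_translate_sin hf hfc, h1, h2, h]
  ring

theorem cosMode_translate_half (hτ : ∃ n : ℤ, inner ℝ (latt ξ₀) τ = (n : ℝ) + 1 / 2)
    (x : Space d) : cosMode ξ₀ (x + τ) = -cosMode ξ₀ x := by
  obtain ⟨h1, h2⟩ := cos_sin_phase_of_half hτ
  have := (trigMode_sub ξ₀ τ (x + τ)).1
  rw [add_sub_cancel_right, h1, h2] at this
  linarith

/-- A half-period shift reverses the sign of the amplitude and of the critical component. -/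
theorem SolvesComplement.translate_half
    (hτ : ∃ n : ℤ, inner ℝ (latt ξ₀) τ = (n : ℝ) + 1 / 2) {ν : ℝ} {K : Space d → ℝ}
    (hK : IsKernel K) (h0 : ξ₀ ≠ 0) {γ A l : ℝ} {μ w : Space d → ℝ}
    (h : SolvesComplement ν K ξ₀ γ A μ w l) :
    SolvesComplement ν K ξ₀ γ (-A) (translate τ μ) (translate τ w) l ∧
      reducedValue ν K ξ₀ γ (translate τ μ) (translate τ w) l = -reducedValue ν K ξ₀ γ μ w l := by
  set r := reducedValue ν K ξ₀ γ μ w l with hr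
  have e1 : hjbOp ν K γ (translate τ μ) (translate τ w) l = fun x => -r * cosMode ξ₀ x := by
    rw [hjbOp_translate hK h.contDiff_w h.periodic_mu]
    funext x
    rw [translate, h.complement_hjb, cosMode_translate_half hτ]; ring
  have e2 : fpOp ν (translate τ μ) (translate τ w) = fun x => -r * (-ν * cosMode ξ₀ x) := by
    rw [fpOp_translate h.contDiff_mu h.contDiff_w]
    funext x
    rw [translate, h.complement_fp, cosMode_translate_half hτ]; ring
  have er : reducedValue ν K ξ₀ γ (translate τ μ) (translate τ w) l = -r := by
    rw [reducedValue, e1, e2, critPairing_smul_cosMode h0]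
  have cμ := h.contDiff_mu.continuous
  refine ⟨⟨contDiff_translate h.contDiff_mu τ, contDiff_translate h.contDiff_w τ,
    h.periodic_mu.translate τ, h.periodic_w.translate τ, ?_, ?_,
    h.phaseFixed.translate_half hτ h.periodic_mu cμ, ?_, fun x => ?_, fun x => ?_⟩, er⟩
  · rw [torusIntegral_translate h.periodic_mu, h.mean_mu]
  · rw [torusIntegral_translate h.periodic_w, h.mean_w]
  · rw [critPairing_translate_half hτ h.periodic_mu h.periodic_w cμ h.contDiff_w.continuous,
      h.amplitude]
  · rw [er, e1]
  · rw [er, e2]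

end HalfPeriod

theorem exists_half_period {ξ₀ : Fin d → ℤ} (h : ξ₀ ≠ 0) :
    ∃ τ : Space d, ∃ n : ℤ, inner ℝ (latt ξ₀) τ = (n : ℝ) + 1 / 2 := by
  obtain ⟨τ, hτ⟩ := exists_phase_eq h Real.pi
  refine ⟨τ, 0, ?_⟩
  rw [phase] at hτ
  have := Real.pi_pos.ne'
  rw [Int.cast_zero, zero_add]
  field_simp at hτ
  linarith

/-- The amplitude of a small perturbation is small. -/
theorem abs_critPairing_le {ν ε : ℝ} (hν : 0 < ν) (ξ₀ : Fin d → ℤ) {f g : Space d → ℝ}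
    (hf : C2Small ε f) (hg : C2Small ε g) (hfc : Continuous f) (hgc : Continuous g) :
    |critPairing ν ξ₀ f g| ≤ 2 / (1 + ν ^ 2) * (1 + ν) * ε := by
  have c1 : Continuous (cosMode ξ₀) := continuous_trigMode true ξ₀
  have key : ∀ {h : Space d → ℝ}, C2Small ε h → Continuous h →
      |torusIntegral fun x => h x * cosMode ξ₀ x| ≤ ε := fun {h} hh hc =>
    abs_torusIntegral_le (by fun_prop) fun x => by
      rw [abs_mul]
      exact (mul_le_of_le_one_right (abs_nonneg _) (abs_trigMode_le true ξ₀ x)).trans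
        (hh.abs_lt x).le
  have h1 := key hf hfc
  have h2 := key hg hgc
  have h3 : 0 < 2 / (1 + ν ^ 2) := by positivity
  rw [critPairing, abs_mul, abs_of_pos h3, mul_assoc]
  refine mul_le_mul_of_nonneg_left ((abs_sub _ _).trans ?_) h3.le
  rw [abs_mul, abs_of_pos hν]
  nlinarith

/-! ### The reduced equation -/

section Reduced

variable {ν : ℝ} {K : Space d → ℝ} {γc : ℝ} {ξ₀ : Fin d → ℤ} {O : Set (ℝ × ℝ)}
  {P W : ℝ × ℝ → (Fin d → ℤ) → ℝ}

theorem NearUniform.mono {ε ε' l : ℝ} {φ m : Space d → ℝ} (h : NearUniform ε φ m l) (hε : ε ≤ ε') :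
    NearUniform ε' φ m l :=
  ⟨fun k hk x => (h.1 k hk x).trans_le hε, fun k hk x => (h.2.1 k hk x).trans_le hε,
    h.2.2.trans_le hε⟩

/-- Near the uniform equilibrium the profiles give all solutions of the complement equation. -/
theorem IsProfile.exists_unique (hν : 0 < ν) (hK : IsKernel K) (h : SimpleCriticalPair ν K γc ξ₀)
    (hP : IsProfile ν K γc ξ₀ O P W) : ∃ ε > 0, ∀ᶠ p in 𝓝 (0 : ℝ × ℝ),
      ∀ (μ w : Space d → ℝ) (l : ℝ), SolvesComplement ν K ξ₀ (γc + p.2) p.1 μ w l →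
        NearUniform ε w (fun x => 1 + μ x) l →
        μ = profileFun P p ∧ w = profileFun W p ∧ l = profileConst W p := by
  obtain ⟨ε, hε, huniq⟩ := h.exists_solvesComplement_unique hν hK
  refine ⟨ε, hε, ?_⟩
  have h2 : ∀ᶠ p : ℝ × ℝ in 𝓝 0, |p.2| < ε :=
    (continuous_snd.tendsto (0 : ℝ × ℝ)).eventually (eventually_abs_lt hε)
  filter_upwards [hP.eventually_nearUniform hε, h2, hP.mem_nhds] with p h1 h2 h3 μ w l hs hn
  exact huniq (γc + p.2) p.1 _ _ _ _ _ _ (by simpa using h2) hs hn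
    (hP.solvesComplement hν hK h h3).1 h1

theorem tendsto_neg_fst : Tendsto (fun p : ℝ × ℝ => (-p.1, p.2)) (𝓝 0) (𝓝 0) := by
  have : Continuous fun p : ℝ × ℝ => (-p.1, p.2) := by fun_prop
  have h := this.tendsto 0
  rwa [show ((-(0 : ℝ × ℝ).1, (0 : ℝ × ℝ).2) : ℝ × ℝ) = 0 by ext <;> simp] at h

/-- Half-period shifts make the reduced bifurcation function odd in the amplitude. -/
theorem IsProfile.eventually_even (hν : 0 < ν) (hK : IsKernel K)
    (h : SimpleCriticalPair ν K γc ξ₀) (hP : IsProfile ν K γc ξ₀ O P W) :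
    ∀ᶠ p in 𝓝 (0 : ℝ × ℝ), reducedQuotient ν K γc ξ₀ P W (-p.1, p.2) =
      reducedQuotient ν K γc ξ₀ P W p := by
  obtain ⟨ε₀, hε₀, huniq⟩ := hP.exists_unique hν hK h
  obtain ⟨τ, hτ⟩ := exists_half_period h.ne_zero
  filter_upwards [tendsto_neg_fst.eventually huniq,
    hP.eventually_nearUniform hε₀, hP.mem_nhds, tendsto_neg_fst.eventually hP.mem_nhds]
    with p h1 h2 h3 h4
  have s1 := hP.solvesComplement hν hK h h3
  have s2 := hP.solvesComplement hν hK h h4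
  have s3 := s1.1.translate_half hτ hK h.ne_zero
  obtain ⟨e1, e2, e3⟩ := h1 _ _ _ s3.1 (h2.translate τ)
  -- the reduced functions agree, and may be divided by the amplitude unless it vanishes
  by_cases h0 : p.1 = 0
  · have : ((-p.1, p.2) : ℝ × ℝ) = p := Prod.ext (by simp [h0]) rfl
    rw [this]
  · have h5 := s3.2
    rw [s1.2, e1, e2, e3] at h5
    have h6 := s2.2.symm.trans h5
    have h7 : p.1 * (reducedQuotient ν K γc ξ₀ P W (-p.1, p.2) -
        reducedQuotient ν K γc ξ₀ P W p) = 0 := by linear_combination -h6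
    exact sub_eq_zero.1 ((mul_eq_zero.1 h7).resolve_left h0)

/-- The cubic hypothesis, applied to the solutions given by the profiles. -/
theorem IsProfile.exists_eventually_cubic (hν : 0 < ν) (hK : IsKernel K)
    (h : SimpleCriticalPair ν K γc ξ₀) (hP : IsProfile ν K γc ξ₀ O P W) {α β : ℝ}
    (hc : CubicReducedEquation ν K ξ₀ γc α β) : ∃ C, ∀ᶠ p in 𝓝 (0 : ℝ × ℝ),
      |p.1 * reducedQuotient ν K γc ξ₀ P W p - (α * p.2 * p.1 - β * p.1 ^ 3)| ≤
        C * (|p.2| ^ 2 * |p.1| + |p.2| * |p.1| ^ 3 + |p.1| ^ 5) := by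
  obtain ⟨-, -, C, ε, hε, η, hη, hb⟩ := hc
  refine ⟨C, ?_⟩
  filter_upwards [hP.eventually_nearUniform hε, hP.mem_nhds,
    (continuous_fst.tendsto (0 : ℝ × ℝ)).eventually (eventually_abs_lt hη),
    (continuous_snd.tendsto (0 : ℝ × ℝ)).eventually (eventually_abs_lt hη)] with p h1 h2 h3 h4
  have s := hP.solvesComplement hν hK h h2
  have := hb p.1 (γc + p.2) _ _ _ h3 (by simpa using h4) s.1 h1
  rwa [s.2, add_sub_cancel_left] at this

/-- The sign of the amplitude of a profile is the sign of `∫ μ cos (2π ξ₀·x)`. -/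
theorem IsProfile.eventually_sign (h : SimpleCriticalPair ν K γc ξ₀)
    (hP : IsProfile ν K γc ξ₀ O P W) : ∀ᶠ p in 𝓝 (0 : ℝ × ℝ),
      ∃ c > 0, torusIntegral (fun x => profileFun P p x * cosMode ξ₀ x) = p.1 * c := by
  have hcoef : ∀ p ∈ O, trigCoef true (trigSeries true (P p)) ξ₀ = (P p ξ₀ + P p (-ξ₀)) / 2 :=
    fun p hp => trigCoef_cosSeries (hP.smoothP.decay hp 0).summable_abs ξ₀
  have hcont : ContinuousAt (fun p => (P p ξ₀ + P p (-ξ₀)) / 2) 0 :=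
    ((((hP.smoothP.contDiffOn_apply ξ₀).add
      (hP.smoothP.contDiffOn_apply (-ξ₀))).continuousOn.continuousAt hP.mem_nhds)).div_const 2
  have h0 : (P 0 ξ₀ + P 0 (-ξ₀)) / 2 = 1 / 2 := by
    have hne : ξ₀ ≠ -ξ₀ := fun h' => h.ne_zero (self_eq_neg.1 h')
    rw [← hcoef 0 hP.zero_mem, hP.cosSeries_zero h.ne_zero, trigCoef_true_cosMode, if_pos rfl,
      if_neg hne, add_zero]
  filter_upwards [hcont.eventually (lt_mem_nhds (one_half_pos.trans_eq h0.symm)), hP.mem_nhds]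
    with p h1 h2
  refine ⟨_, h1, ?_⟩
  rw [← hcoef p h2, trigCoef, ← torusIntegral_const_mul]
  congr 1; funext x; simp only [profileFun, trigMode]; ring

theorem profileFun_zero_fst (P : ℝ × ℝ → (Fin d → ℤ) → ℝ) {p : ℝ × ℝ} (h : p.1 = 0) :
    profileFun P p = fun _ => 0 :=
  funext fun x => by rw [profileFun, h, zero_mul]

end Reduced

/-! ### The local bifurcation diagram -/

/-- The local bifurcation diagram in the coordinates `a = A`, `t = γ - γc`. The box `|a| < ρ`,
`|t| < δ` contains the amplitudes of all solutions in the `ε`-neighbourhood of the uniform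
equilibrium, each such solution of the complement equation is given by the profiles, and profiles
with `|a| < η` do lie in that neighbourhood. The zeros of the reduced function are those of a
pitchfork. -/
structure LocalModel (ν : ℝ) (K : Space d → ℝ) (γc : ℝ) (ξ₀ : Fin d → ℤ) (O : Set (ℝ × ℝ))
    (P W : ℝ × ℝ → (Fin d → ℤ) → ℝ) (ε ρ η δ : ℝ) (A : ℝ → ℝ) : Prop where
  profile : IsProfile ν K γc ξ₀ O P W
  eps_le : ε ≤ 1 / 2
  eta_pos : 0 < η
  eta_le : η ≤ ρ
  amplitude_lt : ∀ f g : Space d → ℝ, C2Small ε f → C2Small ε g → Continuous f → Continuous g →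
    |critPairing ν ξ₀ f g| < ρ
  mem : ∀ p : ℝ × ℝ, |p.1| < ρ → |p.2| < δ → p ∈ O
  unique : ∀ p : ℝ × ℝ, |p.1| < ρ → |p.2| < δ → ∀ (μ w : Space d → ℝ) (l : ℝ),
    SolvesComplement ν K ξ₀ (γc + p.2) p.1 μ w l → NearUniform ε w (fun x => 1 + μ x) l →
      μ = profileFun P p ∧ w = profileFun W p ∧ l = profileConst W p
  even : ∀ p : ℝ × ℝ, |p.1| < ρ → |p.2| < δ →
    reducedQuotient ν K γc ξ₀ P W (-p.1, p.2) = reducedQuotient ν K γc ξ₀ P W p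
  sign : ∀ p : ℝ × ℝ, |p.1| < ρ → |p.2| < δ →
    ∃ c > 0, torusIntegral (fun x => profileFun P p x * cosMode ξ₀ x) = p.1 * c
  near : ∀ p : ℝ × ℝ, |p.1| < η → |p.2| < δ →
    NearUniform ε (profileFun W p) (fun x => 1 + profileFun P p x) (profileConst W p)
  zero_pos : ∀ t ∈ Ioo 0 δ, 0 < A t ∧ A t < η ∧
    ∀ a, 0 < a → a < ρ → (reducedQuotient ν K γc ξ₀ P W (a, t) = 0 ↔ a = A t)
  zero_nonpos : ∀ t ∈ Ioc (-δ) 0, ∀ a, 0 < a → a < ρ → reducedQuotient ν K γc ξ₀ P W (a, t) ≠ 0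

theorem exists_box_of_eventually {Q : ℝ × ℝ → Prop} (h : ∀ᶠ p in 𝓝 (0 : ℝ × ℝ), Q p) :
    ∃ b > 0, ∀ p : ℝ × ℝ, |p.1| < b → |p.2| < b → Q p := by
  obtain ⟨b, hb, hQ⟩ := Metric.eventually_nhds_iff_ball.1 h
  exact ⟨b, hb, fun p h1 h2 => hQ p (mem_ball_zero_prod.2 ⟨h1, h2⟩)⟩

/-- The radii are chosen in the order `ρ`, `ε`, `η`, `δ`: the neighbourhood is small enough for all
amplitudes in it to stay in the region where the equation is understood, and the coupling is then
close enough to `γc` for the bifurcating amplitude to stay in the neighbourhood. -/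
theorem exists_localModel {ν : ℝ} (hν : 0 < ν) {K : Space d → ℝ} (hK : IsKernel K) {γc : ℝ}
    {ξ₀ : Fin d → ℤ} (h : SimpleCriticalPair ν K γc ξ₀) {α β : ℝ}
    (hc : CubicReducedEquation ν K ξ₀ γc α β) : ∃ O P W ε ρ η δ A M,
      LocalModel ν K γc ξ₀ O P W ε ρ η δ A ∧ 0 < ε ∧ 0 < δ ∧ ContDiffOn ℝ ∞ A (Ioo 0 δ) ∧
      (∀ t ∈ Ioo 0 δ, A t ^ 2 ≤ M * t) ∧
      (fun t => A t - √(α / β) * √t) =O[𝓝[>] 0] fun t => t := by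
  obtain ⟨O, P, W, hP⟩ := h.exists_isProfile hν hK
  obtain ⟨ε₀, hε₀, huniq⟩ := hP.exists_unique hν hK h
  have heven := hP.eventually_even hν hK h
  obtain ⟨C, hcub⟩ := hP.exists_eventually_cubic hν hK h hc
  obtain ⟨r, hr, δ₁, hδ₁, A, M, hpos, hneg, hA, hM, hasym⟩ :=
    exists_pitchfork hP.isOpen hP.zero_mem hP.contDiffOn_reducedQuotient hc.1 hc.2.1 heven hcub
  obtain ⟨b₁, hb₁, hbox₁⟩ := exists_box_of_eventually
    (huniq.and (heven.and ((hP.eventually_sign h).and hP.mem_nhds)))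
  set ρ := min r b₁
  have hρ : 0 < ρ := lt_min hr hb₁
  -- functions below `ε` have critical pairing below `c * ε`
  set c := 2 / (1 + ν ^ 2) * (1 + ν) with hc'
  have hc0 : 0 < c := by positivity
  set ε := min (min ε₀ (1 / 2)) (ρ / (2 * c))
  have hε : 0 < ε := lt_min (lt_min hε₀ one_half_pos) (by positivity)
  have hεc : c * ε < ρ := by
    have : ε ≤ ρ / (2 * c) := min_le_right _ _
    calc c * ε ≤ c * (ρ / (2 * c)) := by gcongr
      _ = ρ / 2 := by field_simp
      _ < ρ := half_lt_self hρ
  obtain ⟨b₂, hb₂, hbox₂⟩ := exists_box_of_eventually (hP.eventually_nearUniform hε)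
  -- profiles with amplitude below `η` belong to the neighbourhood
  set η := min ρ b₂
  have hη : 0 < η := lt_min hρ hb₂
  -- the last bound keeps `A t ≤ √(M t)` below `η`
  set δ := min (min δ₁ b₁) (min b₂ (η ^ 2 / (|M| + 1)))
  have hM0 : 0 < |M| + 1 := by positivity
  have hδ : 0 < δ := lt_min (lt_min hδ₁ hb₁) (lt_min hb₂ (by positivity))
  have d1 : δ ≤ δ₁ := (min_le_left _ _).trans (min_le_left _ _)
  have d2 : δ ≤ b₁ := (min_le_left _ _).trans (min_le_right _ _)
  have d3 : δ ≤ b₂ := (min_le_right _ _).trans (min_le_left _ _)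
  have d4 : δ ≤ η ^ 2 / (|M| + 1) := (min_le_right _ _).trans (min_le_right _ _)
  have hsub : Ioo 0 δ ⊆ Ioo 0 δ₁ := Ioo_subset_Ioo_right d1
  have hbox : ∀ p : ℝ × ℝ, |p.1| < ρ → |p.2| < δ → |p.1| < b₁ ∧ |p.2| < b₁ := fun p h1 h2 =>
    ⟨h1.trans_le (min_le_right _ _), h2.trans_le d2⟩
  refine ⟨O, P, W, ε, ρ, η, δ, A, M, ⟨hP, (min_le_left _ _).trans (min_le_right _ _), hη,
    min_le_left _ _, fun f g hf hg hfc hgc => ?_, fun p h1 h2 => ?_, fun p h1 h2 μ w l hs hn => ?_,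
    fun p h1 h2 => ?_, fun p h1 h2 => ?_, fun p h1 h2 => ?_, fun t ht => ?_,
    fun t ht a ha har => ?_⟩,
    hε, hδ, hA.mono hsub, fun t ht => hM t (hsub ht), hasym⟩
  · exact (abs_critPairing_le hν ξ₀ hf hg hfc hgc).trans_lt hεc
  · exact (hbox₁ p (hbox p h1 h2).1 (hbox p h1 h2).2).2.2.2
  · exact (hbox₁ p (hbox p h1 h2).1 (hbox p h1 h2).2).1 μ w l hs
      (hn.mono ((min_le_left _ _).trans (min_le_left _ _)))
  · exact (hbox₁ p (hbox p h1 h2).1 (hbox p h1 h2).2).2.1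
  · exact (hbox₁ p (hbox p h1 h2).1 (hbox p h1 h2).2).2.2.1
  · exact hbox₂ p (h1.trans_le (min_le_right _ _)) (h2.trans_le d3)
  · obtain ⟨h1, -, h3⟩ := hpos t (hsub ht)
    refine ⟨h1, lt_of_pow_lt_pow_left₀ 2 hη.le ?_, fun a ha har =>
      h3 a ha (har.trans_le (min_le_left _ _))⟩
    calc A t ^ 2 ≤ M * t := hM t (hsub ht)
      _ ≤ (|M| + 1) * t := mul_le_mul_of_nonneg_right (by linarith [le_abs_self M]) ht.1.le
      _ < (|M| + 1) * (η ^ 2 / (|M| + 1)) := mul_lt_mul_of_pos_left (ht.2.trans_le d4) hM0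
      _ = η ^ 2 := by field_simp
  · exact hneg t ⟨by linarith [ht.1], ht.2⟩ a ha (har.trans_le (min_le_left _ _))

namespace LocalModel

variable {ν : ℝ} {K : Space d → ℝ} {γc : ℝ} {ξ₀ : Fin d → ℤ} {O : Set (ℝ × ℝ)}
  {P W : ℝ × ℝ → (Fin d → ℤ) → ℝ} {ε ρ η δ : ℝ} {A : ℝ → ℝ}

theorem solves (H : LocalModel ν K γc ξ₀ O P W ε ρ η δ A) (hν : 0 < ν) (hK : IsKernel K)
    (h : SimpleCriticalPair ν K γc ξ₀) {a γ : ℝ} (ha : |a| < ρ) (hγ : |γ - γc| < δ) :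
    SolvesComplement ν K ξ₀ γ a (profileFun P (a, γ - γc)) (profileFun W (a, γ - γc))
        (profileConst W (a, γ - γc)) ∧
      reducedValue ν K ξ₀ γ (profileFun P (a, γ - γc)) (profileFun W (a, γ - γc))
        (profileConst W (a, γ - γc)) = a * reducedQuotient ν K γc ξ₀ P W (a, γ - γc) := by
  have := H.profile.solvesComplement hν hK h (H.mem (a, γ - γc) ha hγ)
  rwa [add_sub_cancel] at this

theorem eq_profile (H : LocalModel ν K γc ξ₀ O P W ε ρ η δ A) {a γ : ℝ} (ha : |a| < ρ)
    (hγ : |γ - γc| < δ) {μ w : Space d → ℝ} {l : ℝ} (hs : SolvesComplement ν K ξ₀ γ a μ w l)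
    (hn : NearUniform ε w (fun x => 1 + μ x) l) :
    μ = profileFun P (a, γ - γc) ∧ w = profileFun W (a, γ - γc) ∧
      l = profileConst W (a, γ - γc) :=
  H.unique (a, γ - γc) ha hγ μ w l (by rwa [add_sub_cancel]) hn

theorem abs_lt_of_pos (H : LocalModel ν K γc ξ₀ O P W ε ρ η δ A) {t : ℝ} (ht : t ∈ Ioo 0 δ) :
    |A t| < η ∧ |A t| < ρ ∧ |t| < δ := by
  obtain ⟨h1, h2, -⟩ := H.zero_pos t ht
  rw [abs_of_pos h1, abs_of_pos ht.1]
  exact ⟨h2, h2.trans_le H.eta_le, ht.2⟩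

theorem quotient_abs (H : LocalModel ν K γc ξ₀ O P W ε ρ η δ A) {a t : ℝ} (ha : |a| < ρ)
    (ht : |t| < δ) : reducedQuotient ν K γc ξ₀ P W (|a|, t) =
      reducedQuotient ν K γc ξ₀ P W (a, t) := by
  rcases abs_choice a with h | h
  · rw [h]
  · rw [h]; exact H.even (a, t) ha ht

/-- Zeros of the reduced bifurcation function for `t > 0`. -/
theorem zero_iff_of_pos (H : LocalModel ν K γc ξ₀ O P W ε ρ η δ A) {a t : ℝ} (ha : |a| < ρ)
    (ht : t ∈ Ioo 0 δ) : a * reducedQuotient ν K γc ξ₀ P W (a, t) = 0 ↔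
      a = 0 ∨ a = A t ∨ a = -A t := by
  have ht' := (H.abs_lt_of_pos ht).2.2
  rw [mul_eq_zero]
  by_cases h0 : a = 0
  · simp [h0]
  · rw [← H.quotient_abs ha ht', (H.zero_pos t ht).2.2 |a| (abs_pos.2 h0) ha,
      abs_eq (H.zero_pos t ht).1.le]

theorem zero_iff_of_nonpos (H : LocalModel ν K γc ξ₀ O P W ε ρ η δ A) {a t : ℝ} (ha : |a| < ρ)
    (ht : t ∈ Ioc (-δ) 0) : a * reducedQuotient ν K γc ξ₀ P W (a, t) = 0 ↔ a = 0 := by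
  have ht' : |t| < δ := by rw [abs_of_nonpos ht.2]; linarith [ht.1]
  refine ⟨fun h => ?_, fun h => by rw [h, zero_mul]⟩
  by_contra h0
  refine H.zero_nonpos t ht |a| (abs_pos.2 h0) ha ?_
  rw [H.quotient_abs ha ht']
  exact (mul_eq_zero.1 h).resolve_left h0

/-- The bifurcating solutions. -/
theorem isStationary (H : LocalModel ν K γc ξ₀ O P W ε ρ η δ A) (hν : 0 < ν) (hK : IsKernel K)
    (h : SimpleCriticalPair ν K γc ξ₀) {γ : ℝ} (hγ : γ - γc ∈ Ioo 0 δ) :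
    IsStationary ν K γ (profileFun W (A (γ - γc), γ - γc))
      (fun x => 1 + profileFun P (A (γ - γc), γ - γc) x)
      (profileConst W (A (γ - γc), γ - γc)) := by
  obtain ⟨-, h1, h2⟩ := H.abs_lt_of_pos hγ
  have s := H.solves hν hK h h1 h2
  refine s.1.isStationary hK ?_
  rw [s.2]
  exact (H.zero_iff_of_pos h1 hγ).2 (Or.inr (Or.inl rfl))

/-- Nontrivial phase-fixed solutions near the uniform equilibrium have amplitude `±A t`. -/
theorem classify (H : LocalModel ν K γc ξ₀ O P W ε ρ η δ A) (hν : 0 < ν) (hK : IsKernel K)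
    (h : SimpleCriticalPair ν K γc ξ₀) {γ : ℝ} (hγ : γ - γc ∈ Ioo 0 δ) {φ m : Space d → ℝ} {l : ℝ}
    (hs : IsStationary ν K γ φ m l) (hn : NearUniform ε φ m l)
    (hp : PhaseFixed ξ₀ fun x => m x - 1) (hne : ∃ x, m x ≠ 1) :
    ∃ a, (a = A (γ - γc) ∨ a = -A (γ - γc)) ∧ φ = profileFun W (a, γ - γc) ∧
      m = (fun x => 1 + profileFun P (a, γ - γc) x) ∧ l = profileConst W (a, γ - γc) := by
  obtain ⟨-, -, hγ'⟩ := H.abs_lt_of_pos hγ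
  obtain ⟨s1, s2⟩ := hs.solvesComplement hK hp
  set a := critPairing ν ξ₀ (fun x => m x - 1) φ
  have ha : |a| < ρ := H.amplitude_lt _ _ hn.2.1 hn.1
    (hs.contDiff_m.continuous.sub continuous_const) hs.contDiff_phi.continuous
  obtain ⟨e1, e2, e3⟩ := H.eq_profile ha hγ' s1 (by simpa only [add_sub_cancel] using hn)
  have em : m = fun x => 1 + profileFun P (a, γ - γc) x := by
    rw [← e1]; funext x; ring
  rw [e1, e2, e3, (H.solves hν hK h ha hγ').2] at s2
  rcases (H.zero_iff_of_pos ha hγ).1 s2 with h0 | h0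
  · obtain ⟨x, hx⟩ := hne
    refine (hx ?_).elim
    rw [em, profileFun_zero_fst P (p := (a, γ - γc)) h0]
    exact add_zero 1
  · exact ⟨a, h0, e2, em, e3⟩

/-- The sign condition selects the branch of positive amplitude. -/
theorem eq_branch (H : LocalModel ν K γc ξ₀ O P W ε ρ η δ A) (hν : 0 < ν) (hK : IsKernel K)
    (h : SimpleCriticalPair ν K γc ξ₀) {γ : ℝ} (hγ : γ - γc ∈ Ioo 0 δ) {φ m : Space d → ℝ} {l : ℝ}
    (hs : IsStationary ν K γ φ m l) (hn : NearUniform ε φ m l)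
    (hp : PhaseFixed ξ₀ fun x => m x - 1) (hsg : SignFixed ξ₀ fun x => m x - 1)
    (hne : ∃ x, m x ≠ 1) :
    φ = profileFun W (A (γ - γc), γ - γc) ∧
      m = (fun x => 1 + profileFun P (A (γ - γc), γ - γc) x) ∧
      l = profileConst W (A (γ - γc), γ - γc) := by
  obtain ⟨a, ha, e1, e2, e3⟩ := H.classify hν hK h hγ hs hn hp hne
  rcases ha with rfl | rfl
  · exact ⟨e1, e2, e3⟩
  · -- the branch of negative amplitude violates the sign condition
    exfalso
    obtain ⟨-, h1, h2⟩ := H.abs_lt_of_pos hγ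
    obtain ⟨c, hc, hce⟩ := H.sign (-A (γ - γc), γ - γc) (by rwa [abs_neg]) h2
    rw [SignFixed, e2] at hsg
    simp only [add_sub_cancel_left] at hsg
    rw [hce] at hsg
    have := mul_pos (H.zero_pos _ hγ).1 hc
    linarith

/-- Half-period shifts exchange the two branches. -/
theorem translate_half (H : LocalModel ν K γc ξ₀ O P W ε ρ η δ A) (hν : 0 < ν) (hK : IsKernel K)
    (h : SimpleCriticalPair ν K γc ξ₀) {γ : ℝ} (hγ : γ - γc ∈ Ioo 0 δ) {τ : Space d}
    (hτ : ∃ n : ℤ, inner ℝ (latt ξ₀) τ = (n : ℝ) + 1 / 2) :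
    translate τ (profileFun P (A (γ - γc), γ - γc)) = profileFun P (-A (γ - γc), γ - γc) ∧
      translate τ (profileFun W (A (γ - γc), γ - γc)) = profileFun W (-A (γ - γc), γ - γc) ∧
      profileConst W (A (γ - γc), γ - γc) = profileConst W (-A (γ - γc), γ - γc) := by
  obtain ⟨h0, h1, h2⟩ := H.abs_lt_of_pos hγ
  exact H.eq_profile (by rwa [abs_neg]) h2
    ((H.solves hν hK h h1 h2).1.translate_half hτ hK h.ne_zero).1
    ((H.near (A (γ - γc), γ - γc) h0 h2).translate τ)

theorem sign_branch (H : LocalModel ν K γc ξ₀ O P W ε ρ η δ A) {γ : ℝ} (hγ : γ - γc ∈ Ioo 0 δ) :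
    0 < torusIntegral fun x => profileFun P (A (γ - γc), γ - γc) x * cosMode ξ₀ x := by
  obtain ⟨-, h1, h2⟩ := H.abs_lt_of_pos hγ
  obtain ⟨c, hc, hce⟩ := H.sign (A (γ - γc), γ - γc) h1 h2
  rw [hce]
  exact mul_pos (H.zero_pos _ hγ).1 hc

end LocalModel

/-! ### Asymptotics along the branch -/

theorem tendsto_sub_nhdsGT (c : ℝ) : Tendsto (fun γ => γ - c) (𝓝[>] c) (𝓝[>] 0) := by
  refine tendsto_nhdsWithin_iff.2 ⟨?_, ?_⟩
  · have : Continuous fun γ => γ - c := by fun_prop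
    simpa using (this.tendsto c).mono_left nhdsWithin_le_nhds
  · filter_upwards [self_mem_nhdsWithin] with γ hγ using sub_pos.2 (mem_Ioi.1 hγ)

theorem tendsto_zero_of_sq_le {A : ℝ → ℝ} {M δ : ℝ} (hδ : 0 < δ)
    (hM : ∀ t ∈ Ioo 0 δ, A t ^ 2 ≤ M * t) : Tendsto A (𝓝[>] 0) (𝓝 0) := by
  have h1 : Tendsto (fun t => √(M * t)) (𝓝[>] 0) (𝓝 0) := by
    have : Continuous fun t => √(M * t) := by fun_prop
    simpa using (this.tendsto 0).mono_left nhdsWithin_le_nhds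
  refine squeeze_zero_norm' ?_ h1
  filter_upwards [Ioo_mem_nhdsGT hδ] with t ht using Real.abs_le_sqrt (hM t ht)

section Asymptotics

variable {O : Set (ℝ × ℝ)} {P : ℝ × ℝ → (Fin d → ℤ) → ℝ} {A : ℝ → ℝ} {M δ : ℝ}

theorem tendsto_branchPoint (hδ : 0 < δ) (hM : ∀ t ∈ Ioo 0 δ, A t ^ 2 ≤ M * t) (γc : ℝ) :
    Tendsto (fun γ => (A (γ - γc), γ - γc)) (𝓝[>] γc) (𝓝 (0 : ℝ × ℝ)) :=
  ((tendsto_zero_of_sq_le hδ hM).comp (tendsto_sub_nhdsGT γc)).prodMk_nhds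
    (tendsto_nhds_of_tendsto_nhdsWithin (tendsto_sub_nhdsGT γc))

theorem SmoothFamily.tendsto_sobolevNorm (hP : SmoothFamily O P) (hO : O ∈ 𝓝 (0 : ℝ × ℝ))
    (hδ : 0 < δ) (hM : ∀ t ∈ Ioo 0 δ, A t ^ 2 ≤ M * t) (γc s : ℝ) :
    Tendsto (fun γ => sobolevNorm s (profileFun P (A (γ - γc), γ - γc))) (𝓝[>] γc) (𝓝 0) := by
  obtain ⟨C, hC⟩ := hP.exists_sobolevNorm_le hO s
  have h1 : Tendsto (fun γ => ENNReal.ofReal (C * |A (γ - γc)|)) (𝓝[>] γc) (𝓝 0) := by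
    have h2 := ((tendsto_zero_of_sq_le hδ hM).comp (tendsto_sub_nhdsGT γc)).abs.const_mul C
    simpa using ENNReal.tendsto_ofReal h2
  refine tendsto_of_tendsto_of_tendsto_of_le_of_le' tendsto_const_nhds h1
    (Eventually.of_forall fun _ => zero_le) ?_
  filter_upwards [(tendsto_branchPoint hδ hM γc).eventually hC] with γ h using h.1

/-- Replacing the profile by its value at zero costs `|A| ‖(A, t)‖`, which is of order
`A² + |A| t = O(t)`. -/
theorem SmoothFamily.exists_remainder_le (hP : SmoothFamily O P) (hO : O ∈ 𝓝 (0 : ℝ × ℝ))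
    (hδ : 0 < δ) (hM : ∀ t ∈ Ioo 0 δ, A t ^ 2 ≤ M * t) (γc s : ℝ) :
    ∃ C, ∀ᶠ γ in 𝓝[>] γc,
      sobolevNorm s (fun x => profileFun P (A (γ - γc), γ - γc) x -
        A (γ - γc) * trigSeries true (P 0) x) ≤ ENNReal.ofReal (C * (γ - γc)) := by
  obtain ⟨C, hC⟩ := hP.exists_sobolevNorm_le hO s
  refine ⟨|C| * (M + 1), ?_⟩
  filter_upwards [(tendsto_branchPoint hδ hM γc).eventually hC,
    (tendsto_sub_nhdsGT γc).eventually (Ioo_mem_nhdsGT hδ),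
    ((tendsto_zero_of_sq_le hδ hM).comp (tendsto_sub_nhdsGT γc)).eventually
      (eventually_abs_lt one_pos)] with γ h1 h2 h3
  refine h1.2.trans (ENNReal.ofReal_le_ofReal ?_)
  set t := γ - γc
  have h4 : ‖((A t, t) : ℝ × ℝ)‖ ≤ |A t| + t := by
    rw [Prod.norm_def]
    refine max_le ?_ ?_
    · rw [Real.norm_eq_abs]; linarith [h2.1]
    · rw [Real.norm_eq_abs, abs_of_pos h2.1]; linarith [abs_nonneg (A t)]
  have h5 : |A t| * ‖((A t, t) : ℝ × ℝ)‖ ≤ (M + 1) * t := by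
    refine (mul_le_mul_of_nonneg_left h4 (abs_nonneg _)).trans ?_
    have h6 : |A t| * t ≤ 1 * t := mul_le_mul_of_nonneg_right (le_of_lt h3) h2.1.le
    have h7 := hM t h2
    rw [mul_add, ← pow_two, sq_abs]
    linarith
  have h8 : 0 ≤ |A t| * ‖((A t, t) : ℝ × ℝ)‖ := mul_nonneg (abs_nonneg _) (norm_nonneg _)
  calc C * (|A t| * ‖((A t, t) : ℝ × ℝ)‖) ≤ |C| * (|A t| * ‖((A t, t) : ℝ × ℝ)‖) :=
        mul_le_mul_of_nonneg_right (le_abs_self C) h8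
    _ ≤ |C| * ((M + 1) * t) := mul_le_mul_of_nonneg_left h5 (abs_nonneg C)
    _ = _ := by ring

end Asymptotics

end MFGTorus

end

theorem mainTheorem2 (d : ℕ) (ν : ℝ) (hν : 0 < ν)
    (K : MFGTorus.Space d → ℝ) (hK : MFGTorus.IsKernel K)
    (γc : ℝ) (ξ₀ : Fin d → ℤ) (hcrit : MFGTorus.SimpleCriticalPair ν K γc ξ₀)
    (α β : ℝ) (hcubic : MFGTorus.CubicReducedEquation ν K ξ₀ γc α β) :
    ∃ (δ ε : ℝ) (m φ : ℝ → MFGTorus.Space d → ℝ) (lam A : ℝ → ℝ), 0 < δ ∧ 0 < ε ∧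
      -- the branch is smooth in `(γ, x)`
      ContDiffOn ℝ ∞ (fun p : ℝ × MFGTorus.Space d => m p.1 p.2) (Ioo γc (γc + δ) ×ˢ univ) ∧
      ContDiffOn ℝ ∞ (fun p : ℝ × MFGTorus.Space d => φ p.1 p.2) (Ioo γc (γc + δ) ×ˢ univ) ∧
      ContDiffOn ℝ ∞ lam (Ioo γc (γc + δ)) ∧
      ContDiffOn ℝ ∞ A (Ioo γc (γc + δ)) ∧
      -- it consists of nontrivial phase-fixed solutions, with critical amplitude `A γ > 0`
      (∀ γ ∈ Ioo γc (γc + δ),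
        MFGTorus.IsStationary ν K γ (φ γ) (m γ) (lam γ) ∧
        MFGTorus.NearUniform ε (φ γ) (m γ) (lam γ) ∧
        MFGTorus.PhaseFixed ξ₀ (fun x => m γ x - 1) ∧
        MFGTorus.SignFixed ξ₀ (fun x => m γ x - 1) ∧
        A γ = MFGTorus.critPairing ν ξ₀ (fun x => m γ x - 1) (φ γ) ∧
        0 < A γ ∧ ∃ x, m γ x ≠ 1) ∧
      -- it bifurcates from the uniform equilibrium
      (∀ s : ℝ, 0 ≤ s →
        Tendsto (fun γ => MFGTorus.sobolevNorm s (fun x => m γ x - 1)) (𝓝[>] γc) (𝓝 0) ∧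
        Tendsto (fun γ => MFGTorus.sobolevNorm s (φ γ)) (𝓝[>] γc) (𝓝 0)) ∧
      Tendsto lam (𝓝[>] γc) (𝓝 0) ∧
      -- the expansion of the amplitude and of the density
      (fun γ => A γ - √(α / β) * √(γ - γc)) =O[𝓝[>] γc] (fun γ => γ - γc) ∧
      (∀ s : ℝ, 0 ≤ s → ∃ C : ℝ, ∀ᶠ γ in 𝓝[>] γc,
        MFGTorus.sobolevNorm s (fun x => m γ x - (1 + A γ * MFGTorus.cosMode ξ₀ x)) ≤
          ENNReal.ofReal (C * (γ - γc))) ∧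
      -- translates are solutions with positive density
      (∀ γ ∈ Ioo γc (γc + δ), ∀ τ : MFGTorus.Space d,
        MFGTorus.IsStationary ν K γ (MFGTorus.translate τ (φ γ)) (MFGTorus.translate τ (m γ))
          (lam γ) ∧
        ∀ x, 0 < MFGTorus.translate τ (m γ) x) ∧
      -- local uniqueness in the phase-fixed space
      (∀ γ ∈ Ioo γc (γc + δ), ∀ (φ' m' : MFGTorus.Space d → ℝ) (l' : ℝ),
        MFGTorus.IsStationary ν K γ φ' m' l' → MFGTorus.NearUniform ε φ' m' l' →
        MFGTorus.PhaseFixed ξ₀ (fun x => m' x - 1) → MFGTorus.SignFixed ξ₀ (fun x => m' x - 1) →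
        (∃ x, m' x ≠ 1) → φ' = φ γ ∧ m' = m γ ∧ l' = lam γ) ∧
      -- without the phase condition: translations generate all nontrivial solutions
      (∀ γ ∈ Ioo γc (γc + δ), ∀ (φ' m' : MFGTorus.Space d → ℝ) (l' : ℝ),
        MFGTorus.IsStationary ν K γ φ' m' l' → MFGTorus.NearUniform ε φ' m' l' →
        (∃ x, m' x ≠ 1) →
        ∃ τ : MFGTorus.Space d,
          φ' = MFGTorus.translate τ (φ γ) ∧ m' = MFGTorus.translate τ (m γ) ∧ l' = lam γ) ∧
      -- half-period shifts exchange the two signs of the amplitude, and without the sign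
      -- convention the branch and its half-period shift are the only nontrivial solutions
      (∀ γ ∈ Ioo γc (γc + δ), ∀ τ : MFGTorus.Space d,
        (∃ n : ℤ, inner ℝ (MFGTorus.latt ξ₀) τ = (n : ℝ) + 1 / 2) →
        MFGTorus.PhaseFixed ξ₀ (fun x => MFGTorus.translate τ (m γ) x - 1) ∧
        MFGTorus.critPairing ν ξ₀ (fun x => MFGTorus.translate τ (m γ) x - 1)
          (MFGTorus.translate τ (φ γ)) = -A γ ∧
        ∀ (φ' m' : MFGTorus.Space d → ℝ) (l' : ℝ),
          MFGTorus.IsStationary ν K γ φ' m' l' → MFGTorus.NearUniform ε φ' m' l' →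
          MFGTorus.PhaseFixed ξ₀ (fun x => m' x - 1) → (∃ x, m' x ≠ 1) →
          l' = lam γ ∧ ((φ' = φ γ ∧ m' = m γ) ∨
            (φ' = MFGTorus.translate τ (φ γ) ∧ m' = MFGTorus.translate τ (m γ)))) ∧
      -- the reduced amplitude equation is of supercritical pitchfork type
      ∃ η > 0, ∃ Ψ : ℝ → ℝ → ℝ, MFGTorus.IsReducedFunction ν K ξ₀ γc ε η δ Ψ ∧
        (∀ a γ : ℝ, |a| < η → |γ - γc| < δ → Ψ (-a) γ = -Ψ a γ) ∧
        (∀ a γ : ℝ, |a| < η → γc - δ < γ → γ ≤ γc → (Ψ a γ = 0 ↔ a = 0)) ∧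
        (∀ γ ∈ Ioo γc (γc + δ), A γ < η ∧
          ∀ a : ℝ, |a| < η → (Ψ a γ = 0 ↔ a = 0 ∨ a = A γ ∨ a = -A γ)) := by
  obtain ⟨O, P, W, ε, ρ, η, δ, A, M, H, hε, hδ, hA, hM, hasym⟩ :=
    MFGTorus.exists_localModel hν hK hcrit hcubic
  have hPO := H.profile.mem_nhds
  have hshift : ∀ γ ∈ Ioo γc (γc + δ), γ - γc ∈ Ioo 0 δ := fun γ hγ =>
    ⟨by linarith [hγ.1], by linarith [hγ.2]⟩
  have hmem : ∀ γ ∈ Ioo γc (γc + δ), (A (γ - γc), γ - γc) ∈ O := fun γ hγ =>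
    H.mem _ (H.abs_lt_of_pos (hshift γ hγ)).2.1 (H.abs_lt_of_pos (hshift γ hγ)).2.2
  have hsub : ContDiff ℝ ∞ fun γ : ℝ => γ - γc := contDiff_id.sub contDiff_const
  have hA' : ContDiffOn ℝ ∞ (fun γ => A (γ - γc)) (Ioo γc (γc + δ)) :=
    hA.comp hsub.contDiffOn hshift
  have hpt : ContDiffOn ℝ ∞ (fun γ => (A (γ - γc), γ - γc)) (Ioo γc (γc + δ)) :=
    hA'.prodMk hsub.contDiffOn
  have hjoint : ContDiffOn ℝ ∞
      (fun p : ℝ × MFGTorus.Space d => ((A (p.1 - γc), p.1 - γc), p.2))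
      (Ioo γc (γc + δ) ×ˢ univ) :=
    (hpt.comp contDiff_fst.contDiffOn fun p hp => hp.1).prodMk contDiff_snd.contDiffOn
  have hmaps : MapsTo (fun p : ℝ × MFGTorus.Space d => ((A (p.1 - γc), p.1 - γc), p.2))
      (Ioo γc (γc + δ) ×ˢ univ) (O ×ˢ univ) := fun p hp => ⟨hmem p.1 hp.1, mem_univ _⟩
  have hnear : ∀ γ ∈ Ioo γc (γc + δ), MFGTorus.NearUniform ε
      (MFGTorus.profileFun W (A (γ - γc), γ - γc))
      (fun x => 1 + MFGTorus.profileFun P (A (γ - γc), γ - γc) x)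
      (MFGTorus.profileConst W (A (γ - γc), γ - γc)) := fun γ hγ =>
    H.near _ (H.abs_lt_of_pos (hshift γ hγ)).1 (H.abs_lt_of_pos (hshift γ hγ)).2.2
  have hstat := fun γ (hγ : γ ∈ Ioo γc (γc + δ)) => H.isStationary hν hK hcrit (hshift γ hγ)
  have hsolve := fun γ (hγ : γ ∈ Ioo γc (γc + δ)) => (H.solves hν hK hcrit
    (H.abs_lt_of_pos (hshift γ hγ)).2.1 (H.abs_lt_of_pos (hshift γ hγ)).2.2).1
  refine ⟨δ, ε, fun γ x => 1 + MFGTorus.profileFun P (A (γ - γc), γ - γc) x,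
    fun γ => MFGTorus.profileFun W (A (γ - γc), γ - γc),
    fun γ => MFGTorus.profileConst W (A (γ - γc), γ - γc), fun γ => A (γ - γc), hδ, hε,
    contDiffOn_const.add (H.profile.smoothP.contDiffOn_profileFun.comp hjoint hmaps),
    H.profile.smoothW.contDiffOn_profileFun.comp hjoint hmaps,
    H.profile.contDiffOn_profileConst.comp hpt hmem, hA', fun γ hγ => ?_, fun s _ => ⟨?_, ?_⟩,
    H.profile.tendsto_profileConst.comp (MFGTorus.tendsto_branchPoint hδ hM γc),
    hasym.comp_tendsto (MFGTorus.tendsto_sub_nhdsGT γc), fun s _ => ?_, fun γ hγ τ => ?_,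
    fun γ hγ φ' m' l' hs hn hp hsg hne => ?_, fun γ hγ φ' m' l' hs hn hne => ?_,
    fun γ hγ τ hτ => ⟨?_, ?_, fun φ' m' l' hs hn hp hne => ?_⟩, η, H.eta_pos,
    fun a γ => a * MFGTorus.reducedQuotient ν K γc ξ₀ P W (a, γ - γc), fun a γ ha hγ => ?_,
    fun a γ ha hγ => ?_, fun a γ ha h1 h2 => ?_, fun γ hγ => ⟨?_, fun a ha => ?_⟩⟩
  -- the branch consists of nontrivial phase-fixed solutions
  · have hs := hsolve γ hγ
    have hpos := H.sign_branch (hshift γ hγ)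
    simp only [add_sub_cancel_left]
    refine ⟨hstat γ hγ, hnear γ hγ, hs.phaseFixed, hpos.le, hs.amplitude.symm,
      (H.zero_pos _ (hshift γ hγ)).1, ?_⟩
    by_contra! hall
    have h0 : ∀ x, MFGTorus.profileFun P (A (γ - γc), γ - γc) x = 0 := fun x => by
      linarith [hall x]
    simp [h0, MFGTorus.torusIntegral] at hpos
  -- convergence to the uniform equilibrium
  · simp only [add_sub_cancel_left]
    exact H.profile.smoothP.tendsto_sobolevNorm hPO hδ hM γc s
  · exact H.profile.smoothW.tendsto_sobolevNorm hPO hδ hM γc s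
  -- the profile at zero is `cos (2π ξ₀·x)`
  · obtain ⟨C, hC⟩ := H.profile.smoothP.exists_remainder_le hPO hδ hM γc s
    refine ⟨C, ?_⟩
    rw [H.profile.cosSeries_zero hcrit.ne_zero] at hC
    simpa only [add_sub_add_left_eq_sub] using hC
  -- the density is positive because it differs from `1` by less than `ε ≤ 1/2`
  · refine ⟨(hstat γ hγ).translate hK τ, fun x => ?_⟩
    have h1 := (hnear γ hγ).2.1.abs_lt (x + τ)
    have h2 := (abs_lt.1 h1).1
    have h3 := H.eps_le
    change 0 < 1 + MFGTorus.profileFun P (A (γ - γc), γ - γc) (x + τ)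
    linarith
  · exact H.eq_branch hν hK hcrit (hshift γ hγ) hs hn hp hsg hne
  -- a translate of the given solution satisfies the phase and sign conditions
  · obtain ⟨⟨-, hc⟩, ⟨-, hper⟩, -⟩ := (MFGTorus.isStationary_iff hK).1 hs
    obtain ⟨τ, h1, h2⟩ := MFGTorus.exists_translate_phaseFixed hcrit.ne_zero hper hc.continuous
    obtain ⟨x, hx⟩ := hne
    obtain ⟨e1, e2, e3⟩ := H.eq_branch hν hK hcrit (hshift γ hγ) (hs.translate hK τ)
      (hn.translate τ) h1 h2 ⟨x - τ, by simpa [MFGTorus.translate] using hx⟩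
    refine ⟨-τ, ?_, ?_, e3⟩
    · exact (MFGTorus.translate_translate_neg τ φ').symm.trans (congrArg _ e1)
    · exact (MFGTorus.translate_translate_neg τ m').symm.trans (congrArg _ e2)
  · have hs := hsolve γ hγ
    have := hs.phaseFixed.translate_half hτ hs.periodic_mu hs.contDiff_mu.continuous
    rwa [← MFGTorus.translate_one_add_sub_one] at this
  · have hs := hsolve γ hγ
    have := (hs.translate_half hτ hK hcrit.ne_zero).1.amplitude
    rwa [← MFGTorus.translate_one_add_sub_one] at this
  -- without the sign condition the amplitude is `A` or `-A`, and the latter is the shifted branch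
  · obtain ⟨h1, h2, h3⟩ := H.translate_half hν hK hcrit (hshift γ hγ) hτ
    obtain ⟨a, ha, e1, e2, e3⟩ := H.classify hν hK hcrit (hshift γ hγ) hs hn hp hne
    rcases ha with rfl | rfl
    · exact ⟨e3, Or.inl ⟨e1, e2⟩⟩
    · refine ⟨e3.trans h3.symm, Or.inr ⟨e1.trans h2.symm, e2.trans ?_⟩⟩
      rw [← h1]
      rfl
  -- the reduced function is `a` times the reduced quotient
  · have ha' := ha.trans_le H.eta_le
    obtain ⟨s1, s2⟩ := H.solves hν hK hcrit ha' hγ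
    refine ⟨⟨_, _, _, s1, H.near (a, γ - γc) ha hγ⟩, fun μ w l hs hn => ?_⟩
    obtain ⟨rfl, rfl, rfl⟩ := H.eq_profile ha' hγ hs hn
    exact s2
  · have := H.even (a, γ - γc) (ha.trans_le H.eta_le) hγ
    change -a * _ = -(a * _)
    rw [this, neg_mul]
  · exact H.zero_iff_of_nonpos (ha.trans_le H.eta_le) ⟨by linarith, by linarith⟩
  · exact (H.zero_pos _ (hshift γ hγ)).2.1
  · exact H.zero_iff_of_pos (ha.trans_le H.eta_le) (hshift γ hγ)
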